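/- Let $n,r\ge 0$ be integers, $\rho\ge 0$, $A,C\in\mathbb R^{n\times n}$, $B,D\in\mathbb R^{n\times r}$, and let $Q\in\mathbb R^{n\times n}$, $R\in\mathbb R^{r\times r}$ be symmetric. Let $W$ be a standard one-dimensional Brownian motion on a filtered probability space $(\Omega,(\mathcal F_t)_{t\ge 0},\mathbb P)$. Let $C_{\rho/2}([0,\infty),\mathbb R^k)$ be the space of continuous functions $f:[0,\infty)\to\mathbb R^k$ with $\int_0^\infty e^{-\rho t}\|f(t)\|^2\,dt<\infty$. Assume: (A3) The system $dx=(Ax+Bu)\,dt+(Cx+Du)\,dW$ is $\rho$-stabilizable: there is a matrix $K\in\mathbb R^{r\times n}$ such that for every initial state $x(0)\in\mathbb R^n$ the solution of $dx=(A+BK)x\,dt+(C+DK)x\,dW$ satisfies $\mathbb E\int_0^\infty e^{-\rho t}\|x(t)\|^2\,dt<\infty$. (A4) $R>0$, $Q\ge 0$, and $[A-\frac{\rho}{2}I,\,C,\,\sqrt Q]$ is exactly detectable: for every initial state $z(0)\in\mathbb R^n$, if the solution $z$ of $dz=(A-\frac{\rho}{2}I)z\,dt+Cz\,dW$ satisfies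 $\sqrt Q\,z(t)=0$ for all $t\ge 0$ almost surely, then $\lim_{t\to\infty}\mathbb E\|z(t)\|^2=0$. Then the algebraic Riccati equation $$\rho P=A^TP+PA+C^TPC+Q-(B^TP+D^TPC)^T(R+D^TPD)^{-1}(B^TP+D^TPC)$$ has a positive semidefinite solution. Moreover, let $P$ be a positive semidefinite solution of it, put $\bar A=A-B(R+D^TPD)^{-1}(B^TP+D^TPC)$, and suppose that the matrix $$M=\begin{pmatrix}\bar A-\frac{\rho}{2}I & B(R+D^TPD)^{-1}B^T\\ -Q & -\bar A^T+\frac{\rho}{2}I\end{pmatrix}$$ has no eigenvalue with zero real part. Then for every $\bar x_0\in\mathbb R^n$ there is exactly one pair $(s,\bar x)\in C_{\rho/2}([0,\infty),\mathbb R^{2n})$ of differentiable functions that satisfies, for all $t\ge 0$, $$\rho s(t)=\frac{ds}{dt}(t)+\bar A^Ts(t)-Q\bar x(t),\qquad \frac{d\bar x}{dt}(t)=\bar A\bar x(t)-B(R+D^TPD)^{-1}B^Ts(t),\qquad \bar x(0)=\bar x_0,$$ where $s(0)$ is not prescribed. -/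

import Mathlib

open MeasureTheory ProbabilityTheory Filter Topology Set
open scoped NNReal ENNReal Matrix MatrixOrder Matrix.Norms.L2Operator

noncomputable section

/-! ### Brownian motion relative to a filtration and the Itô integral -/

/-- `W` is a standard one-dimensional Brownian motion relative to the filtration `ℱ`: it is a
Brownian motion, it is adapted, and its increments after `s` are independent of `ℱ s`. -/
structure IsFilteredBrownian {Ω : Type*} {m : MeasurableSpace Ω} (μ : Measure Ω)
    (ℱ : Filtration ℝ≥0 m) (W : ℝ≥0 → Ω → ℝ) : Prop where
  brownian : IsBrownianReal W μ
  adapted : StronglyAdapted ℱ W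
  indep_increment : ∀ s t : ℝ≥0, s ≤ t →
    Indep (MeasurableSpace.comap (fun ω => W t ω - W s ω) inferInstance) (ℱ s) μ

/-- Bounded simple adapted processes
`∑ k < card, value k · 1_{(time k, time (k+1)]}`, with `value k` being `ℱ (time k)`-measurable. -/
structure SimpleProcess {Ω : Type*} {m : MeasurableSpace Ω} (ℱ : Filtration ℝ≥0 m)
    (E : Type*) [NormedAddCommGroup E] where
  card : ℕ
  time : ℕ → ℝ≥0
  time_mono : Monotone time
  value : ℕ → Ω → E
  measurable_value : ∀ k, StronglyMeasurable[ℱ (time k)] (value k)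
  bounded_value : ∃ c : ℝ, ∀ k ω, ‖value k ω‖ ≤ c

namespace SimpleProcess

variable {Ω : Type*} {m : MeasurableSpace Ω} {ℱ : Filtration ℝ≥0 m}
  {E : Type*} [NormedAddCommGroup E] [NormedSpace ℝ E]

/-- The simple process as a function of time and chance. -/
def eval (ψ : SimpleProcess ℱ E) (t : ℝ≥0) (ω : Ω) : E :=
  ∑ k ∈ Finset.range ψ.card,
    (Ioc (ψ.time k) (ψ.time (k + 1))).indicator (fun _ => ψ.value k ω) t

/-- The elementary stochastic integral `∫₀ᵗ ψ dW` of a simple process. -/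
def integral (ψ : SimpleProcess ℱ E) (W : ℝ≥0 → Ω → ℝ) (t : ℝ≥0) (ω : Ω) : E :=
  ∑ k ∈ Finset.range ψ.card,
    (W (min (ψ.time (k + 1)) t) ω - W (min (ψ.time k) t) ω) • ψ.value k ω

end SimpleProcess

/-- `I` is (a version of) the Itô integral `∫₀ᵗ φ dW`: the `L²(μ)`-limit of the elementary
integrals of simple processes which converge to `φ` in `L²(μ ⊗ ds)` on `Ω × [0, t]`. -/
def IsItoIntegral {Ω : Type*} {m : MeasurableSpace Ω} (μ : Measure Ω) (ℱ : Filtration ℝ≥0 m)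
    (W : ℝ≥0 → Ω → ℝ) {E : Type*} [NormedAddCommGroup E] [NormedSpace ℝ E]
    (φ : ℝ≥0 → Ω → E) (t : ℝ≥0) (I : Ω → E) : Prop :=
  AEStronglyMeasurable I μ ∧
  ∃ ψ : ℕ → SimpleProcess ℱ E,
    Tendsto (fun j => ∫⁻ ω, ∫⁻ s in Icc (0 : ℝ) t,
        ‖(ψ j).eval s.toNNReal ω - φ s.toNNReal ω‖ₑ ^ 2 ∂volume ∂μ)
      atTop (𝓝 0) ∧
    Tendsto (fun j => ∫⁻ ω, ‖(ψ j).integral W t ω - I ω‖ₑ ^ 2 ∂μ) atTop (𝓝 0)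

/-! ### Linear stochastic systems -/

/-- The action of a square matrix on Euclidean space. -/
abbrev act {n : ℕ} (A : Matrix (Fin n) (Fin n) ℝ) :
    EuclideanSpace ℝ (Fin n) →L[ℝ] EuclideanSpace ℝ (Fin n) :=
  Matrix.toEuclideanCLM (𝕜 := ℝ) A

/-- `x` is a solution of `dx = A x dt + C x dW`, `x(0) = x₀`: it is progressively measurable, has
almost surely continuous paths, is square integrable on `Ω × [0, T]` for each `T`, and
`x(t) = x₀ + ∫₀ᵗ A x ds + ∫₀ᵗ C x dW` almost surely for each `t`. -/
structure IsLinearSDESolution {Ω : Type*} {m : MeasurableSpace Ω} (μ : Measure Ω)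
    (ℱ : Filtration ℝ≥0 m) (W : ℝ≥0 → Ω → ℝ) {n : ℕ} (A C : Matrix (Fin n) (Fin n) ℝ)
    (x₀ : EuclideanSpace ℝ (Fin n)) (x : ℝ≥0 → Ω → EuclideanSpace ℝ (Fin n)) : Prop where
  progressive : IsStronglyProgressive ℱ x
  continuous_paths : ∀ᵐ ω ∂μ, Continuous fun t => x t ω
  sq_integrable : ∀ T : ℝ≥0, ∫⁻ ω, ∫⁻ s in Icc (0 : ℝ) T, ‖x s.toNNReal ω‖ₑ ^ 2 ∂volume ∂μ < ∞
  initial : ∀ᵐ ω ∂μ, x 0 ω = x₀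
  equation : ∀ t : ℝ≥0, IsItoIntegral μ ℱ W (fun s ω => act C (x s ω)) t
    (fun ω => x t ω - x₀ - ∫ s in (0 : ℝ)..t, act A (x s.toNNReal ω))

/-- `ρ`-stabilizability of `dx = (A x + B u) dt + (C x + D u) dW`: for some feedback `u = K x` and
every initial state, the closed-loop state satisfies `E ∫₀^∞ e^{-ρ t} ‖x(t)‖² dt < ∞`. -/
def IsRhoStabilizable {Ω : Type*} {m : MeasurableSpace Ω} (μ : Measure Ω)
    (ℱ : Filtration ℝ≥0 m) (W : ℝ≥0 → Ω → ℝ) {n r : ℕ} (ρ : ℝ)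
    (A : Matrix (Fin n) (Fin n) ℝ) (B : Matrix (Fin n) (Fin r) ℝ)
    (C : Matrix (Fin n) (Fin n) ℝ) (D : Matrix (Fin n) (Fin r) ℝ) : Prop :=
  ∃ K : Matrix (Fin r) (Fin n) ℝ, ∀ x₀ : EuclideanSpace ℝ (Fin n),
    ∃ x : ℝ≥0 → Ω → EuclideanSpace ℝ (Fin n),
      IsLinearSDESolution μ ℱ W (A + B * K) (C + D * K) x₀ x ∧
      ∫⁻ ω, ∫⁻ t in Ici (0 : ℝ),
        ENNReal.ofReal (Real.exp (-ρ * t)) * ‖x t.toNNReal ω‖ₑ ^ 2 ∂volume ∂μ < ∞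

/-- Exact detectability of `dz = A z dt + C z dW`, `y = H z`: for every initial state, if the output
vanishes almost surely at all times, then `E ‖z(t)‖² → 0` as `t → ∞`. -/
def IsExactlyDetectable {Ω : Type*} {m : MeasurableSpace Ω} (μ : Measure Ω)
    (ℱ : Filtration ℝ≥0 m) (W : ℝ≥0 → Ω → ℝ) {n : ℕ}
    (A C H : Matrix (Fin n) (Fin n) ℝ) : Prop :=
  ∀ (z₀ : EuclideanSpace ℝ (Fin n)) (z : ℝ≥0 → Ω → EuclideanSpace ℝ (Fin n)),
    IsLinearSDESolution μ ℱ W A C z₀ z →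
    (∀ᵐ ω ∂μ, ∀ t : ℝ≥0, act H (z t ω) = 0) →
    Tendsto (fun t : ℝ≥0 => ∫⁻ ω, ‖z t ω‖ₑ ^ 2 ∂μ) atTop (𝓝 0)

/-! ### The Riccati equation and the consistency equations -/

/-- `P` is a positive semidefinite solution of
`ρ P = Aᵀ P + P A + Cᵀ P C + Q - (Bᵀ P + Dᵀ P C)ᵀ (R + Dᵀ P D)⁻¹ (Bᵀ P + Dᵀ P C)`. -/
def IsRiccatiSolution {n r : ℕ} (ρ : ℝ)
    (A : Matrix (Fin n) (Fin n) ℝ) (B : Matrix (Fin n) (Fin r) ℝ)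
    (C : Matrix (Fin n) (Fin n) ℝ) (D : Matrix (Fin n) (Fin r) ℝ)
    (Q : Matrix (Fin n) (Fin n) ℝ) (R : Matrix (Fin r) (Fin r) ℝ)
    (P : Matrix (Fin n) (Fin n) ℝ) : Prop :=
  P.PosSemidef ∧
  ρ • P = Aᵀ * P + P * A + Cᵀ * P * C + Q
    - (Bᵀ * P + Dᵀ * P * C)ᵀ * (R + Dᵀ * P * D)⁻¹ * (Bᵀ * P + Dᵀ * P * C)

/-- `Ā = A - B (R + Dᵀ P D)⁻¹ (Bᵀ P + Dᵀ P C)`. -/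
def closedLoopMatrix {n r : ℕ}
    (A : Matrix (Fin n) (Fin n) ℝ) (B : Matrix (Fin n) (Fin r) ℝ)
    (C : Matrix (Fin n) (Fin n) ℝ) (D : Matrix (Fin n) (Fin r) ℝ)
    (R : Matrix (Fin r) (Fin r) ℝ) (P : Matrix (Fin n) (Fin n) ℝ) : Matrix (Fin n) (Fin n) ℝ :=
  A - B * (R + Dᵀ * P * D)⁻¹ * (Bᵀ * P + Dᵀ * P * C)

/-- `B (R + Dᵀ P D)⁻¹ Bᵀ`. -/
def inputMatrix {n r : ℕ}
    (B D : Matrix (Fin n) (Fin r) ℝ)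
    (R : Matrix (Fin r) (Fin r) ℝ) (P : Matrix (Fin n) (Fin n) ℝ) : Matrix (Fin n) (Fin n) ℝ :=
  B * (R + Dᵀ * P * D)⁻¹ * Bᵀ

/-- The matrix
`M = [[Ā - (ρ/2) I, B (R + Dᵀ P D)⁻¹ Bᵀ], [-Q, -Āᵀ + (ρ/2) I]]`. -/
def hamiltonianMatrix {n r : ℕ} (ρ : ℝ)
    (A : Matrix (Fin n) (Fin n) ℝ) (B : Matrix (Fin n) (Fin r) ℝ)
    (C : Matrix (Fin n) (Fin n) ℝ) (D : Matrix (Fin n) (Fin r) ℝ)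
    (Q : Matrix (Fin n) (Fin n) ℝ) (R : Matrix (Fin r) (Fin r) ℝ)
    (P : Matrix (Fin n) (Fin n) ℝ) : Matrix (Fin n ⊕ Fin n) (Fin n ⊕ Fin n) ℝ :=
  Matrix.fromBlocks
    (closedLoopMatrix A B C D R P - (ρ / 2) • (1 : Matrix (Fin n) (Fin n) ℝ))
    (inputMatrix B D R P)
    (-Q)
    (-(closedLoopMatrix A B C D R P)ᵀ + (ρ / 2) • (1 : Matrix (Fin n) (Fin n) ℝ))

/-- No complex eigenvalue of the real matrix `M` has zero real part. -/
def NoImaginaryAxisEigenvalue {ι : Type*} [Fintype ι] [DecidableEq ι] (M : Matrix ι ι ℝ) : Prop :=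
  ∀ z : ℂ, Module.End.HasEigenvalue (Matrix.toLin' (M.map (algebraMap ℝ ℂ))) z → z.re ≠ 0

/-- The space `C_{ρ/2}([0,∞), E)`: continuous functions `f` on `[0,∞)` with
`∫₀^∞ e^{-ρ t} ‖f(t)‖² dt < ∞`. A function on `[0,∞)` is represented by a function on `ℝ` whose
values at negative arguments are irrelevant. -/
def MemCHalfRho (ρ : ℝ) {E : Type*} [NormedAddCommGroup E] (f : ℝ → E) : Prop :=
  ContinuousOn f (Ici 0) ∧
  IntegrableOn (fun t : ℝ => Real.exp (-ρ * t) * ‖f t‖ ^ 2) (Ici 0) volume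

/-- `(s, xbar)` solves the consistency equations
`ρ s = ds/dt + Āᵀ s - Q xbar`, `d xbar/dt = Ā xbar - B (R + Dᵀ P D)⁻¹ Bᵀ s` on `[0,∞)`, with
`xbar(0) = xbar₀` (and `s(0)` free), and belongs to `C_{ρ/2}([0,∞), ℝ^{2n})`. -/
structure IsConsistencySolution {n r : ℕ} (ρ : ℝ)
    (A : Matrix (Fin n) (Fin n) ℝ) (B : Matrix (Fin n) (Fin r) ℝ)
    (C : Matrix (Fin n) (Fin n) ℝ) (D : Matrix (Fin n) (Fin r) ℝ)
    (Q : Matrix (Fin n) (Fin n) ℝ) (R : Matrix (Fin r) (Fin r) ℝ)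
    (P : Matrix (Fin n) (Fin n) ℝ) (xbar₀ : EuclideanSpace ℝ (Fin n))
    (s xbar : ℝ → EuclideanSpace ℝ (Fin n)) : Prop where
  mem : MemCHalfRho ρ (fun t => WithLp.toLp 2 (s t, xbar t))
  differentiable_s : DifferentiableOn ℝ s (Ici 0)
  differentiable_xbar : DifferentiableOn ℝ xbar (Ici 0)
  eq_s : ∀ t : ℝ, 0 ≤ t →
    ρ • s t = derivWithin s (Ici 0) t + act (closedLoopMatrix A B C D R P)ᵀ (s t)
      - act Q (xbar t)
  eq_xbar : ∀ t : ℝ, 0 ≤ t →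
    derivWithin xbar (Ici 0) t
      = act (closedLoopMatrix A B C D R P) (xbar t) - act (inputMatrix B D R P) (s t)
  initial : xbar 0 = xbar₀

end

/-!
# Riccati equation and consistency equations of a discounted linear-quadratic problem

Both assumptions on the stochastic system enter through two facts about solutions of linear
stochastic differential equations: a solution exists for every initial state
(`exists_isSDESolution`), and the expectations `E ⟨G x, x⟩` satisfy the differential equation given
by the Lyapunov operator (`IsSDESolution.integral_inner_self`). The second fact is Itô's formula for
quadratic forms after taking expectations; it needs only the Itô isometry and the martingale
property, because the state is the sum of an absolutely continuous part and a stochastic integral.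
Solutions are produced by a Picard iteration in which every iterate is replaced by a simple
process close to it, so that the iteration involves finite sums only. The maximal inequality makes
it converge locally uniformly along almost every path.

*Existence of a Riccati solution.* If the discounted energy of every solution is finite, then a
quadratic form which does not increase along solutions is nonnegative
(`IsSDESolution.inner_nonneg_of_discounted`). So the Lyapunov operator of the system with a
stabilizing feedback is injective on symmetric matrices and its Lyapunov equation has a positive
semidefinite solution (`IsRhoStable.exists_lyapunov_eq`). Completing the square shows that this
cost matrix is a supersolution of the Riccati equation. By compactness there is a positive
semidefinite supersolution of minimal trace. A supersolution which is not a solution can be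
decreased by one step of a monotone fixed point iteration for the Lyapunov equation of its own
feedback (`exists_smaller_riccati_supersolution`). Hence the minimal one is a solution.

*Stability of the closed loop.* Let `P ≥ 0` be a Riccati solution and suppose that `Ā - (ρ/2) I` has
an eigenvalue in the closed right half plane. By the Riccati equation the feedback and `√Q` vanish
on the eigenvector, and `C` maps it to `ker P`. Therefore the eigenvector and `ker P` span a
subspace which is invariant under `A - (ρ/2) I` and `C` and lies in the kernel of `√Q`. A solution
that starts there stays there and is not observed, but its mean, a solution of the deterministic
equation, does not tend to zero. This contradicts exact detectability
(`IsRiccatiSolution.re_lt_zero`).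

*The consistency equations.* With `x = e^{-ρt/2} x̄` and `q = -e^{-ρt/2} s` they become a Hamiltonian
system with a stable upper left block `F`, and the weighted spaces become `L²`. The initial values
of square integrable solutions form the stable subspace of the Hamiltonian matrix, and what has to
be shown is that it is a graph over the first component. It is isotropic for the symplectic form.
This and the stability of `F` give uniqueness (`eq_zero_of_elim_zero_mem_stableSpace`). When no
eigenvalue is purely imaginary, the stable subspaces of the matrix and of its negative, both
isotropic, span the whole space; so the stable subspace is equal to its symplectic orthogonal, and
existence follows by duality (`exists_elim_mem_stableSpace`).
-/


set_option linter.unusedSectionVars false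

/-! ### Increments of Brownian motion -/

namespace IsFilteredBrownian

variable {Ω : Type*} {m : MeasurableSpace Ω} {μ : Measure Ω} [IsProbabilityMeasure μ]
  {ℱ : Filtration ℝ≥0 m} {W : ℝ≥0 → Ω → ℝ}

theorem memLp_increment (hW : IsFilteredBrownian μ ℱ W) (s t : ℝ≥0) :
    MemLp (fun ω => W t ω - W s ω) 2 μ := by
  have h := hW.brownian.hasLaw_sub t s
  have h2 : MemLp id 2 (μ.map (W t - W s)) := by
    rw [h.map_eq]; exact memLp_id_gaussianReal' 2 (by simp)
  exact (memLp_map_measure_iff h2.1 h.aemeasurable).1 h2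

theorem stronglyMeasurable_increment (hW : IsFilteredBrownian μ ℱ W) {s t u : ℝ≥0}
    (hs : s ≤ u) (ht : t ≤ u) : StronglyMeasurable[ℱ u] (fun ω => W t ω - W s ω) :=
  ((hW.adapted t).mono (ℱ.mono ht)).sub ((hW.adapted s).mono (ℱ.mono hs))

theorem integral_increment (hW : IsFilteredBrownian μ ℱ W) (s t : ℝ≥0) :
    ∫ ω, (W t ω - W s ω) ∂μ = 0 := by
  have h := (hW.brownian.hasLaw_sub t s).integral_eq
  simpa using h

theorem integral_increment_sq (hW : IsFilteredBrownian μ ℱ W) {s t : ℝ≥0} (hst : s ≤ t) :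
    ∫ ω, (W t ω - W s ω) ^ 2 ∂μ = (t : ℝ) - s := by
  have h := (hW.brownian.hasLaw_sub t s).variance_eq
  have h0 := hW.integral_increment s t
  have e : (W t - W s) = fun ω => W t ω - W s ω := rfl
  rw [variance_id_gaussianReal, e, variance_eq_sub (hW.memLp_increment s t), h0] at h
  have h1 : ((nndist (t : ℝ) (s : ℝ) : ℝ≥0) : ℝ) = (t : ℝ) - s := by
    rw [coe_nndist, Real.dist_eq, abs_of_nonneg]; exact sub_nonneg.2 (by exact_mod_cast hst)
  simp only [Pi.pow_apply, ne_eq, OfNat.ofNat_ne_zero, not_false_eq_true, zero_pow, sub_zero] at h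
  rw [h]; exact h1

/-- A Brownian increment after time `s` is independent of everything known at time `s`. -/
theorem indepFun_increment (hW : IsFilteredBrownian μ ℱ W) {s t : ℝ≥0} (hst : s ≤ t)
    {Y : Ω → ℝ} (hY : StronglyMeasurable[ℱ s] Y) :
    IndepFun (fun ω => W t ω - W s ω) Y μ := by
  rw [IndepFun_iff_Indep]
  exact indep_of_indep_of_le_right (hW.indep_increment s t hst) hY.measurable.comap_le

theorem integral_increment_mul (hW : IsFilteredBrownian μ ℱ W) {s t : ℝ≥0} (hst : s ≤ t)
    {Y : Ω → ℝ} (hY : StronglyMeasurable[ℱ s] Y) :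
    ∫ ω, (W t ω - W s ω) * Y ω ∂μ = 0 := by
  rw [(hW.indepFun_increment hst hY).integral_fun_mul_eq_mul_integral
    (hW.memLp_increment s t).1 (hY.mono (ℱ.le s)).aestronglyMeasurable,
    hW.integral_increment, zero_mul]

theorem integral_increment_sq_mul (hW : IsFilteredBrownian μ ℱ W) {s t : ℝ≥0} (hst : s ≤ t)
    {Y : Ω → ℝ} (hY : StronglyMeasurable[ℱ s] Y) :
    ∫ ω, (W t ω - W s ω) ^ 2 * Y ω ∂μ = ((t : ℝ) - s) * ∫ ω, Y ω ∂μ := by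
  have h := (hW.indepFun_increment hst hY).comp (φ := fun x => x ^ 2) (ψ := id)
    (by fun_prop) measurable_id
  have h1 := h.integral_fun_mul_eq_mul_integral (𝕜 := ℝ)
    ((continuous_pow 2).comp_aestronglyMeasurable (hW.memLp_increment s t).1)
    (hY.mono (ℱ.le s)).aestronglyMeasurable
  simp only [Function.comp_def, id] at h1
  rw [h1, hW.integral_increment_sq hst]

theorem integrable_increment_mul (hW : IsFilteredBrownian μ ℱ W) (a b a' b' : ℝ≥0)
    {ξ : Ω → ℝ} (hξ : AEStronglyMeasurable ξ μ) {c : ℝ} (hc : ∀ ω, ‖ξ ω‖ ≤ c) :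
    Integrable (fun ω => (W b ω - W a ω) * ((W b' ω - W a' ω) * ξ ω)) μ := by
  have := ((hW.memLp_increment a b).integrable_mul (hW.memLp_increment a' b')).mul_bdd (c := c) hξ
    (Eventually.of_forall hc)
  simpa [mul_assoc] using this

/-- Two increments with the same starting time: the later part of the longer one is independent
of everything else. -/
theorem integral_increment_mul_increment_mul_of_le (hW : IsFilteredBrownian μ ℱ W)
    {a b b' : ℝ≥0} (hab : a ≤ b) (hbb : b ≤ b')
    {ξ : Ω → ℝ} (hξ : StronglyMeasurable[ℱ a] ξ) {c : ℝ} (hc : ∀ ω, ‖ξ ω‖ ≤ c) :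
    ∫ ω, (W b ω - W a ω) * ((W b' ω - W a ω) * ξ ω) ∂μ = ((b : ℝ) - a) * ∫ ω, ξ ω ∂μ := by
  have hξ' := (hξ.mono (ℱ.le a)).aestronglyMeasurable (μ := μ)
  have e : ∀ ω, (W b ω - W a ω) * ((W b' ω - W a ω) * ξ ω)
      = (W b ω - W a ω) * ((W b ω - W a ω) * ξ ω)
        + (W b' ω - W b ω) * ((W b ω - W a ω) * ξ ω) := fun ω => by ring
  simp_rw [e]
  rw [integral_add (hW.integrable_increment_mul _ _ _ _ hξ' hc)
    (hW.integrable_increment_mul _ _ _ _ hξ' hc),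
    hW.integral_increment_mul hbb (Y := fun ω => (W b ω - W a ω) * ξ ω)
      ((hW.stronglyMeasurable_increment hab le_rfl).mul (hξ.mono (ℱ.mono hab))), add_zero,
    ← hW.integral_increment_sq_mul hab hξ]
  congr 1; ext ω; ring

/-- Covariance of two Brownian increments weighted by a bounded variable known at the later of the
two starting times: the length of the common time interval appears. -/
theorem integral_increment_mul_increment_mul (hW : IsFilteredBrownian μ ℱ W)
    {a b a' b' : ℝ≥0} (hab : a ≤ b) (hab' : a' ≤ b')
    {ξ : Ω → ℝ} (hξ : StronglyMeasurable[ℱ (max a a')] ξ) {c : ℝ} (hc : ∀ ω, ‖ξ ω‖ ≤ c) :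
    ∫ ω, (W b ω - W a ω) * ((W b' ω - W a' ω) * ξ ω) ∂μ
      = max 0 (min (b : ℝ) b' - max (a : ℝ) a') * ∫ ω, ξ ω ∂μ := by
  -- The first increment may be assumed to start first; the part of it before `a'` contributes
  -- nothing, so both may be assumed to start at `a'`.
  wlog haa : a ≤ a' generalizing a b a' b'
  · have h := this (a := a') (b := b') (a' := a) (b' := b) hab' hab (by rwa [max_comm])
      (not_le.1 haa).le
    rw [min_comm (b : ℝ), max_comm (a : ℝ), ← h]
    congr 1; ext ω; ring
  have haa' : (a : ℝ) ≤ a' := by exact_mod_cast haa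
  rw [max_eq_right haa] at hξ
  rw [max_eq_right haa']
  have hξ' := (hξ.mono (ℱ.le a')).aestronglyMeasurable (μ := μ)
  rcases le_total b a' with hba | hba
  · have h0 : max 0 (min (b : ℝ) b' - a') = 0 :=
      max_eq_left (sub_nonpos.2 ((min_le_left _ _).trans (by exact_mod_cast hba)))
    rw [h0, zero_mul, ← hW.integral_increment_mul hab'
      ((hW.stronglyMeasurable_increment haa hba).mul hξ)]
    congr 1; ext ω; simp only [Pi.mul_apply]; ring
  · have e : ∀ ω, (W b ω - W a ω) * ((W b' ω - W a' ω) * ξ ω)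
        = (W a' ω - W a ω) * ((W b' ω - W a' ω) * ξ ω)
          + (W b ω - W a' ω) * ((W b' ω - W a' ω) * ξ ω) := fun ω => by ring
    have h1 : ∫ ω, (W a' ω - W a ω) * ((W b' ω - W a' ω) * ξ ω) ∂μ = 0 := by
      rw [← hW.integral_increment_mul hab'
        ((hW.stronglyMeasurable_increment haa le_rfl).mul hξ)]
      congr 1; ext ω; simp only [Pi.mul_apply]; ring
    simp_rw [e]
    rw [integral_add (hW.integrable_increment_mul _ _ _ _ hξ' hc)
      (hW.integrable_increment_mul _ _ _ _ hξ' hc), h1, zero_add]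
    have hba' : (a' : ℝ) ≤ b := by exact_mod_cast hba
    have hab'' : (a' : ℝ) ≤ b' := by exact_mod_cast hab'
    rcases le_total b b' with hbb | hbb
    · have hbb' : (b : ℝ) ≤ b' := by exact_mod_cast hbb
      rw [hW.integral_increment_mul_increment_mul_of_le hba hbb hξ hc, min_eq_left hbb',
        max_eq_right (sub_nonneg.2 hba')]
    · have hbb' : (b' : ℝ) ≤ b := by exact_mod_cast hbb
      rw [min_eq_right hbb', max_eq_right (sub_nonneg.2 hab''),
        ← hW.integral_increment_mul_increment_mul_of_le hab' hbb hξ hc]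
      congr 1; ext ω; ring

end IsFilteredBrownian

/-! ### The elementary stochastic integral -/

theorem integrable_inner_of_memLp {α E : Type*} {m : MeasurableSpace α} {μ : Measure α}
    [NormedAddCommGroup E] [InnerProductSpace ℝ E] {f g : α → E} (hf : MemLp f 2 μ)
    (hg : MemLp g 2 μ) : Integrable (fun x => inner ℝ (f x) (g x)) μ := by
  refine (hf.norm.integrable_mul hg.norm).mono (hf.1.inner hg.1) (Eventually.of_forall fun x => ?_)
  simpa using abs_real_inner_le_norm (f x) (g x)

theorem integral_norm_sub_sq_of_memLp {α E : Type*} {m : MeasurableSpace α} {μ : Measure α}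
    [NormedAddCommGroup E] [InnerProductSpace ℝ E] {f g : α → E} (hf : MemLp f 2 μ)
    (hg : MemLp g 2 μ) :
    ∫ x, ‖f x - g x‖ ^ 2 ∂μ = ∫ x, inner ℝ (f x) (f x) ∂μ - 2 * ∫ x, inner ℝ (f x) (g x) ∂μ
      + ∫ x, inner ℝ (g x) (g x) ∂μ := by
  have h1 : Integrable (fun x => inner ℝ (f x) (f x) - 2 * inner ℝ (f x) (g x)) μ :=
    (integrable_inner_of_memLp hf hf).sub ((integrable_inner_of_memLp hf hg).const_mul 2)
  simp_rw [norm_sub_sq_real, ← real_inner_self_eq_norm_sq]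
  rw [integral_add h1 (integrable_inner_of_memLp hg hg),
    integral_sub (integrable_inner_of_memLp hf hf) ((integrable_inner_of_memLp hf hg).const_mul 2),
    integral_const_mul]

theorem intervalIntegrable_sum {ι : Type*} (s : Finset ι) {f : ι → ℝ → ℝ} {a b : ℝ}
    (h : ∀ i ∈ s, IntervalIntegrable (f i) volume a b) :
    IntervalIntegrable (fun x => ∑ i ∈ s, f i x) volume a b := by
  simpa only [Finset.sum_fn] using IntervalIntegrable.sum s h

/-- The length of `(0, t] ∩ (a, b] ∩ (a', b']`. -/
theorem intervalIntegral_indicator_mul_indicator (t a b a' b' : ℝ≥0) :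
    ∫ s in (0 : ℝ)..t, (Ioc a b).indicator (fun _ => (1 : ℝ)) s.toNNReal
        * (Ioc a' b').indicator (fun _ => (1 : ℝ)) s.toNNReal
      = max 0 (min ((min b t : ℝ≥0) : ℝ) (min b' t : ℝ≥0)
          - max ((min a t : ℝ≥0) : ℝ) (min a' t : ℝ≥0)) := by
  rw [intervalIntegral.integral_of_le t.coe_nonneg]
  have h : ∀ s ∈ Ioc (0 : ℝ) t, (Ioc a b).indicator (fun _ => (1 : ℝ)) s.toNNReal
        * (Ioc a' b').indicator (fun _ => (1 : ℝ)) s.toNNReal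
      = (Ioc (max (a : ℝ) a') (min (b : ℝ) b')).indicator (fun _ => (1 : ℝ)) s := by
    intro s hs
    lift s to ℝ≥0 using hs.1.le
    simp only [Real.toNNReal_coe, Set.indicator_apply, mem_Ioc, max_lt_iff, le_min_iff,
      NNReal.coe_lt_coe, NNReal.coe_le_coe]
    split_ifs <;> first | norm_num; done | (exfalso; tauto)
  rw [setIntegral_congr_fun measurableSet_Ioc h, setIntegral_indicator measurableSet_Ioc,
    setIntegral_const, Ioc_inter_Ioc, Real.volume_real_Ioc]
  simp only [smul_eq_mul, mul_one, NNReal.coe_min]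
  have := t.coe_nonneg; have := a.coe_nonneg
  generalize (t : ℝ) = t, (a : ℝ) = a, (b : ℝ) = b, (a' : ℝ) = a', (b' : ℝ) = b' at *
  grind

theorem intervalIntegrable_indicator_mul_indicator (t a b a' b' : ℝ≥0) :
    IntervalIntegrable (fun s : ℝ => (Ioc a b).indicator (fun _ => (1 : ℝ)) s.toNNReal
        * (Ioc a' b').indicator (fun _ => (1 : ℝ)) s.toNNReal) volume 0 t := by
  have hm : ∀ a b : ℝ≥0,
      Measurable (fun s : ℝ => (Ioc a b).indicator (fun _ => (1 : ℝ)) s.toNNReal) := fun a b =>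
    (measurable_const.indicator measurableSet_Ioc).comp measurable_real_toNNReal
  refine (intervalIntegrable_const (c := (1 : ℝ))).mono_fun
    ((hm a b).mul (hm a' b')).aestronglyMeasurable (Eventually.of_forall fun s => ?_)
  simp only [Set.indicator_apply]
  split_ifs <;> simp

namespace SimpleProcess

variable {Ω : Type*} {m : MeasurableSpace Ω} {μ : Measure Ω} [IsProbabilityMeasure μ]
  {ℱ : Filtration ℝ≥0 m} {W : ℝ≥0 → Ω → ℝ}
  {E : Type*} [NormedAddCommGroup E] [InnerProductSpace ℝ E]

theorem stronglyMeasurable_value (ψ : SimpleProcess ℱ E) (k : ℕ) :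
    StronglyMeasurable (ψ.value k) :=
  (ψ.measurable_value k).mono (ℱ.le _)

theorem memLp_value (ψ : SimpleProcess ℱ E) (k : ℕ) : MemLp (ψ.value k) 2 μ := by
  obtain ⟨c, hc⟩ := ψ.bounded_value
  exact MemLp.of_bound (ψ.stronglyMeasurable_value k).aestronglyMeasurable c
    (Eventually.of_forall (hc k))

theorem memLp_eval (ψ : SimpleProcess ℱ E) (t : ℝ≥0) : MemLp (ψ.eval t) 2 μ := by
  refine memLp_finsetSum _ fun k _ => ?_
  by_cases h : t ∈ Ioc (ψ.time k) (ψ.time (k + 1))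
  · simpa [h] using ψ.memLp_value k
  · simp [h]

theorem memLp_term (ψ : SimpleProcess ℱ E) (hW : IsFilteredBrownian μ ℱ W) (a b : ℝ≥0) (k : ℕ) :
    MemLp (fun ω => (W b ω - W a ω) • ψ.value k ω) 2 μ := by
  obtain ⟨c, hc⟩ := ψ.bounded_value
  refine ((hW.memLp_increment a b).const_mul c).mono
    ((hW.memLp_increment a b).1.smul (ψ.stronglyMeasurable_value k).aestronglyMeasurable)
    (Eventually.of_forall fun ω => ?_)
  rw [norm_smul, norm_mul, mul_comm]
  gcongr
  exact (hc k ω).trans (le_abs_self c)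

theorem memLp_integral (ψ : SimpleProcess ℱ E) (hW : IsFilteredBrownian μ ℱ W) (t : ℝ≥0) :
    MemLp (ψ.integral W t) 2 μ :=
  memLp_finsetSum _ fun k _ => ψ.memLp_term hW _ _ k

/-- Expected product of two summands: given the later starting time, the values of both processes
are known, so the covariance of the Brownian increments factors out. -/
theorem integral_inner_term (ψ ψ' : SimpleProcess ℱ E) (hW : IsFilteredBrownian μ ℱ W)
    (t : ℝ≥0) (k l : ℕ) :
    ∫ ω, inner ℝ ((W (min (ψ.time (k + 1)) t) ω - W (min (ψ.time k) t) ω) • ψ.value k ω)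
        ((W (min (ψ'.time (l + 1)) t) ω - W (min (ψ'.time l) t) ω) • ψ'.value l ω) ∂μ
      = (∫ s in (0 : ℝ)..t,
          (Ioc (ψ.time k) (ψ.time (k + 1))).indicator (fun _ => (1 : ℝ)) s.toNNReal
          * (Ioc (ψ'.time l) (ψ'.time (l + 1))).indicator (fun _ => (1 : ℝ)) s.toNNReal)
        * ∫ ω, inner ℝ (ψ.value k ω) (ψ'.value l ω) ∂μ := by
  rw [intervalIntegral_indicator_mul_indicator]
  have hk := ψ.time_mono (Nat.le_succ k)
  have hl := ψ'.time_mono (Nat.le_succ l)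
  simp only [Nat.succ_eq_add_one] at hk hl
  simp_rw [real_inner_smul_left, real_inner_smul_right]
  -- Terms which start after `t` vanish.
  rcases lt_or_ge t (ψ.time k) with h | h
  · rw [min_eq_right h.le, min_eq_right (h.le.trans hk)]
    simp
  rcases lt_or_ge t (ψ'.time l) with h' | h'
  · rw [min_eq_right h'.le, min_eq_right (h'.le.trans hl)]
    simp
  obtain ⟨c, hc⟩ := ψ.bounded_value
  obtain ⟨c', hc'⟩ := ψ'.bounded_value
  refine hW.integral_increment_mul_increment_mul (min_le_min_right t hk) (min_le_min_right t hl)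
    (c := c * c') ?_ fun ω => ?_
  · rw [min_eq_left h, min_eq_left h']
    exact ((ψ.measurable_value k).mono (ℱ.mono (le_max_left _ _))).inner
      ((ψ'.measurable_value l).mono (ℱ.mono (le_max_right _ _)))
  · refine (norm_inner_le_norm _ _).trans ?_
    have := hc k ω; have := hc' l ω
    gcongr
    exact (norm_nonneg _).trans (hc k ω)

theorem inner_eval_eval (ψ ψ' : SimpleProcess ℱ E) (t : ℝ≥0) (ω : Ω) :
    inner ℝ (ψ.eval t ω) (ψ'.eval t ω) =
      ∑ k ∈ Finset.range ψ.card, ∑ l ∈ Finset.range ψ'.card,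
        ((Ioc (ψ.time k) (ψ.time (k + 1))).indicator (fun _ => (1 : ℝ)) t
          * (Ioc (ψ'.time l) (ψ'.time (l + 1))).indicator (fun _ => (1 : ℝ)) t)
        * inner ℝ (ψ.value k ω) (ψ'.value l ω) := by
  simp only [eval, sum_inner, inner_sum]
  rw [Finset.sum_comm]
  refine Finset.sum_congr rfl fun k _ => Finset.sum_congr rfl fun l _ => ?_
  simp only [Set.indicator_apply]
  split_ifs <;> simp

theorem integral_inner_eval (ψ ψ' : SimpleProcess ℱ E) (μ : Measure Ω) [IsProbabilityMeasure μ]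
    (t : ℝ≥0) :
    ∫ ω, inner ℝ (ψ.eval t ω) (ψ'.eval t ω) ∂μ =
      ∑ k ∈ Finset.range ψ.card, ∑ l ∈ Finset.range ψ'.card,
        ((Ioc (ψ.time k) (ψ.time (k + 1))).indicator (fun _ => (1 : ℝ)) t
          * (Ioc (ψ'.time l) (ψ'.time (l + 1))).indicator (fun _ => (1 : ℝ)) t)
        * ∫ ω, inner ℝ (ψ.value k ω) (ψ'.value l ω) ∂μ := by
  have hi : ∀ k l, Integrable (fun ω => inner ℝ (ψ.value k ω) (ψ'.value l ω)) μ := fun k l =>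
    integrable_inner_of_memLp (ψ.memLp_value k) (ψ'.memLp_value l)
  simp_rw [inner_eval_eval]
  rw [integral_finsetSum _ fun k _ => integrable_finsetSum _ fun l _ => (hi k l).const_mul _]
  refine Finset.sum_congr rfl fun k _ => ?_
  rw [integral_finsetSum _ fun l _ => (hi k l).const_mul _]
  simp_rw [integral_const_mul]

theorem intervalIntegrable_integral_inner_eval (ψ ψ' : SimpleProcess ℱ E) (μ : Measure Ω)
    [IsProbabilityMeasure μ] (t : ℝ≥0) :
    IntervalIntegrable
      (fun s : ℝ => ∫ ω, inner ℝ (ψ.eval s.toNNReal ω) (ψ'.eval s.toNNReal ω) ∂μ)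
      volume 0 t := by
  simp_rw [integral_inner_eval]
  exact intervalIntegrable_sum _ fun k _ => intervalIntegrable_sum _ fun l _ =>
    (intervalIntegrable_indicator_mul_indicator t _ _ _ _).mul_const _

/-- The Itô isometry for simple processes, in bilinear form. -/
theorem integral_inner_integral (ψ ψ' : SimpleProcess ℱ E) (hW : IsFilteredBrownian μ ℱ W)
    (t : ℝ≥0) :
    ∫ ω, inner ℝ (ψ.integral W t ω) (ψ'.integral W t ω) ∂μ
      = ∫ s in (0 : ℝ)..t,
          ∫ ω, inner ℝ (ψ.eval s.toNNReal ω) (ψ'.eval s.toNNReal ω) ∂μ := by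
  simp_rw [integral_inner_eval]
  rw [intervalIntegral.integral_finsetSum fun k _ => intervalIntegrable_sum _ fun l _ =>
    (intervalIntegrable_indicator_mul_indicator t _ _ _ _).mul_const _]
  simp only [integral, sum_inner, inner_sum]
  have hi : ∀ k l, Integrable (fun ω =>
      inner ℝ ((W (min (ψ.time (k + 1)) t) ω - W (min (ψ.time k) t) ω) • ψ.value k ω)
        ((W (min (ψ'.time (l + 1)) t) ω - W (min (ψ'.time l) t) ω) • ψ'.value l ω)) μ :=
    fun k l => integrable_inner_of_memLp (ψ.memLp_term hW _ _ k) (ψ'.memLp_term hW _ _ l)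
  rw [integral_finsetSum _ fun l _ => integrable_finsetSum _ fun k _ => hi k l]
  simp_rw [integral_finsetSum _ fun k _ => hi k _]
  rw [Finset.sum_comm]
  refine Finset.sum_congr rfl fun k _ => ?_
  rw [intervalIntegral.integral_finsetSum fun l _ =>
      (intervalIntegrable_indicator_mul_indicator t _ _ _ _).mul_const _]
  refine Finset.sum_congr rfl fun l _ => ?_
  rw [integral_inner_term _ _ hW, intervalIntegral.integral_mul_const]

theorem integral_norm_sq_eval_sub (ψ ψ' : SimpleProcess ℱ E) (μ : Measure Ω)
    [IsProbabilityMeasure μ] (t : ℝ≥0) :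
    ∫ ω, ‖ψ.eval t ω - ψ'.eval t ω‖ ^ 2 ∂μ =
      ∫ ω, inner ℝ (ψ.eval t ω) (ψ.eval t ω) ∂μ
        - 2 * ∫ ω, inner ℝ (ψ.eval t ω) (ψ'.eval t ω) ∂μ
        + ∫ ω, inner ℝ (ψ'.eval t ω) (ψ'.eval t ω) ∂μ :=
  integral_norm_sub_sq_of_memLp (ψ.memLp_eval t) (ψ'.memLp_eval t)

theorem intervalIntegrable_integral_norm_sq_eval_sub (ψ ψ' : SimpleProcess ℱ E) (μ : Measure Ω)
    [IsProbabilityMeasure μ] (t : ℝ≥0) :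
    IntervalIntegrable
      (fun s : ℝ => ∫ ω, ‖ψ.eval s.toNNReal ω - ψ'.eval s.toNNReal ω‖ ^ 2 ∂μ) volume 0 t := by
  simp_rw [integral_norm_sq_eval_sub]
  exact ((intervalIntegrable_integral_inner_eval _ _ μ t).sub
    ((intervalIntegrable_integral_inner_eval _ _ μ t).const_mul _)).add
    (intervalIntegrable_integral_inner_eval _ _ μ t)

/-- The Itô isometry for the difference of two simple processes. -/
theorem integral_norm_sq_integral_sub (ψ ψ' : SimpleProcess ℱ E)
    (hW : IsFilteredBrownian μ ℱ W) (t : ℝ≥0) :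
    ∫ ω, ‖ψ.integral W t ω - ψ'.integral W t ω‖ ^ 2 ∂μ
      = ∫ s in (0 : ℝ)..t, ∫ ω, ‖ψ.eval s.toNNReal ω - ψ'.eval s.toNNReal ω‖ ^ 2 ∂μ := by
  have h' := fun φ φ' : SimpleProcess ℱ E => intervalIntegrable_integral_inner_eval φ φ' μ t
  simp_rw [integral_norm_sq_eval_sub]
  rw [integral_norm_sub_sq_of_memLp (ψ.memLp_integral hW t) (ψ'.memLp_integral hW t),
    intervalIntegral.integral_add ((h' _ _).sub ((h' _ _).const_mul _)) (h' _ _),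
    intervalIntegral.integral_sub (h' _ _) ((h' _ _).const_mul _),
    intervalIntegral.integral_const_mul]
  simp_rw [integral_inner_integral _ _ hW]

/-- The elementary integral is a martingale: its increment after time `s` is orthogonal to every
square integrable variable known at time `s`. -/
theorem integral_inner_integral_sub (ψ : SimpleProcess ℱ E) (hW : IsFilteredBrownian μ ℱ W)
    {s t : ℝ≥0} (hst : s ≤ t) {Y : Ω → E} (hY : StronglyMeasurable[ℱ s] Y) (hY2 : MemLp Y 2 μ) :
    ∫ ω, inner ℝ (ψ.integral W t ω - ψ.integral W s ω) (Y ω) ∂μ = 0 := by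
  -- Only the part of each increment after time `s` survives in the difference.
  have key : ∀ (b : ℝ≥0) ω, W (min b t) ω - W (min b s) ω = W (max s (min b t)) ω - W s ω := by
    intro b ω
    rcases le_total b s with h | h
    · simp [min_eq_left (h.trans hst), min_eq_left h, max_eq_left h]
    · rw [min_eq_right h, max_eq_right (le_min h hst)]
  have e : ∀ ω, ψ.integral W t ω - ψ.integral W s ω = ∑ k ∈ Finset.range ψ.card,
      (W (max s (min (ψ.time (k + 1)) t)) ω - W (max s (min (ψ.time k) t)) ω) • ψ.value k ω := by
    intro ω
    simp only [integral, ← Finset.sum_sub_distrib, ← sub_smul]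
    refine Finset.sum_congr rfl fun k _ => ?_
    have h1 := key (ψ.time (k + 1)) ω
    have h2 := key (ψ.time k) ω
    congr 1
    linarith
  simp_rw [e, sum_inner]
  rw [integral_finsetSum _ fun k _ => integrable_inner_of_memLp (ψ.memLp_term hW _ _ k) hY2]
  refine Finset.sum_eq_zero fun k _ => ?_
  have hk := ψ.time_mono (Nat.le_succ k)
  simp only [Nat.succ_eq_add_one] at hk
  rcases lt_or_ge t (ψ.time k) with h | h
  · rw [min_eq_right h.le, min_eq_right (h.le.trans hk)]
    simp
  simp_rw [real_inner_smul_left]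
  refine hW.integral_increment_mul (max_le_max_left s (min_le_min_right t hk)) ?_
  rw [min_eq_left h]
  exact ((ψ.measurable_value k).mono (ℱ.mono (le_max_right _ _))).inner
    (hY.mono (ℱ.mono (le_max_left _ _)))

theorem stronglyMeasurable_integral (ψ : SimpleProcess ℱ E)
    (hW : StronglyAdapted ℱ W) (t : ℝ≥0) : StronglyMeasurable[ℱ t] (ψ.integral W t) := by
  refine Finset.stronglyMeasurable_fun_sum _ fun k _ => ?_
  rcases lt_or_ge t (ψ.time k) with h | h
  · rw [min_eq_right h.le, min_eq_right (h.le.trans (ψ.time_mono (Nat.le_succ k)))]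
    simpa using stronglyMeasurable_const
  · have hm : ∀ a : ℝ≥0, StronglyMeasurable[ℱ t] (W (min a t)) := fun a =>
      (hW (min a t)).mono (ℱ.mono (min_le_right a t))
    exact ((hm _).sub (hm _)).smul ((ψ.measurable_value k).mono (ℱ.mono h))

end SimpleProcess

/-! ### Square integrable functions -/

section SquareIntegrable

variable {α E : Type*} {m : MeasurableSpace α} {μ : Measure α} [NormedAddCommGroup E]

theorem lintegral_enorm_sq_eq_eLpNorm_sq (f : α → E) (μ : Measure α) :
    ∫⁻ x, ‖f x‖ₑ ^ 2 ∂μ = eLpNorm f 2 μ ^ 2 := by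
  have h := eLpNorm_nnreal_pow_eq_lintegral (f := f) (μ := μ) (p := 2) two_ne_zero
  simp only [ENNReal.coe_ofNat, NNReal.coe_ofNat, ENNReal.rpow_ofNat] at h
  exact h.symm

theorem tendsto_lintegral_enorm_sq_iff {ι : Type*} {l : Filter ι} (f : ι → α → E) :
    Tendsto (fun j => ∫⁻ x, ‖f j x‖ₑ ^ 2 ∂μ) l (𝓝 0)
      ↔ Tendsto (fun j => eLpNorm (f j) 2 μ) l (𝓝 0) := by
  simp_rw [lintegral_enorm_sq_eq_eLpNorm_sq]
  constructor
  · intro h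
    have h1 := h.ennrpow_const (1 / 2 : ℝ)
    simp only [← ENNReal.rpow_natCast, ← ENNReal.rpow_mul] at h1
    norm_num at h1
    exact h1
  · intro h
    simpa using ENNReal.Tendsto.pow (n := 2) h

theorem lintegral_enorm_sq_eq_ofReal {f : α → E} (hf : MemLp f 2 μ) :
    ∫⁻ x, ‖f x‖ₑ ^ 2 ∂μ = ENNReal.ofReal (∫ x, ‖f x‖ ^ 2 ∂μ) := by
  rw [ofReal_integral_eq_lintegral_ofReal
    ((memLp_two_iff_integrable_sq_norm hf.1).1 hf) (Eventually.of_forall fun _ => by positivity)]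
  congr 1; ext x
  rw [← ofReal_norm, ENNReal.ofReal_pow (norm_nonneg _)]

theorem memLp_two_of_lintegral_lt_top {f : α → E} (hf : AEStronglyMeasurable f μ)
    (h : ∫⁻ x, ‖f x‖ₑ ^ 2 ∂μ < ∞) : MemLp f 2 μ := by
  refine ⟨hf, ?_⟩
  rw [lintegral_enorm_sq_eq_eLpNorm_sq] at h
  simpa using h

/-- Continuity of the scalar product of `L²`, for representatives. -/
theorem tendsto_integral_inner [InnerProductSpace ℝ E] {ι : Type*} {l : Filter ι}
    {f g : ι → α → E} {f₀ g₀ : α → E}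
    (hf : ∀ j, MemLp (f j) 2 μ) (hg : ∀ j, MemLp (g j) 2 μ)
    (hf₀ : MemLp f₀ 2 μ) (hg₀ : MemLp g₀ 2 μ)
    (hft : Tendsto (fun j => eLpNorm (f j - f₀) 2 μ) l (𝓝 0))
    (hgt : Tendsto (fun j => eLpNorm (g j - g₀) 2 μ) l (𝓝 0)) :
    Tendsto (fun j => ∫ x, inner ℝ (f j x) (g j x) ∂μ) l (𝓝 (∫ x, inner ℝ (f₀ x) (g₀ x) ∂μ)) := by
  have e : ∀ {u v : α → E} (hu : MemLp u 2 μ) (hv : MemLp v 2 μ),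
      ∫ x, inner ℝ (u x) (v x) ∂μ = inner ℝ (hu.toLp u) (hv.toLp v) := by
    intro u v hu hv
    rw [L2.inner_def]
    refine integral_congr_ae ?_
    filter_upwards [hu.coeFn_toLp, hv.coeFn_toLp] with x h1 h2
    rw [h1, h2]
  rw [e hf₀ hg₀]
  simp_rw [fun j => e (hf j) (hg j)]
  exact ((Lp.tendsto_Lp_iff_tendsto_eLpNorm'' f hf f₀ hf₀).2 hft).inner
    ((Lp.tendsto_Lp_iff_tendsto_eLpNorm'' g hg g₀ hg₀).2 hgt)

end SquareIntegrable

/-! ### The Itô integral -/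

section Ito

variable {Ω : Type*} {m : MeasurableSpace Ω} {μ : Measure Ω} [IsProbabilityMeasure μ]
  {ℱ : Filtration ℝ≥0 m} {W : ℝ≥0 → Ω → ℝ}
  {E : Type*} [NormedAddCommGroup E] [InnerProductSpace ℝ E]

/-- The product of `μ` and Lebesgue measure on `[0, t]`. -/
noncomputable abbrev pathMeasure (μ : Measure Ω) (t : ℝ≥0) : Measure (Ω × ℝ) :=
  μ.prod (volume.restrict (Icc (0 : ℝ) t))

/-- A process as a function on `Ω × ℝ`, with negative times sent to `0`. -/
abbrev onPaths {F : Type*} (φ : ℝ≥0 → Ω → F) (p : Ω × ℝ) : F := φ p.2.toNNReal p.1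

theorem pathMeasure_mono (μ : Measure Ω) [IsProbabilityMeasure μ] {s t : ℝ≥0} (hst : s ≤ t) :
    pathMeasure μ s ≤ pathMeasure μ t := by
  rw [pathMeasure, pathMeasure, ← Measure.restrict_univ (μ := μ), Measure.prod_restrict,
    Measure.prod_restrict]
  exact Measure.restrict_mono
    (prod_mono le_rfl (Icc_subset_Icc_right (by exact_mod_cast hst))) le_rfl

namespace SimpleProcess

theorem stronglyMeasurable_onPaths (ψ : SimpleProcess ℱ E) :
    StronglyMeasurable (onPaths ψ.eval) := by
  refine Finset.stronglyMeasurable_fun_sum _ fun k _ => ?_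
  have h : (fun p : Ω × ℝ => (Ioc (ψ.time k) (ψ.time (k + 1))).indicator
      (fun _ => ψ.value k p.1) p.2.toNNReal)
      = ((fun p : Ω × ℝ => p.2.toNNReal) ⁻¹' Ioc (ψ.time k) (ψ.time (k + 1))).indicator
          (fun p => ψ.value k p.1) := by
    rfl
  rw [h]
  exact ((ψ.stronglyMeasurable_value k).comp_measurable measurable_fst).indicator
    ((measurable_real_toNNReal.comp measurable_snd) measurableSet_Ioc)

theorem norm_eval_le (ψ : SimpleProcess ℱ E) : ∃ c : ℝ, ∀ t ω, ‖ψ.eval t ω‖ ≤ c := by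
  obtain ⟨c, hc⟩ := ψ.bounded_value
  refine ⟨∑ k ∈ Finset.range ψ.card, c, fun t ω => (norm_sum_le _ _).trans
    (Finset.sum_le_sum fun k _ => ?_)⟩
  have h0 : 0 ≤ c := (norm_nonneg _).trans (hc k ω)
  simp only [Set.indicator_apply]
  split_ifs
  · exact hc k ω
  · simpa using h0

theorem memLp_onPaths (ψ : SimpleProcess ℱ E) (μ : Measure Ω) [IsProbabilityMeasure μ] (t : ℝ≥0) :
    MemLp (onPaths ψ.eval) 2 (pathMeasure μ t) := by
  obtain ⟨c, hc⟩ := ψ.norm_eval_le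
  exact MemLp.of_bound ψ.stronglyMeasurable_onPaths.aestronglyMeasurable c
    (Eventually.of_forall fun p => hc _ _)

/-- The Itô isometry for simple processes, over the product of `μ` and Lebesgue measure. -/
theorem integral_inner_integral_eq_pathMeasure (ψ ψ' : SimpleProcess ℱ E)
    (hW : IsFilteredBrownian μ ℱ W) (t : ℝ≥0) :
    ∫ ω, inner ℝ (ψ.integral W t ω) (ψ'.integral W t ω) ∂μ
      = ∫ p, inner ℝ (onPaths ψ.eval p) (onPaths ψ'.eval p) ∂(pathMeasure μ t) := by
  rw [integral_inner_integral _ _ hW, intervalIntegral.integral_of_le t.coe_nonneg,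
    ← integral_Icc_eq_integral_Ioc, integral_prod_symm _
      (integrable_inner_of_memLp (ψ.memLp_onPaths μ t) (ψ'.memLp_onPaths μ t))]

theorem eLpNorm_integral_sub (ψ ψ' : SimpleProcess ℱ E)
    (hW : IsFilteredBrownian μ ℱ W) (t : ℝ≥0) :
    eLpNorm (ψ.integral W t - ψ'.integral W t) 2 μ
      = eLpNorm (onPaths ψ.eval - onPaths ψ'.eval) 2 (pathMeasure μ t) := by
  have hi := fun φ : SimpleProcess ℱ E => φ.memLp_integral (μ := μ) hW t
  have hp := fun φ : SimpleProcess ℱ E => φ.memLp_onPaths μ t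
  have h1 := lintegral_enorm_sq_eq_ofReal ((hi ψ).sub (hi ψ'))
  have h2 := lintegral_enorm_sq_eq_ofReal ((hp ψ).sub (hp ψ'))
  rw [lintegral_enorm_sq_eq_eLpNorm_sq] at h1 h2
  have h3 : eLpNorm (ψ.integral W t - ψ'.integral W t) 2 μ ^ 2
      = eLpNorm (onPaths ψ.eval - onPaths ψ'.eval) 2 (pathMeasure μ t) ^ 2 := by
    rw [h1, h2]
    simp only [Pi.sub_apply]
    rw [integral_norm_sub_sq_of_memLp (hi ψ) (hi ψ'), integral_norm_sub_sq_of_memLp (hp ψ) (hp ψ')]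
    simp only [integral_inner_integral_eq_pathMeasure _ _ hW]
  exact (ENNReal.pow_right_strictMono two_ne_zero).injective h3

end SimpleProcess

/-- The approximation condition in the definition of the Itô integral, as convergence in `L²` of
the product measure. -/
theorem tendsto_onPaths_iff {φ : ℝ≥0 → Ω → E} {t : ℝ≥0} (ψ : ℕ → SimpleProcess ℱ E)
    (hφ : AEStronglyMeasurable (onPaths φ) (pathMeasure μ t)) :
    Tendsto (fun j => ∫⁻ ω, ∫⁻ s in Icc (0 : ℝ) t,
        ‖(ψ j).eval s.toNNReal ω - φ s.toNNReal ω‖ₑ ^ 2 ∂volume ∂μ) atTop (𝓝 0)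
      ↔ Tendsto (fun j => eLpNorm (onPaths (ψ j).eval - onPaths φ) 2 (pathMeasure μ t))
        atTop (𝓝 0) := by
  rw [← tendsto_lintegral_enorm_sq_iff]
  refine tendsto_congr fun j => ?_
  rw [lintegral_prod]
  · simp only [Pi.sub_apply]
  · exact (((ψ j).stronglyMeasurable_onPaths.aestronglyMeasurable.sub hφ).enorm).pow_const 2

theorem memLp_of_tendsto_eLpNorm {α : Type*} {mα : MeasurableSpace α} {ν : Measure α}
    {f : ℕ → α → E} {f₀ : α → E} (hf : ∀ j, MemLp (f j) 2 ν) (hf₀ : AEStronglyMeasurable f₀ ν)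
    (h : Tendsto (fun j => eLpNorm (f j - f₀) 2 ν) atTop (𝓝 0)) : MemLp f₀ 2 ν := by
  obtain ⟨j, hj⟩ := (h.eventually (gt_mem_nhds ENNReal.zero_lt_top)).exists
  have h1 : MemLp (f j - f₀) 2 ν := ⟨(hf j).1.sub hf₀, hj⟩
  simpa using (hf j).sub h1

namespace IsItoIntegral

theorem memLp {φ : ℝ≥0 → Ω → E} {t : ℝ≥0} {I : Ω → E} (h : IsItoIntegral μ ℱ W φ t I)
    (hW : IsFilteredBrownian μ ℱ W) : MemLp I 2 μ := by
  obtain ⟨hI, ψ, -, h2⟩ := h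
  rw [tendsto_lintegral_enorm_sq_iff] at h2
  exact memLp_of_tendsto_eLpNorm (fun j => (ψ j).memLp_integral hW t) hI h2

theorem memLp_integrand {φ : ℝ≥0 → Ω → E} {t : ℝ≥0} {I : Ω → E}
    (h : IsItoIntegral μ ℱ W φ t I)
    (hφ : AEStronglyMeasurable (onPaths φ) (pathMeasure μ t)) :
    MemLp (onPaths φ) 2 (pathMeasure μ t) := by
  obtain ⟨hI, ψ, h1, -⟩ := h
  rw [tendsto_onPaths_iff ψ hφ] at h1
  exact memLp_of_tendsto_eLpNorm (fun j => (ψ j).memLp_onPaths μ t) hφ h1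

/-- The Itô isometry, in bilinear form. -/
theorem integral_inner {φ φ' : ℝ≥0 → Ω → E} {t : ℝ≥0} {I I' : Ω → E}
    (hW : IsFilteredBrownian μ ℱ W)
    (h : IsItoIntegral μ ℱ W φ t I) (h' : IsItoIntegral μ ℱ W φ' t I')
    (hφ : AEStronglyMeasurable (onPaths φ) (pathMeasure μ t))
    (hφ' : AEStronglyMeasurable (onPaths φ') (pathMeasure μ t)) :
    ∫ ω, inner ℝ (I ω) (I' ω) ∂μ
      = ∫ p, inner ℝ (onPaths φ p) (onPaths φ' p) ∂(pathMeasure μ t) := by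
  have m1 := h.memLp hW
  have m2 := h'.memLp hW
  have m3 := h.memLp_integrand hφ
  have m4 := h'.memLp_integrand hφ'
  obtain ⟨-, ψ, h1, h2⟩ := h
  obtain ⟨-, ψ', h1', h2'⟩ := h'
  rw [tendsto_onPaths_iff _ hφ] at h1
  rw [tendsto_onPaths_iff _ hφ'] at h1'
  rw [tendsto_lintegral_enorm_sq_iff] at h2 h2'
  have a := tendsto_integral_inner (fun j => (ψ j).memLp_integral hW t)
    (fun j => (ψ' j).memLp_integral hW t) m1 m2 h2 h2'
  have b := tendsto_integral_inner (fun j => (ψ j).memLp_onPaths μ t)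
    (fun j => (ψ' j).memLp_onPaths μ t) m3 m4 h1 h1'
  simp only [SimpleProcess.integral_inner_integral_eq_pathMeasure _ _ hW] at a
  exact tendsto_nhds_unique a b

/-- Every sequence of simple processes which approximates the integrand on `[0, t]` gives the
Itô integral in the limit. -/
theorem tendsto_of_approx {φ : ℝ≥0 → Ω → E} {t : ℝ≥0} {I : Ω → E}
    (hW : IsFilteredBrownian μ ℱ W) (h : IsItoIntegral μ ℱ W φ t I)
    (hφ : AEStronglyMeasurable (onPaths φ) (pathMeasure μ t)) {ψ' : ℕ → SimpleProcess ℱ E}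
    (hψ' : Tendsto (fun j => eLpNorm (onPaths (ψ' j).eval - onPaths φ) 2 (pathMeasure μ t))
      atTop (𝓝 0)) :
    Tendsto (fun j => eLpNorm ((ψ' j).integral W t - I) 2 μ) atTop (𝓝 0) := by
  obtain ⟨hI, ψ, h1, h2⟩ := h
  rw [tendsto_onPaths_iff _ hφ] at h1
  rw [tendsto_lintegral_enorm_sq_iff] at h2
  have hb := (hψ'.add h1).add h2
  simp only [add_zero] at hb
  refine tendsto_of_tendsto_of_tendsto_of_le_of_le tendsto_const_nhds hb (fun _ => zero_le)
    fun j => ?_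
  have mi := fun χ : SimpleProcess ℱ E => (χ.memLp_integral (μ := μ) hW t).1
  have mp := fun χ : SimpleProcess ℱ E => (χ.memLp_onPaths μ t).1
  have e1 : (ψ' j).integral W t - I
      = ((ψ' j).integral W t - (ψ j).integral W t) + ((ψ j).integral W t - I) := by abel
  have e2 : onPaths (ψ' j).eval - onPaths (ψ j).eval
      = (onPaths (ψ' j).eval - onPaths φ) - (onPaths (ψ j).eval - onPaths φ) := by abel
  calc eLpNorm ((ψ' j).integral W t - I) 2 μ
      ≤ eLpNorm ((ψ' j).integral W t - (ψ j).integral W t) 2 μ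
          + eLpNorm ((ψ j).integral W t - I) 2 μ := by
        rw [e1]
        exact eLpNorm_add_le ((mi _).sub (mi _)) ((mi _).sub hI) one_le_two
    _ ≤ _ := by
        rw [SimpleProcess.eLpNorm_integral_sub _ _ hW, e2]
        refine add_le_add ?_ le_rfl
        exact eLpNorm_sub_le ((mp _).sub hφ) ((mp _).sub hφ) one_le_two

/-- The Itô integral is a martingale. -/
theorem integral_inner_eq {φ : ℝ≥0 → Ω → E} {s t : ℝ≥0} (hst : s ≤ t) {I J : Ω → E}
    (hW : IsFilteredBrownian μ ℱ W) (h : IsItoIntegral μ ℱ W φ s I)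
    (h' : IsItoIntegral μ ℱ W φ t J)
    (hφ : AEStronglyMeasurable (onPaths φ) (pathMeasure μ t))
    {Y : Ω → E} (hY : StronglyMeasurable[ℱ s] Y) (hY2 : MemLp Y 2 μ) :
    ∫ ω, inner ℝ (J ω) (Y ω) ∂μ = ∫ ω, inner ℝ (I ω) (Y ω) ∂μ := by
  have m1 := h.memLp hW
  have m2 := h'.memLp hW
  obtain ⟨-, ψ, h1, h2⟩ := h'
  rw [tendsto_onPaths_iff _ hφ] at h1
  rw [tendsto_lintegral_enorm_sq_iff] at h2
  have hmono := pathMeasure_mono μ hst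
  have h3 := h.tendsto_of_approx hW (hφ.mono_measure hmono)
    (tendsto_of_tendsto_of_tendsto_of_le_of_le tendsto_const_nhds h1 (fun _ => zero_le)
      fun j => eLpNorm_mono_measure _ hmono)
  have hYt : Tendsto (fun _ : ℕ => eLpNorm (Y - Y) 2 μ) atTop (𝓝 0) := by simp
  have a := tendsto_integral_inner (fun j => (ψ j).memLp_integral hW t) (fun _ => hY2) m2 hY2 h2 hYt
  have b := tendsto_integral_inner (fun j => (ψ j).memLp_integral hW s) (fun _ => hY2) m1 hY2 h3 hYt
  refine tendsto_nhds_unique (a.congr fun j => ?_) b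
  have h0 := (ψ j).integral_inner_integral_sub hW hst hY hY2
  simp only [inner_sub_left] at h0
  rw [integral_sub (integrable_inner_of_memLp ((ψ j).memLp_integral hW t) hY2)
    (integrable_inner_of_memLp ((ψ j).memLp_integral hW s) hY2)] at h0
  exact sub_eq_zero.1 h0

end IsItoIntegral

end Ito

/-! ### Linear stochastic differential equations -/

section SDE

variable {Ω : Type*} {m : MeasurableSpace Ω} {μ : Measure Ω} [IsProbabilityMeasure μ]
  {ℱ : Filtration ℝ≥0 m} {W : ℝ≥0 → Ω → ℝ}
  {E : Type*} [NormedAddCommGroup E] [InnerProductSpace ℝ E]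
  {F : Type*} [NormedAddCommGroup F] [InnerProductSpace ℝ F]

/-- The image of a simple process under a bounded linear map. -/
def SimpleProcess.map (ψ : SimpleProcess ℱ E) (L : E →L[ℝ] F) : SimpleProcess ℱ F where
  card := ψ.card
  time := ψ.time
  time_mono := ψ.time_mono
  value k ω := L (ψ.value k ω)
  measurable_value k := L.continuous.comp_stronglyMeasurable (ψ.measurable_value k)
  bounded_value := by
    obtain ⟨c, hc⟩ := ψ.bounded_value
    exact ⟨‖L‖ * c, fun k ω => (L.le_opNorm _).trans
      (mul_le_mul_of_nonneg_left (hc k ω) (norm_nonneg _))⟩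

theorem SimpleProcess.eval_map (ψ : SimpleProcess ℱ E) (L : E →L[ℝ] F) (t : ℝ≥0) (ω : Ω) :
    (ψ.map L).eval t ω = L (ψ.eval t ω) := by
  simp only [SimpleProcess.eval, SimpleProcess.map, map_sum, Set.indicator_apply]
  refine Finset.sum_congr rfl fun k _ => ?_
  split_ifs <;> simp

theorem SimpleProcess.integral_map (ψ : SimpleProcess ℱ E) (L : E →L[ℝ] F) (W : ℝ≥0 → Ω → ℝ)
    (t : ℝ≥0) (ω : Ω) : (ψ.map L).integral W t ω = L (ψ.integral W t ω) := by
  simp only [SimpleProcess.integral, SimpleProcess.map, map_sum, map_smul]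

/-- Bounded linear maps commute with the Itô integral. -/
theorem IsItoIntegral.map {φ : ℝ≥0 → Ω → E} {t : ℝ≥0} {I : Ω → E}
    (h : IsItoIntegral μ ℱ W φ t I) (L : E →L[ℝ] F) :
    IsItoIntegral μ ℱ W (fun s ω => L (φ s ω)) t (fun ω => L (I ω)) := by
  obtain ⟨hI, ψ, h1, h2⟩ := h
  have hL : ∀ u v : E, ‖L u - L v‖ₑ ^ 2 ≤ ‖L‖ₑ ^ 2 * ‖u - v‖ₑ ^ 2 := fun u v => by
    rw [← map_sub, ← mul_pow]
    gcongr
    exact L.le_opENorm _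
  have hc : ‖L‖ₑ ^ 2 ≠ ∞ := by simp
  refine ⟨L.continuous.comp_aestronglyMeasurable hI, fun j => (ψ j).map L, ?_, ?_⟩
  · have h3 := ENNReal.Tendsto.const_mul h1 (Or.inr hc)
    rw [mul_zero] at h3
    refine tendsto_of_tendsto_of_tendsto_of_le_of_le tendsto_const_nhds h3 (fun _ => zero_le)
      fun j => ?_
    rw [← lintegral_const_mul' _ _ hc]
    refine lintegral_mono fun ω => ?_
    rw [← lintegral_const_mul' _ _ hc]
    refine lintegral_mono fun s => ?_
    simp only [SimpleProcess.eval_map]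
    exact hL _ _
  · have h3 := ENNReal.Tendsto.const_mul h2 (Or.inr hc)
    rw [mul_zero] at h3
    refine tendsto_of_tendsto_of_tendsto_of_le_of_le tendsto_const_nhds h3 (fun _ => zero_le)
      fun j => ?_
    rw [← lintegral_const_mul' _ _ hc]
    refine lintegral_mono fun ω => ?_
    simp only [SimpleProcess.integral_map]
    exact hL _ _

/-- Solutions of `dx = a x dt + c x dW`, `x(0) = x₀` in an arbitrary inner product space `E`,
defined as in `IsLinearSDESolution`. -/
structure IsSDESolution (μ : Measure Ω) (ℱ : Filtration ℝ≥0 m) (W : ℝ≥0 → Ω → ℝ)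
    (a c : E →L[ℝ] E) (x₀ : E) (x : ℝ≥0 → Ω → E) : Prop where
  progressive : IsStronglyProgressive ℱ x
  continuous_paths : ∀ᵐ ω ∂μ, Continuous fun t => x t ω
  sq_integrable : ∀ T : ℝ≥0, ∫⁻ ω, ∫⁻ s in Icc (0 : ℝ) T, ‖x s.toNNReal ω‖ₑ ^ 2 ∂volume ∂μ < ∞
  initial : ∀ᵐ ω ∂μ, x 0 ω = x₀
  equation : ∀ t : ℝ≥0, IsItoIntegral μ ℱ W (fun s ω => c (x s ω)) t
    (fun ω => x t ω - x₀ - ∫ s in (0 : ℝ)..t, a (x s.toNNReal ω))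

theorem isLinearSDESolution_iff {n : ℕ} {A C : Matrix (Fin n) (Fin n) ℝ}
    {x₀ : EuclideanSpace ℝ (Fin n)} {x : ℝ≥0 → Ω → EuclideanSpace ℝ (Fin n)} :
    IsLinearSDESolution μ ℱ W A C x₀ x ↔ IsSDESolution μ ℱ W (act A) (act C) x₀ x :=
  ⟨fun h => ⟨h.1, h.2, h.3, h.4, h.5⟩, fun h => ⟨h.1, h.2, h.3, h.4, h.5⟩⟩

/-- `x` with time stopped at `T`: a jointly measurable function on `Ω × ℝ`. -/
theorem stronglyMeasurable_stopped {x : ℝ≥0 → Ω → E} (hx : IsStronglyProgressive ℱ x) (T : ℝ≥0) :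
    StronglyMeasurable (fun p : Ω × ℝ => x (min p.2.toNNReal T) p.1) := by
  have h := hx T
  have hm : Measurable[_, Subtype.instMeasurableSpace.prod (ℱ T)]
      (fun p : Ω × ℝ => ((⟨min p.2.toNNReal T, mem_Iic.2 (min_le_right _ _)⟩ : Iic T), p.1)) := by
    refine Measurable.prodMk (Measurable.subtype_mk ?_) ?_
    · exact (measurable_real_toNNReal.comp measurable_snd).min measurable_const
    · exact fun s hs => measurable_fst ((ℱ.le T) s hs)
  exact h.comp_measurable hm

theorem ae_pathMeasure_mem (μ : Measure Ω) [IsProbabilityMeasure μ] (T : ℝ≥0) :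
    ∀ᵐ p ∂(pathMeasure μ T), p.2 ∈ Icc (0 : ℝ) T := by
  rw [pathMeasure]
  have h : ∀ᵐ s ∂(volume.restrict (Icc (0 : ℝ) T)), s ∈ Icc (0 : ℝ) T :=
    ae_restrict_mem measurableSet_Icc
  exact Measure.quasiMeasurePreserving_snd.ae h

theorem aestronglyMeasurable_onPaths {x : ℝ≥0 → Ω → E} (hx : IsStronglyProgressive ℱ x)
    (T : ℝ≥0) : AEStronglyMeasurable (onPaths x) (pathMeasure μ T) := by
  refine ⟨_, stronglyMeasurable_stopped hx T, ?_⟩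
  filter_upwards [ae_pathMeasure_mem μ T] with p hp
  have : p.2.toNNReal ≤ T := Real.toNNReal_le_iff_le_coe.2 hp.2
  rw [min_eq_left this]

/-- Cauchy-Schwarz: the second moment of a time integral. -/
theorem lintegral_enorm_sq_integral_time_le [CompleteSpace E] {f : Ω × ℝ → E} {T : ℝ≥0}
    (hf : AEStronglyMeasurable f (pathMeasure μ T)) :
    ∫⁻ ω, ‖∫ s in Icc (0 : ℝ) T, f (ω, s)‖ₑ ^ 2 ∂μ
      ≤ (T : ℝ≥0∞) * ∫⁻ p, ‖f p‖ₑ ^ 2 ∂(pathMeasure μ T) := by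
  have hae : ∀ᵐ ω ∂μ, ‖∫ s in Icc (0 : ℝ) T, f (ω, s)‖ₑ ^ 2
      ≤ (T : ℝ≥0∞) * ∫⁻ s in Icc (0 : ℝ) T, ‖f (ω, s)‖ₑ ^ 2 := by
    filter_upwards [hf.prodMk_left] with ω hω
    have h := eLpNorm_le_eLpNorm_mul_rpow_measure_univ (p := 1) (q := 2) (by norm_num) hω
    have h1 : ‖∫ s in Icc (0 : ℝ) T, f (ω, s)‖ₑ
        ≤ eLpNorm (fun s => f (ω, s)) 1 (volume.restrict (Icc (0 : ℝ) T)) := by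
      rw [eLpNorm_one_eq_lintegral_enorm]
      exact enorm_integral_le_lintegral_enorm _
    calc _ ≤ (eLpNorm (fun s => f (ω, s)) 2 (volume.restrict (Icc (0 : ℝ) T))
          * (volume.restrict (Icc (0 : ℝ) T)) Set.univ
            ^ (1 / (1 : ℝ≥0∞).toReal - 1 / (2 : ℝ≥0∞).toReal)) ^ 2 := by
          gcongr
          exact h1.trans h
      _ = _ := by
          rw [mul_pow, ← lintegral_enorm_sq_eq_eLpNorm_sq, mul_comm]
          congr 1
          rw [← ENNReal.rpow_natCast, ← ENNReal.rpow_mul]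
          norm_num
  refine (lintegral_mono_ae hae).trans_eq ?_
  rw [lintegral_const_mul' _ _ ENNReal.coe_ne_top, lintegral_prod _ (hf.enorm.pow_const 2)]

theorem memLp_integral_time [CompleteSpace E] {f : Ω × ℝ → E} {T : ℝ≥0}
    (hf : MemLp f 2 (pathMeasure μ T)) :
    MemLp (fun ω => ∫ s in Icc (0 : ℝ) T, f (ω, s)) 2 μ := by
  refine memLp_two_of_lintegral_lt_top hf.1.integral_prod_right'
    ((lintegral_enorm_sq_integral_time_le hf.1).trans_lt ?_)
  rw [lintegral_enorm_sq_eq_eLpNorm_sq]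
  have := hf.2
  finiteness

namespace IsSDESolution

variable {a c : E →L[ℝ] E} {x₀ : E} {x : ℝ≥0 → Ω → E}

theorem memLp_onPaths (hx : IsSDESolution μ ℱ W a c x₀ x) (T : ℝ≥0) :
    MemLp (onPaths x) 2 (pathMeasure μ T) := by
  have hm := aestronglyMeasurable_onPaths (μ := μ) hx.progressive T
  refine memLp_two_of_lintegral_lt_top hm ?_
  rw [lintegral_prod _ (hm.enorm.pow_const 2)]
  exact hx.sq_integrable T

theorem memLp_drift [CompleteSpace E] (hx : IsSDESolution μ ℱ W a c x₀ x) (t : ℝ≥0) :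
    MemLp (fun ω => ∫ s in (0 : ℝ)..t, a (x s.toNNReal ω)) 2 μ := by
  simp_rw [intervalIntegral.integral_of_le t.coe_nonneg, ← integral_Icc_eq_integral_Ioc]
  exact memLp_integral_time (f := fun p => a (onPaths x p)) (a.comp_memLp' (hx.memLp_onPaths t))

theorem memLp_martingale (hx : IsSDESolution μ ℱ W a c x₀ x) (hW : IsFilteredBrownian μ ℱ W)
    (t : ℝ≥0) : MemLp (fun ω => x t ω - x₀ - ∫ s in (0 : ℝ)..t, a (x s.toNNReal ω)) 2 μ :=
  (hx.equation t).memLp hW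

theorem memLp [CompleteSpace E] (hx : IsSDESolution μ ℱ W a c x₀ x)
    (hW : IsFilteredBrownian μ ℱ W) (t : ℝ≥0) : MemLp (x t) 2 μ := by
  have h := ((hx.memLp_martingale hW t).add (hx.memLp_drift t)).add (memLp_const x₀)
  refine h.ae_eq (Eventually.of_forall fun ω => ?_)
  simp only [Pi.add_apply]
  abel

theorem stronglyMeasurable (hx : IsSDESolution μ ℱ W a c x₀ x) (t : ℝ≥0) :
    StronglyMeasurable[ℱ t] (x t) :=
  hx.progressive.stronglyAdapted t

/-- An injection which intertwines the coefficients maps solutions to solutions. -/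
theorem map [CompleteSpace E] [CompleteSpace F] (hx : IsSDESolution μ ℱ W a c x₀ x)
    {a' c' : F →L[ℝ] F} (L : E →L[ℝ] F)
    (ha : ∀ v, L (a v) = a' (L v)) (hc : ∀ v, L (c v) = c' (L v)) :
    IsSDESolution μ ℱ W a' c' (L x₀) (fun t ω => L (x t ω)) where
  progressive i := L.continuous.comp_stronglyMeasurable (hx.progressive i)
  continuous_paths := by
    filter_upwards [hx.continuous_paths] with ω hω using L.continuous.comp hω
  sq_integrable T := by
    refine lt_of_le_of_lt (lintegral_mono fun ω => lintegral_mono fun s =>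
      pow_le_pow_left' (L.le_opENorm _) 2) ?_
    have hL : ‖L‖ₑ ^ 2 ≠ ∞ := by simp
    simp_rw [mul_pow, lintegral_const_mul' _ _ hL]
    exact ENNReal.mul_lt_top hL.lt_top (hx.sq_integrable T)
  initial := by
    filter_upwards [hx.initial] with ω hω
    rw [hω]
  equation t := by
    have h := (hx.equation t).map L
    simp only [hc] at h
    obtain ⟨h0, ψ, h1, h2⟩ := h
    have he : (fun ω => L (x t ω - x₀ - ∫ s in (0 : ℝ)..t, a (x s.toNNReal ω))) =ᵐ[μ]
        fun ω => L (x t ω) - L x₀ - ∫ s in (0 : ℝ)..t, a' (L (x s.toNNReal ω)) := by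
      filter_upwards [hx.continuous_paths] with ω hω
      have hcont : Continuous fun s : ℝ => a (x s.toNNReal ω) :=
        a.continuous.comp (hω.comp continuous_real_toNNReal)
      simp_rw [← ha]
      rw [L.intervalIntegral_comp_comm (hcont.intervalIntegrable _ _), map_sub, map_sub]
    refine ⟨h0.congr he, ψ, h1, h2.congr fun j => lintegral_congr_ae ?_⟩
    filter_upwards [he] with ω hω
    rw [hω]

end IsSDESolution

end SDE

/-! ### Moments of solutions -/

section Moments

variable {Ω : Type*} {m : MeasurableSpace Ω} {μ : Measure Ω} [IsProbabilityMeasure μ]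
  {ℱ : Filtration ℝ≥0 m} {W : ℝ≥0 → Ω → ℝ}
  {E : Type*} [NormedAddCommGroup E] [InnerProductSpace ℝ E] [CompleteSpace E]
  {a c : E →L[ℝ] E} {x₀ : E} {x : ℝ≥0 → Ω → E}

namespace IsSDESolution

/-- The martingale part of a solution. -/
noncomputable def martingalePart (a : E →L[ℝ] E) (x₀ : E) (x : ℝ≥0 → Ω → E) (t : ℝ≥0) (ω : Ω) : E :=
  x t ω - x₀ - ∫ s in (0 : ℝ)..t, a (x s.toNNReal ω)

/-- The bounded variation part of a solution. -/
noncomputable def driftPart (a : E →L[ℝ] E) (x₀ : E) (x : ℝ≥0 → Ω → E) (t : ℝ≥0) (ω : Ω) : E :=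
  x₀ + ∫ s in (0 : ℝ)..t, a (x s.toNNReal ω)

theorem driftPart_add_martingalePart (a : E →L[ℝ] E) (x₀ : E) (x : ℝ≥0 → Ω → E) (t : ℝ≥0) (ω : Ω) :
    driftPart a x₀ x t ω + martingalePart a x₀ x t ω = x t ω := by
  simp only [driftPart, martingalePart]; abel

theorem memLp_martingalePart (hx : IsSDESolution μ ℱ W a c x₀ x) (hW : IsFilteredBrownian μ ℱ W)
    (t : ℝ≥0) : MemLp (martingalePart a x₀ x t) 2 μ :=
  (hx.equation t).memLp hW

theorem memLp_driftPart (hx : IsSDESolution μ ℱ W a c x₀ x) (t : ℝ≥0) :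
    MemLp (driftPart a x₀ x t) 2 μ :=
  (memLp_const x₀).add (hx.memLp_drift t)

theorem aestronglyMeasurable_integrand (hx : IsSDESolution μ ℱ W a c x₀ x) (t : ℝ≥0) :
    AEStronglyMeasurable (onPaths fun s ω => c (x s ω)) (pathMeasure μ t) :=
  c.continuous.comp_aestronglyMeasurable (aestronglyMeasurable_onPaths hx.progressive t)

/-- The martingale property: a variable known at time `s` does not see the martingale part after
`s`. -/
theorem integral_inner_martingalePart (hx : IsSDESolution μ ℱ W a c x₀ x)
    (hW : IsFilteredBrownian μ ℱ W) {s t : ℝ≥0} (hst : s ≤ t) {Y : Ω → E}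
    (hY : StronglyMeasurable[ℱ s] Y) (hY2 : MemLp Y 2 μ) :
    ∫ ω, inner ℝ (martingalePart a x₀ x t ω) (Y ω) ∂μ
      = ∫ ω, inner ℝ (martingalePart a x₀ x s ω) (Y ω) ∂μ :=
  IsItoIntegral.integral_inner_eq hst hW (hx.equation s) (hx.equation t)
    (hx.aestronglyMeasurable_integrand t) hY hY2

theorem integral_inner_martingalePart_const (hx : IsSDESolution μ ℱ W a c x₀ x)
    (hW : IsFilteredBrownian μ ℱ W) (t : ℝ≥0) (v : E) :
    ∫ ω, inner ℝ (martingalePart a x₀ x t ω) v ∂μ = 0 := by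
  rw [hx.integral_inner_martingalePart hW (zero_le : 0 ≤ t) (Y := fun _ => v)
    stronglyMeasurable_const (memLp_const v)]
  refine integral_eq_zero_of_ae ?_
  filter_upwards [hx.initial] with ω hω
  simp [martingalePart, hω]

/-- The drift part is square integrable jointly in chance and time. -/
theorem memLp_onPaths_driftPart (hx : IsSDESolution μ ℱ W a c x₀ x) (T : ℝ≥0) :
    MemLp (onPaths (driftPart a x₀ x)) 2 (pathMeasure μ T) := by
  -- Measurability: write the inner integral over the fixed interval `[0, T]` with a cut-off.
  have hm : AEStronglyMeasurable (onPaths (driftPart a x₀ x)) (pathMeasure μ T) := by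
    refine (AEStronglyMeasurable.const_add ?_ x₀ :)
    have h1 : StronglyMeasurable (fun q : (Ω × ℝ) × ℝ =>
        {q : (Ω × ℝ) × ℝ | q.2 ≤ q.1.2}.indicator
          (fun q => a (x (min q.2.toNNReal T) q.1.1)) q) :=
      StronglyMeasurable.indicator (a.continuous.comp_stronglyMeasurable
        ((stronglyMeasurable_stopped hx.progressive T).comp_measurable
          ((measurable_fst.comp measurable_fst).prodMk measurable_snd)))
        (measurableSet_le measurable_snd (measurable_snd.comp measurable_fst))
    refine ⟨_, h1.integral_prod_right' (ν := volume.restrict (Ioc (0 : ℝ) T)), ?_⟩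
    filter_upwards [ae_pathMeasure_mem μ T] with p hp
    rw [Real.coe_toNNReal _ hp.1, intervalIntegral.integral_of_le hp.1]
    have h2 : (fun r : ℝ => {q : (Ω × ℝ) × ℝ | q.2 ≤ q.1.2}.indicator
          (fun q => a (x (min q.2.toNNReal T) q.1.1)) (p, r))
        = (Iic p.2).indicator (fun r => a (x (min r.toNNReal T) p.1)) := rfl
    rw [h2, setIntegral_indicator measurableSet_Iic, Ioc_inter_Iic, min_eq_right hp.2]
    refine setIntegral_congr_fun measurableSet_Ioc fun r hr => ?_
    have : r.toNNReal ≤ T := Real.toNNReal_le_iff_le_coe.2 (hr.2.trans hp.2)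
    simp only [min_eq_left this]
  -- Domination by the integral of the norm over the whole interval.
  have h3 := memLp_integral_time (f := fun p => ‖a (onPaths x p)‖)
    (a.comp_memLp' (hx.memLp_onPaths T)).norm
  have h4 := ((memLp_const ‖x₀‖).add h3).comp_fst (volume.restrict (Icc (0 : ℝ) T))
  refine h4.mono hm ?_
  have hc := (Measure.quasiMeasurePreserving_fst (μ := μ)
    (ν := volume.restrict (Icc (0 : ℝ) T))).ae hx.continuous_paths
  filter_upwards [ae_pathMeasure_mem μ T, hc] with p hp hcont
  refine le_trans ?_ (le_abs_self _)
  refine (norm_add_le _ _).trans (add_le_add le_rfl ?_)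
  rw [Real.coe_toNNReal _ hp.1, intervalIntegral.integral_of_le hp.1]
  refine (norm_integral_le_integral_norm _).trans ?_
  have hcont' : Continuous fun s : ℝ => ‖a (x s.toNNReal p.1)‖ :=
    (a.continuous.comp (hcont.comp continuous_real_toNNReal)).norm
  exact setIntegral_mono_set (hcont'.integrableOn_Icc) (Eventually.of_forall fun _ => norm_nonneg _)
    (LE.le.eventuallyLE (Ioc_subset_Icc_self.trans (Icc_subset_Icc_right hp.2)))

theorem integrable_inner_onPaths (hx : IsSDESolution μ ℱ W a c x₀ x) (L L' : E →L[ℝ] E) (t : ℝ≥0) :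
    Integrable (fun p => inner ℝ (L (onPaths x p)) (L' (onPaths x p))) (pathMeasure μ t) :=
  integrable_inner_of_memLp (L.comp_memLp' (hx.memLp_onPaths t))
    (L'.comp_memLp' (hx.memLp_onPaths t))

theorem integrableOn_integral_inner (hx : IsSDESolution μ ℱ W a c x₀ x) (L L' : E →L[ℝ] E)
    (t : ℝ≥0) :
    IntegrableOn (fun s : ℝ => ∫ ω, inner ℝ (L (x s.toNNReal ω)) (L' (x s.toNNReal ω)) ∂μ)
      (Icc (0 : ℝ) t) volume :=
  (hx.integrable_inner_onPaths L L' t).integral_prod_right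

/-- The chain rule for the quadratic form of the drift part, integrated over chance. -/
theorem integral_inner_driftPart (hx : IsSDESolution μ ℱ W a c x₀ x)
    {G : E →L[ℝ] E} (hG : ∀ u v, inner ℝ (G u) v = inner ℝ u (G v)) (t : ℝ≥0) :
    ∫ ω, inner ℝ (G (driftPart a x₀ x t ω)) (driftPart a x₀ x t ω) ∂μ
      = inner ℝ (G x₀) x₀ + 2 * ∫ s in Icc (0 : ℝ) t,
          ∫ ω, inner ℝ (G (a (x s.toNNReal ω))) (driftPart a x₀ x s.toNNReal ω) ∂μ := by
  have hint : Integrable (fun p : Ω × ℝ =>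
      inner ℝ (G (a (onPaths x p))) (onPaths (driftPart a x₀ x) p)) (pathMeasure μ t) :=
    integrable_inner_of_memLp ((G.comp a).comp_memLp' (hx.memLp_onPaths t))
      (hx.memLp_onPaths_driftPart t)
  -- The identity holds along each continuous path, by the fundamental theorem of calculus.
  have hpath : ∀ᵐ ω ∂μ, inner ℝ (G (driftPart a x₀ x t ω)) (driftPart a x₀ x t ω)
      = inner ℝ (G x₀) x₀ + 2 * ∫ s in Icc (0 : ℝ) t,
          inner ℝ (G (a (x s.toNNReal ω))) (driftPart a x₀ x s.toNNReal ω) := by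
    filter_upwards [hx.continuous_paths] with ω hω
    have hf : Continuous fun s : ℝ => a (x s.toNNReal ω) :=
      a.continuous.comp (hω.comp continuous_real_toNNReal)
    set u : ℝ → E := fun s => x₀ + ∫ r in (0 : ℝ)..s, a (x r.toNNReal ω) with hu
    have hd : ∀ s, HasDerivAt u (a (x s.toNNReal ω)) s := fun s =>
      (hf.integral_hasStrictDerivAt 0 s).hasDerivAt.const_add x₀
    have huc : Continuous u := continuous_iff_continuousAt.2 fun s => (hd s).continuousAt
    have hd2 : ∀ s, HasDerivAt (fun s => inner ℝ (G (u s)) (u s))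
        (2 * inner ℝ (G (a (x s.toNNReal ω))) (u s)) s := fun s => by
      have h := (G.hasFDerivAt.comp_hasDerivAt s (hd s)).inner ℝ (hd s)
      refine h.congr_deriv ?_
      simp only [Function.comp_apply]
      rw [hG (u s), real_inner_comm]; ring
    have hft := intervalIntegral.integral_eq_sub_of_hasDerivAt (a := (0 : ℝ)) (b := t)
      (fun s _ => hd2 s) (by
        refine Continuous.intervalIntegrable ?_ _ _
        exact continuous_const.mul ((G.continuous.comp hf).inner huc))
    have hu0 : u 0 = x₀ := by simp [hu]
    have hut : u t = driftPart a x₀ x t ω := rfl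
    rw [hu0, hut, intervalIntegral.integral_const_mul,
      intervalIntegral.integral_of_le t.coe_nonneg, ← integral_Icc_eq_integral_Ioc] at hft
    rw [setIntegral_congr_fun (g := fun s => inner ℝ (G (a (x s.toNNReal ω))) (u s))
      measurableSet_Icc fun s hs => ?_, hft]
    · ring
    · simp only [driftPart, hu, Real.coe_toNNReal _ hs.1]
  have hm := hint.integral_prod_left
  rw [integral_congr_ae hpath, integral_add (integrable_const _) (hm.const_mul 2), integral_const,
    integral_const_mul, ← integral_prod_symm _ hint, integral_prod _ hint]
  simp

/-- The cross term of drift and martingale part: only the drift is differentiated, since the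
martingale property replaces the martingale part at time `t` by the one at time `s`. -/
theorem integral_inner_driftPart_martingalePart (hx : IsSDESolution μ ℱ W a c x₀ x)
    (hW : IsFilteredBrownian μ ℱ W) (G : E →L[ℝ] E) (t : ℝ≥0) :
    IntegrableOn (fun s : ℝ => ∫ ω, inner ℝ (G (a (x s.toNNReal ω)))
      (martingalePart a x₀ x s.toNNReal ω) ∂μ) (Icc (0 : ℝ) t) volume ∧
    ∫ ω, inner ℝ (G (driftPart a x₀ x t ω)) (martingalePart a x₀ x t ω) ∂μ
      = ∫ s in Icc (0 : ℝ) t, ∫ ω, inner ℝ (G (a (x s.toNNReal ω)))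
          (martingalePart a x₀ x s.toNNReal ω) ∂μ := by
  have hM := hx.memLp_martingalePart hW t
  have hint : Integrable (fun p : Ω × ℝ =>
      inner ℝ (G (a (onPaths x p))) (martingalePart a x₀ x t p.1)) (pathMeasure μ t) :=
    integrable_inner_of_memLp ((G.comp a).comp_memLp' (hx.memLp_onPaths t))
      (hM.comp_fst (volume.restrict (Icc (0 : ℝ) t)))
  -- The martingale property, tested with the drift at time `s`.
  have hcong : ∀ s ∈ Icc (0 : ℝ) t,
      ∫ ω, inner ℝ (G (a (x s.toNNReal ω))) (martingalePart a x₀ x t ω) ∂μ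
      = ∫ ω, inner ℝ (G (a (x s.toNNReal ω))) (martingalePart a x₀ x s.toNNReal ω) ∂μ := by
    intro s hs
    simp_rw [real_inner_comm (martingalePart a x₀ x _ _)]
    exact hx.integral_inner_martingalePart hW (Real.toNNReal_le_iff_le_coe.2 hs.2)
      ((G.comp a).continuous.comp_stronglyMeasurable (hx.stronglyMeasurable _))
      ((G.comp a).comp_memLp' (hx.memLp hW _))
  refine ⟨(hint.integral_prod_right).congr ?_, ?_⟩
  · filter_upwards [ae_restrict_mem measurableSet_Icc] with s hs using hcong s hs
  rw [← setIntegral_congr_fun measurableSet_Icc hcong,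
    ← integral_prod_symm _ hint, integral_prod _ hint]
  have hpath : ∀ᵐ ω ∂μ, inner ℝ (G (driftPart a x₀ x t ω)) (martingalePart a x₀ x t ω)
      = inner ℝ (martingalePart a x₀ x t ω) (G x₀) + ∫ s in Icc (0 : ℝ) t,
          inner ℝ (G (a (x s.toNNReal ω))) (martingalePart a x₀ x t ω) := by
    filter_upwards [hx.continuous_paths] with ω hω
    have hf : Continuous fun s : ℝ => a (x s.toNNReal ω) :=
      a.continuous.comp (hω.comp continuous_real_toNNReal)
    simp_rw [real_inner_comm (martingalePart a x₀ x t ω) (G _)]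
    have hGi : IntegrableOn (fun s : ℝ => G (a (x s.toNNReal ω))) (Icc (0 : ℝ) t) volume :=
      (G.continuous.comp hf).integrableOn_Icc
    rw [integral_inner hGi, ← inner_add_right]
    congr 1
    rw [driftPart, map_add, intervalIntegral.integral_of_le t.coe_nonneg,
      ← integral_Icc_eq_integral_Ioc]
    congr 1
    exact (G.integral_comp_comm hf.integrableOn_Icc).symm
  rw [integral_congr_ae hpath, integral_add (integrable_inner_of_memLp hM (memLp_const _))
    hint.integral_prod_left, hx.integral_inner_martingalePart_const hW, zero_add]

/-- The second moments of a solution satisfy the integrated Lyapunov equation: this is Itô's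
formula for a quadratic form, after taking expectations. -/
theorem integral_inner_self (hx : IsSDESolution μ ℱ W a c x₀ x) (hW : IsFilteredBrownian μ ℱ W)
    {G : E →L[ℝ] E} (hG : ∀ u v, inner ℝ (G u) v = inner ℝ u (G v)) (t : ℝ≥0) :
    ∫ ω, inner ℝ (G (x t ω)) (x t ω) ∂μ = inner ℝ (G x₀) x₀ + ∫ s in Icc (0 : ℝ) t,
      (2 * ∫ ω, inner ℝ (G (a (x s.toNNReal ω))) (x s.toNNReal ω) ∂μ
        + ∫ ω, inner ℝ (G (c (x s.toNNReal ω))) (c (x s.toNNReal ω)) ∂μ) := by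
  have hD := hx.memLp_driftPart t
  have hM := hx.memLp_martingalePart hW t
  have hDM : Integrable (fun ω => 2 *
      inner ℝ (G (driftPart a x₀ x t ω)) (martingalePart a x₀ x t ω)) μ :=
    (integrable_inner_of_memLp (G.comp_memLp' hD) hM).const_mul 2
  have hDD : Integrable (fun ω => inner ℝ (G (driftPart a x₀ x t ω)) (driftPart a x₀ x t ω)) μ :=
    integrable_inner_of_memLp (G.comp_memLp' hD) hD
  have hMM : Integrable (fun ω =>
      inner ℝ (G (martingalePart a x₀ x t ω)) (martingalePart a x₀ x t ω)) μ :=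
    integrable_inner_of_memLp (G.comp_memLp' hM) hM
  have hDs : Integrable (fun ω => inner ℝ (G (driftPart a x₀ x t ω)) (driftPart a x₀ x t ω)
      + 2 * inner ℝ (G (driftPart a x₀ x t ω)) (martingalePart a x₀ x t ω)) μ := hDD.add hDM
  -- Expand the quadratic form of `x = drift + martingale`.
  have hsplit : ∫ ω, inner ℝ (G (x t ω)) (x t ω) ∂μ
      = ∫ ω, inner ℝ (G (driftPart a x₀ x t ω)) (driftPart a x₀ x t ω) ∂μ
        + 2 * ∫ ω, inner ℝ (G (driftPart a x₀ x t ω)) (martingalePart a x₀ x t ω) ∂μ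
        + ∫ ω, inner ℝ (G (martingalePart a x₀ x t ω)) (martingalePart a x₀ x t ω) ∂μ := by
    rw [← integral_const_mul, ← integral_add hDD hDM, ← integral_add hDs hMM]
    congr 1; ext ω
    rw [← driftPart_add_martingalePart a x₀ x t ω]
    simp only [map_add, inner_add_left, inner_add_right]
    rw [hG (martingalePart a x₀ x t ω) (driftPart a x₀ x t ω),
      real_inner_comm (G (driftPart a x₀ x t ω)) (martingalePart a x₀ x t ω)]
    ring
  obtain ⟨hi, hDMeq⟩ := hx.integral_inner_driftPart_martingalePart hW G t
  -- The square of the martingale part is given by the Itô isometry.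
  have hMMeq : ∫ ω, inner ℝ (G (martingalePart a x₀ x t ω)) (martingalePart a x₀ x t ω) ∂μ
      = ∫ s in Icc (0 : ℝ) t, ∫ ω, inner ℝ (G (c (x s.toNNReal ω))) (c (x s.toNNReal ω)) ∂μ := by
    have h := IsItoIntegral.integral_inner hW ((hx.equation t).map G) (hx.equation t)
      (G.continuous.comp_aestronglyMeasurable (hx.aestronglyMeasurable_integrand t))
      (hx.aestronglyMeasurable_integrand t)
    refine h.trans ?_
    exact integral_prod_symm _ (hx.integrable_inner_onPaths (G.comp c) c t)
  have hU : IntegrableOn (fun s : ℝ => ∫ ω, inner ℝ (G (a (x s.toNNReal ω)))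
      (driftPart a x₀ x s.toNNReal ω) ∂μ) (Icc (0 : ℝ) t) volume :=
    (integrable_inner_of_memLp ((G.comp a).comp_memLp' (hx.memLp_onPaths t))
      (hx.memLp_onPaths_driftPart t)).integral_prod_right
  -- The integrands of the drift term and of the cross term recombine into the state.
  have hsum : ∀ s : ℝ, ∫ ω, inner ℝ (G (a (x s.toNNReal ω))) (x s.toNNReal ω) ∂μ
      = ∫ ω, inner ℝ (G (a (x s.toNNReal ω))) (driftPart a x₀ x s.toNNReal ω) ∂μ
        + ∫ ω, inner ℝ (G (a (x s.toNNReal ω))) (martingalePart a x₀ x s.toNNReal ω) ∂μ := by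
    intro s
    have hg := (G.comp a).comp_memLp' (hx.memLp hW s.toNNReal)
    refine Eq.trans ?_ (integral_add (integrable_inner_of_memLp hg (hx.memLp_driftPart _))
      (integrable_inner_of_memLp hg (hx.memLp_martingalePart hW _)))
    congr 1; ext ω
    rw [← inner_add_right, driftPart_add_martingalePart]
  rw [hsplit, hx.integral_inner_driftPart hG, hDMeq, hMMeq]
  have h2 : ∫ s in Icc (0 : ℝ) t,
      (2 * ∫ ω, inner ℝ (G (a (x s.toNNReal ω))) (x s.toNNReal ω) ∂μ
        + ∫ ω, inner ℝ (G (c (x s.toNNReal ω))) (c (x s.toNNReal ω)) ∂μ)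
      = 2 * (∫ s in Icc (0 : ℝ) t, ∫ ω, inner ℝ (G (a (x s.toNNReal ω))) (x s.toNNReal ω) ∂μ)
        + ∫ s in Icc (0 : ℝ) t, ∫ ω, inner ℝ (G (c (x s.toNNReal ω))) (c (x s.toNNReal ω)) ∂μ := by
    rw [← integral_const_mul]
    exact integral_add ((hx.integrableOn_integral_inner (G.comp a) (.id ℝ E) t).const_mul 2)
      (hx.integrableOn_integral_inner (G.comp c) c t)
  rw [h2]
  simp_rw [hsum]
  rw [integral_add hU hi]
  ring

/-- The mean of a solution solves the deterministic equation `m' = a m`. -/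
theorem integral_eq (hx : IsSDESolution μ ℱ W a c x₀ x) (hW : IsFilteredBrownian μ ℱ W)
    (t : ℝ≥0) :
    ∫ ω, x t ω ∂μ = x₀ + ∫ s in (0 : ℝ)..t, a (∫ ω, x s.toNNReal ω ∂μ) := by
  have hMi : Integrable (martingalePart a x₀ x t) μ :=
    (hx.memLp_martingalePart hW t).integrable one_le_two
  have hM : ∫ ω, martingalePart a x₀ x t ω ∂μ = 0 := by
    refine integral_eq_zero_of_forall_integral_inner_eq_zero ℝ _ hMi fun v => ?_
    simp_rw [real_inner_comm _ v]
    exact hx.integral_inner_martingalePart_const hW t v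
  have hint : Integrable (fun p : Ω × ℝ => a (onPaths x p)) (pathMeasure μ t) :=
    (a.comp_memLp' (hx.memLp_onPaths t)).integrable one_le_two
  have hDr : Integrable (fun ω => ∫ s in Icc (0 : ℝ) t, a (x s.toNNReal ω)) μ :=
    hint.integral_prod_left
  have e : ∀ ω, x t ω = (x₀ + ∫ s in Icc (0 : ℝ) t, a (x s.toNNReal ω))
      + martingalePart a x₀ x t ω := by
    intro ω
    rw [integral_Icc_eq_integral_Ioc, ← intervalIntegral.integral_of_le t.coe_nonneg]
    exact (driftPart_add_martingalePart a x₀ x t ω).symm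
  have hD : Integrable (fun ω => x₀ + ∫ s in Icc (0 : ℝ) t, a (x s.toNNReal ω)) μ :=
    (integrable_const _).add hDr
  simp_rw [e]
  rw [integral_add hD hMi, integral_add (integrable_const _) hDr, hM]
  have h1 := (integral_prod _ hint).symm.trans (integral_prod_symm _ hint)
  rw [intervalIntegral.integral_of_le t.coe_nonneg, ← integral_Icc_eq_integral_Ioc]
  simp only [integral_const, probReal_univ, one_smul, add_zero]
  rw [show (∫ ω, ∫ s in Icc (0 : ℝ) t, a (x s.toNNReal ω) ∂volume ∂μ) = _ from h1]
  congr 1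
  refine integral_congr_ae (Eventually.of_forall fun s => ?_)
  exact a.integral_comp_comm ((hx.memLp hW s.toNNReal).integrable one_le_two)

end IsSDESolution

end Moments

/-! ### Progressive modifications and the maximal inequality -/

section Maximal

variable {Ω : Type*} {m : MeasurableSpace Ω} {μ : Measure Ω} [IsProbabilityMeasure μ]
  {ℱ : Filtration ℝ≥0 m} {W : ℝ≥0 → Ω → ℝ}
  {E : Type*} [NormedAddCommGroup E] [InnerProductSpace ℝ E] [CompleteSpace E]

theorem isStronglyProgressive_limUnder {x : ℕ → ℝ≥0 → Ω → E}
    (hx : ∀ k, IsStronglyProgressive ℱ (x k)) :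
    IsStronglyProgressive ℱ (fun t ω => limUnder atTop (fun k => x k t ω)) := fun i =>
  @MeasureTheory.StronglyMeasurable.limUnder ℕ (Iic i × Ω) E
    (Subtype.instMeasurableSpace.prod (ℱ i)) _ _ atTop _ _ ⟨0⟩ _ fun k => hx k i

theorem measurable_floor_mul_prodMk {α : Type*} [MeasurableSpace α] (i c : ℝ≥0) :
    Measurable (fun p : Iic i × α => (⌊(p.1 : ℝ≥0) * c⌋₊, p.2)) :=
  (Nat.measurable_floor.comp ((measurable_subtype_coe.comp measurable_fst).mul_const c)).prodMk
    measurable_snd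

/-- The filtration need not be complete, so an adapted process with almost surely continuous paths
need not be progressive. The limit of its left-point samplings on the grids `ℕ / (j + 1)` is, and it has
the same paths outside a null set. -/
theorem exists_isStronglyProgressive_modification (hW : StronglyAdapted ℱ W)
    (hc : ∀ᵐ ω ∂μ, Continuous fun t => W t ω) :
    ∃ W' : ℝ≥0 → Ω → ℝ, IsStronglyProgressive ℱ W' ∧ ∀ᵐ ω ∂μ, ∀ t, W' t ω = W t ω := by
  -- `d j t` is the last grid point before `t`; sampling there keeps the process adapted.
  set d : ℕ → ℝ≥0 → ℝ≥0 := fun j t => (⌊t * (j + 1)⌋₊ : ℝ≥0) / (j + 1) with hd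
  have hdle : ∀ j t, d j t ≤ t := fun j t => by
    rw [hd]
    exact div_le_of_le_mul₀ zero_le zero_le (Nat.floor_le zero_le)
  have hdlt : ∀ t, Tendsto (fun j => d j t) atTop (𝓝 t) := fun t => by
    have h := (tendsto_nat_floor_mul_div_atTop (R := ℝ) t.coe_nonneg).comp
      ((tendsto_natCast_atTop_atTop (R := ℝ)).comp (tendsto_add_atTop_nat 1))
    rw [← NNReal.tendsto_coe]
    refine h.congr fun j => ?_
    simp only [hd, Function.comp_apply, NNReal.coe_div, NNReal.coe_natCast, NNReal.coe_add,
      NNReal.coe_one, Nat.cast_add, Nat.cast_one]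
    congr 2
  refine ⟨fun t ω => limUnder atTop (fun j => W (d j t) ω),
    isStronglyProgressive_limUnder (x := fun j t ω => W (d j t) ω) fun j i => ?_, ?_⟩
  · refine Measurable.stronglyMeasurable ?_
    have h1 : Measurable[(⊤ : MeasurableSpace ℕ).prod (ℱ i)]
        (fun q : ℕ × Ω => W (min ((q.1 : ℝ≥0) / (j + 1)) i) q.2) :=
      @measurable_from_prod_countable_right ℕ Ω ℝ _ (ℱ i) _ _ _ _ fun k =>
        ((hW (min ((k : ℝ≥0) / (j + 1)) i)).mono (ℱ.mono (min_le_right _ _))).measurable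
    have h2 := @measurable_floor_mul_prodMk Ω (ℱ i) i (j + 1)
    have e : (fun p : Iic i × Ω => W (d j p.1) p.2)
        = (fun q : ℕ × Ω => W (min ((q.1 : ℝ≥0) / (j + 1)) i) q.2)
          ∘ fun p : Iic i × Ω => (⌊(p.1 : ℝ≥0) * (j + 1)⌋₊, p.2) := by
      ext p
      exact congrArg (fun t => W t p.2) (min_eq_left ((hdle j p.1).trans p.1.2)).symm
    rw [e]
    exact h1.comp h2
  · filter_upwards [hc] with ω hω t
    exact ((hω.tendsto t).comp (hdlt t)).limUnder_eq

/-- Kolmogorov's inequality for a square integrable martingale sampled at finitely many times. -/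
theorem measure_exists_mem_finset_lt_le {M : ℝ≥0 → Ω → E} {T : ℝ≥0}
    (hM : ∀ t, StronglyMeasurable[ℱ t] (M t)) (hM2 : ∀ t, MemLp (M t) 2 μ)
    (hmart : ∀ t ≤ T, ∀ Y : Ω → E, StronglyMeasurable[ℱ t] Y → MemLp Y 2 μ →
      ∫ ω, inner ℝ (M T ω - M t ω) (Y ω) ∂μ = 0)
    (F : Finset ℝ≥0) (hF : ∀ t ∈ F, t ≤ T) {η : ℝ} (hη : 0 < η) :
    μ {ω | ∃ t ∈ F, η < ‖M t ω‖} ≤ ENNReal.ofReal ((∫ ω, ‖M T ω‖ ^ 2 ∂μ) / η ^ 2) := by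
  -- `A t`: the threshold is exceeded at time `t` for the first time.
  set A : ℝ≥0 → Set Ω := fun t => {ω | η < ‖M t ω‖} \ ⋃ s ∈ F.filter (· < t), {ω | η < ‖M s ω‖}
    with hA
  have hSm : ∀ t, MeasurableSet[ℱ t] {ω | η < ‖M t ω‖} := fun t =>
    @stronglyMeasurable_const Ω ℝ (ℱ t) _ η |>.measurableSet_lt (hM t).norm
  have hAm : ∀ t, MeasurableSet[ℱ t] (A t) := fun t =>
    (hSm t).diff (Finset.measurableSet_biUnion _ fun s hs =>
      ℱ.mono (Finset.mem_filter.1 hs).2.le _ (hSm s))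
  have hAm' : ∀ t, MeasurableSet (A t) := fun t => ℱ.le t _ (hAm t)
  have hdisj : Set.Pairwise (↑F : Set ℝ≥0) (Function.onFun Disjoint A) := by
    have key : ∀ s ∈ F, ∀ t ∈ F, s < t → Disjoint (A s) (A t) := by
      intro s hs t ht hst
      rw [Set.disjoint_left]
      intro ω h1 h2
      refine h2.2 (mem_iUnion₂.2 ⟨s, Finset.mem_filter.2 ⟨hs, hst⟩, h1.1⟩)
    intro s hs t ht hst
    rcases lt_or_gt_of_ne hst with h | h
    · exact key s hs t ht h
    · exact (key t ht s hs h).symm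
  have hcover : {ω | ∃ t ∈ F, η < ‖M t ω‖} = ⋃ t ∈ F, A t := by
    ext ω
    simp only [mem_ofPred_eq, mem_iUnion, exists_prop]
    constructor
    · rintro ⟨t, ht, h⟩
      obtain ⟨t₀, ht₀, hmin⟩ := Finset.exists_min_image (F.filter fun t => η < ‖M t ω‖) id
        ⟨t, Finset.mem_filter.2 ⟨ht, h⟩⟩
      rw [Finset.mem_filter] at ht₀
      refine ⟨t₀, ht₀.1, ht₀.2, ?_⟩
      intro hmem
      obtain ⟨s, hs, hs'⟩ := mem_iUnion₂.1 hmem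
      rw [Finset.mem_filter] at hs
      exact absurd (hmin s (Finset.mem_filter.2 ⟨hs.1, hs'⟩)) (not_le.2 hs.2)
    · rintro ⟨t, ht, h⟩
      exact ⟨t, ht, h.1⟩
  have hint : ∀ t, Integrable (fun ω => ‖M t ω‖ ^ 2) μ := fun t =>
    (memLp_two_iff_integrable_sq_norm (hM2 t).1).1 (hM2 t)
  -- On `A t` the martingale has norm above `η` at time `t`, and its second moment over `A t`
  -- can only increase until time `T`.
  have hstep : ∀ t ∈ F, η ^ 2 * μ.real (A t) ≤ ∫ ω in A t, ‖M T ω‖ ^ 2 ∂μ := by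
    intro t ht
    have h1 : η ^ 2 * μ.real (A t) ≤ ∫ ω in A t, ‖M t ω‖ ^ 2 ∂μ := by
      have := setIntegral_mono_on (f := fun _ => η ^ 2) (g := fun ω => ‖M t ω‖ ^ 2) (μ := μ)
        (integrableOn_const (measure_ne_top μ (A t))) (hint t).integrableOn (hAm' t)
        fun ω hω => by
          have : η < ‖M t ω‖ := hω.1
          gcongr
      rwa [setIntegral_const, smul_eq_mul, mul_comm] at this
    have hY : StronglyMeasurable[ℱ t] ((A t).indicator (M t)) := (hM t).indicator (hAm t)
    have hY2 : MemLp ((A t).indicator (M t)) 2 μ := (hM2 t).indicator (hAm' t)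
    have h2 := hmart t (hF t ht) _ hY hY2
    have h3 : ∫ ω in A t, inner ℝ (M T ω - M t ω) (M t ω) ∂μ = 0 := by
      rw [← integral_indicator (hAm' t), ← h2]
      congr 1; ext ω
      by_cases hω : ω ∈ A t <;> simp [hω]
    have hi3 : Integrable (fun ω => inner ℝ (M T ω - M t ω) (M t ω)) μ :=
      integrable_inner_of_memLp ((hM2 T).sub (hM2 t)) (hM2 t)
    have h4 : ∫ ω in A t, (‖M t ω‖ ^ 2 + 2 * inner ℝ (M T ω - M t ω) (M t ω)) ∂μ
        ≤ ∫ ω in A t, ‖M T ω‖ ^ 2 ∂μ := by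
      refine setIntegral_mono ((hint t).add (hi3.const_mul 2)).integrableOn
        (hint T).integrableOn fun ω => ?_
      have h5 := norm_add_sq_real (M T ω - M t ω) (M t ω)
      rw [sub_add_cancel] at h5
      have := sq_nonneg ‖M T ω - M t ω‖
      simp only
      linarith
    rw [integral_add (hint t).integrableOn (hi3.const_mul 2).integrableOn, integral_const_mul,
      h3] at h4
    linarith
  have hsum : η ^ 2 * μ.real (⋃ t ∈ F, A t) ≤ ∫ ω, ‖M T ω‖ ^ 2 ∂μ := by
    rw [measureReal_biUnion_finset hdisj fun t _ => hAm' t, Finset.mul_sum]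
    refine (Finset.sum_le_sum hstep).trans ?_
    rw [← integral_biUnion_finset F (fun t _ => hAm' t) hdisj fun t _ => (hint T).integrableOn]
    exact setIntegral_le_integral (hint T) (Eventually.of_forall fun _ => by positivity)
  rw [hcover, ← ofReal_measureReal (measure_ne_top _ _)]
  refine ENNReal.ofReal_le_ofReal ?_
  rw [le_div_iff₀ (by positivity)]
  linarith

/-- The maximal inequality for a square integrable martingale with continuous paths. -/
theorem measure_exists_le_lt_le {M : ℝ≥0 → Ω → E} {T : ℝ≥0}
    (hM : ∀ t, StronglyMeasurable[ℱ t] (M t)) (hM2 : ∀ t, MemLp (M t) 2 μ)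
    (hmart : ∀ t ≤ T, ∀ Y : Ω → E, StronglyMeasurable[ℱ t] Y → MemLp Y 2 μ →
      ∫ ω, inner ℝ (M T ω - M t ω) (Y ω) ∂μ = 0)
    (hc : ∀ᵐ ω ∂μ, Continuous fun t => M t ω) {η : ℝ} (hη : 0 < η) :
    μ {ω | ∃ t ≤ T, η < ‖M t ω‖} ≤ ENNReal.ofReal ((∫ ω, ‖M T ω‖ ^ 2 ∂μ) / η ^ 2) := by
  set q := TopologicalSpace.denseSeq ℝ≥0 with hq
  set F : ℕ → Finset ℝ≥0 := fun j => (Finset.range j).image fun k => min (q k) T with hF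
  have hFm : Monotone fun j => {ω | ∃ t ∈ F j, η < ‖M t ω‖} := by
    rintro i j hij ω ⟨t, ht, h⟩
    exact ⟨t, Finset.image_subset_image (Finset.range_mono hij) ht, h⟩
  -- By continuity of the paths it suffices to look at a countable dense set of times.
  have hle : {ω | ∃ t ≤ T, η < ‖M t ω‖} ≤ᵐ[μ] ⋃ j, {ω | ∃ t ∈ F j, η < ‖M t ω‖} := by
    filter_upwards [hc] with ω hω
    rintro ⟨t, ht, h⟩
    have ho : IsOpen {s : ℝ≥0 | η < ‖M (min s T) ω‖} :=
      isOpen_lt continuous_const (hω.comp (continuous_id.min continuous_const)).norm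
    obtain ⟨s, hs, k, rfl⟩ := (TopologicalSpace.denseRange_denseSeq ℝ≥0).inter_open_nonempty _ ho
      ⟨t, by simpa [min_eq_left ht] using h⟩
    refine mem_iUnion.2 ⟨k + 1, min (q k) T, ?_, hs⟩
    exact Finset.mem_image.2 ⟨k, by simp, rfl⟩
  refine (measure_mono_ae hle).trans ?_
  rw [hFm.measure_iUnion]
  refine iSup_le fun j => measure_exists_mem_finset_lt_le hM hM2 hmart (F j) (fun t ht => ?_) hη
  obtain ⟨k, -, rfl⟩ := Finset.mem_image.1 ht
  exact min_le_right _ _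

end Maximal

/-! ### The Picard step for simple integrands -/

section PicardStep

variable {Ω : Type*} {m : MeasurableSpace Ω} {μ : Measure Ω} [IsProbabilityMeasure μ]
  {ℱ : Filtration ℝ≥0 m} {W : ℝ≥0 → Ω → ℝ}
  {E : Type*} [NormedAddCommGroup E] [InnerProductSpace ℝ E] [CompleteSpace E]

theorem IsFilteredBrownian.congr {W' : ℝ≥0 → Ω → ℝ} (hW : IsFilteredBrownian μ ℱ W)
    (hW' : StronglyAdapted ℱ W') (h : ∀ᵐ ω ∂μ, ∀ t, W' t ω = W t ω) :
    IsFilteredBrownian μ ℱ W' where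
  brownian :=
    { toIsPreBrownianReal := hW.brownian.toIsPreBrownianReal.congr fun t => by
        filter_upwards [h] with ω hω using (hω t).symm
      cont := by
        filter_upwards [h, hW.brownian.cont] with ω hω hc
        simpa only [hω] using hc }
  adapted := hW'
  indep_increment s t hst := by
    rw [Indep_iff]
    rintro _ F ⟨S, hS, rfl⟩ hF
    have e : (fun ω => W' t ω - W' s ω) ⁻¹' S =ᵐ[μ] (fun ω => W t ω - W s ω) ⁻¹' S := by
      filter_upwards [h] with ω hω
      refine propext ?_
      change W' t ω - W' s ω ∈ S ↔ W t ω - W s ω ∈ S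
      rw [hω, hω]
    rw [measure_congr (e.inter (ae_eq_refl F)), measure_congr e]
    exact (Indep_iff _ _ _).1 (hW.indep_increment s t hst) _ _ ⟨S, hS, rfl⟩ hF

namespace SimpleProcess

theorem intervalIntegrable_eval (ψ : SimpleProcess ℱ E) (ω : Ω) (t : ℝ≥0) :
    IntervalIntegrable (fun s : ℝ => ψ.eval s.toNNReal ω) volume 0 t := by
  obtain ⟨c, hc⟩ := ψ.norm_eval_le
  refine (intervalIntegrable_const (c := c)).mono_fun
    (ψ.stronglyMeasurable_onPaths.comp_measurable measurable_prodMk_left).aestronglyMeasurable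
    (Eventually.of_forall fun s => ?_)
  exact (hc _ ω).trans (le_abs_self c)

/-- Integrating a simple process against the identity gives its time integral. -/
theorem integral_clock (ψ : SimpleProcess ℱ E) (t : ℝ≥0) (ω : Ω) :
    ψ.integral (fun t _ => (t : ℝ)) t ω = ∫ s in (0 : ℝ)..t, ψ.eval s.toNNReal ω := by
  have e : ∀ k, ∀ s : ℝ, (Ioc (ψ.time k) (ψ.time (k + 1))).indicator (fun _ => ψ.value k ω)
      s.toNNReal = ((Ioc (ψ.time k) (ψ.time (k + 1))).indicator (fun _ => (1 : ℝ)) s.toNNReal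
        * (Ioc (ψ.time k) (ψ.time (k + 1))).indicator (fun _ => (1 : ℝ)) s.toNNReal)
        • ψ.value k ω := by
    intro k s
    simp only [Set.indicator_apply]
    split_ifs <;> simp
  simp only [eval, e, integral]
  rw [intervalIntegral.integral_finsetSum]
  · refine Finset.sum_congr rfl fun k _ => ?_
    rw [intervalIntegral.integral_smul_const, intervalIntegral_indicator_mul_indicator, min_self,
      max_self, max_eq_right]
    have := min_le_min_right t (ψ.time_mono (Nat.le_succ k))
    simp only [Nat.succ_eq_add_one] at this
    exact sub_nonneg.2 (by exact_mod_cast this)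
  · intro k _
    have h := intervalIntegrable_indicator_mul_indicator t (ψ.time k) (ψ.time (k + 1))
      (ψ.time k) (ψ.time (k + 1))
    exact ⟨h.1.smul_const _, h.2.smul_const _⟩

theorem isStronglyProgressive_integral (ψ : SimpleProcess ℱ E) (hW : IsStronglyProgressive ℱ W) :
    IsStronglyProgressive ℱ (ψ.integral W) := by
  have hmin : ∀ b : ℝ≥0, IsStronglyProgressive ℱ (fun t ω => W (min b t) ω) := by
    intro b
    refine IsStronglyProgressive.comp (t := fun t _ => min b t) hW (fun i => ?_)
      fun t _ => min_le_right _ _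
    refine Measurable.stronglyMeasurable ?_
    exact measurable_const.min (measurable_subtype_coe.comp (@measurable_fst _ _ _ (ℱ i)))
  refine fun i => Finset.stronglyMeasurable_fun_sum _ fun k _ => ?_
  rcases lt_or_ge i (ψ.time k) with h | h
  · have e : (fun p : Iic i × Ω => (W (min (ψ.time (k + 1)) p.1) p.2 - W (min (ψ.time k) p.1) p.2)
        • ψ.value k p.2) = fun _ => 0 := by
      ext p
      have h1 : (p.1 : ℝ≥0) ≤ ψ.time k := (mem_Iic.1 p.1.2).trans h.le
      rw [min_eq_right h1, min_eq_right (h1.trans (ψ.time_mono (Nat.le_succ k)))]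
      simp
    rw [e]
    exact @stronglyMeasurable_const _ _ (_) _ _
  · refine ((hmin _ i).sub (hmin _ i)).smul ?_
    exact ((ψ.measurable_value k).mono (ℱ.mono h)).comp_measurable
      (@measurable_snd _ _ _ (ℱ i))

theorem continuous_integral (ψ : SimpleProcess ℱ E) {ω : Ω} (h : Continuous fun t => W t ω) :
    Continuous fun t => ψ.integral W t ω := by
  refine continuous_finsetSum _ fun k _ => ?_
  exact ((h.comp (continuous_const.min continuous_id)).sub
    (h.comp (continuous_const.min continuous_id))).smul continuous_const

@[simp]
theorem integral_zero (ψ : SimpleProcess ℱ E) (W : ℝ≥0 → Ω → ℝ) (ω : Ω) : ψ.integral W 0 ω = 0 := by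
  simp [integral]

theorem eval_zero (ψ : SimpleProcess ℱ E) (ω : Ω) : ψ.eval 0 ω = 0 := by
  simp [eval]

/-- The mean square distance of two simple processes at time `t`. -/
noncomputable def sqDist (μ : Measure Ω) (ψ ψ' : SimpleProcess ℱ E) (t : ℝ≥0) : ℝ :=
  ∫ ω, ‖ψ.eval t ω - ψ'.eval t ω‖ ^ 2 ∂μ

theorem sqDist_nonneg (ψ ψ' : SimpleProcess ℱ E) (t : ℝ≥0) : 0 ≤ sqDist μ ψ ψ' t :=
  integral_nonneg fun _ => by positivity

theorem lintegral_onPaths_sub (ψ ψ' : SimpleProcess ℱ E) (t : ℝ≥0) :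
    ∫⁻ p, ‖onPaths ψ.eval p - onPaths ψ'.eval p‖ₑ ^ 2 ∂(pathMeasure μ t)
      = ENNReal.ofReal (∫ s in (0 : ℝ)..t, sqDist μ ψ ψ' s.toNNReal) := by
  have h := (ψ.memLp_onPaths μ t).sub (ψ'.memLp_onPaths μ t)
  have h2 := lintegral_enorm_sq_eq_ofReal h
  simp only [Pi.sub_apply] at h2
  have hi : Integrable (fun p => ‖onPaths ψ.eval p - onPaths ψ'.eval p‖ ^ 2)
      (μ.prod (volume.restrict (Icc (0 : ℝ) t))) := (memLp_two_iff_integrable_sq_norm h.1).1 h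
  rw [h2, pathMeasure, integral_prod_symm _ hi,
    intervalIntegral.integral_of_le t.coe_nonneg, ← integral_Icc_eq_integral_Ioc]
  rfl

theorem sqDist_map_le (ψ ψ' : SimpleProcess ℱ E) (L : E →L[ℝ] E) (t : ℝ≥0) :
    sqDist μ (ψ.map L) (ψ'.map L) t ≤ ‖L‖ ^ 2 * sqDist μ ψ ψ' t := by
  rw [sqDist, sqDist, ← integral_const_mul]
  have h := fun φ φ' : SimpleProcess ℱ E => (memLp_two_iff_integrable_sq_norm
    ((φ.memLp_eval (μ := μ) t).sub (φ'.memLp_eval t)).1).1 ((φ.memLp_eval t).sub (φ'.memLp_eval t))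
  refine integral_mono (h _ _) ((h _ _).const_mul _) fun ω => ?_
  simp only [eval_map]
  rw [← map_sub, ← mul_pow]
  gcongr
  exact L.le_opNorm _

theorem intervalIntegrable_sqDist (ψ ψ' : SimpleProcess ℱ E) (t : ℝ≥0) :
    IntervalIntegrable (fun s : ℝ => sqDist μ ψ ψ' s.toNNReal) volume 0 t :=
  intervalIntegrable_integral_norm_sq_eval_sub ψ ψ' μ t

theorem intervalIntegral_sqDist_map_le (ψ ψ' : SimpleProcess ℱ E) (L : E →L[ℝ] E) (t : ℝ≥0) :
    ∫ s in (0 : ℝ)..t, sqDist μ (ψ.map L) (ψ'.map L) s.toNNReal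
      ≤ ‖L‖ ^ 2 * ∫ s in (0 : ℝ)..t, sqDist μ ψ ψ' s.toNNReal := by
  rw [← intervalIntegral.integral_const_mul]
  exact intervalIntegral.integral_mono_on t.coe_nonneg (intervalIntegrable_sqDist _ _ t)
    ((intervalIntegrable_sqDist _ _ t).const_mul _) fun s _ => sqDist_map_le ψ ψ' L _

/-- The Picard map `ψ ↦ x₀ + ∫₀ᵗ a ψ ds + ∫₀ᵗ c ψ dW`. -/
noncomputable def picardStep (a c : E →L[ℝ] E) (x₀ : E) (W : ℝ≥0 → Ω → ℝ) (ψ : SimpleProcess ℱ E)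
    (t : ℝ≥0) (ω : Ω) : E :=
  x₀ + (ψ.map a).integral (fun t _ => (t : ℝ)) t ω + (ψ.map c).integral W t ω

variable (a c : E →L[ℝ] E) (x₀ : E)

theorem isStronglyProgressive_picardStep (ψ : SimpleProcess ℱ E)
    (hW : IsStronglyProgressive ℱ W) : IsStronglyProgressive ℱ (ψ.picardStep a c x₀ W) := by
  refine IsStronglyProgressive.add (IsStronglyProgressive.add
    (isStronglyProgressive_const ℱ x₀) ((ψ.map a).isStronglyProgressive_integral fun i => ?_))
    ((ψ.map c).isStronglyProgressive_integral hW)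
  refine Measurable.stronglyMeasurable ?_
  exact measurable_coe_nnreal_real.comp (measurable_subtype_coe.comp (@measurable_fst _ _ _ (ℱ i)))

theorem continuous_picardStep (ψ : SimpleProcess ℱ E) {ω : Ω} (h : Continuous fun t => W t ω) :
    Continuous fun t => ψ.picardStep a c x₀ W t ω :=
  (continuous_const.add ((ψ.map a).continuous_integral NNReal.continuous_coe)).add
    ((ψ.map c).continuous_integral h)

/-- The pathwise bound for time integrals, uniform in `t ≤ T`. -/
theorem norm_integral_clock_sub_le (ψ ψ' : SimpleProcess ℱ E) {t T : ℝ≥0} (htT : t ≤ T) (ω : Ω) :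
    ‖ψ.integral (fun t _ => (t : ℝ)) t ω - ψ'.integral (fun t _ => (t : ℝ)) t ω‖
      ≤ ∫ s in Icc (0 : ℝ) T, ‖onPaths ψ.eval (ω, s) - onPaths ψ'.eval (ω, s)‖ := by
  rw [integral_clock, integral_clock, ← intervalIntegral.integral_sub
    (ψ.intervalIntegrable_eval ω t) (ψ'.intervalIntegrable_eval ω t)]
  refine (intervalIntegral.norm_integral_le_integral_norm t.coe_nonneg).trans ?_
  rw [integral_Icc_eq_integral_Ioc, ← intervalIntegral.integral_of_le T.coe_nonneg]
  exact intervalIntegral.integral_mono_interval le_rfl t.coe_nonneg (by exact_mod_cast htT)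
    (Eventually.of_forall fun _ => norm_nonneg _)
    ((ψ.intervalIntegrable_eval ω T).sub (ψ'.intervalIntegrable_eval ω T)).norm

theorem memLp_integral_norm_sub (ψ ψ' : SimpleProcess ℱ E) (T : ℝ≥0) :
    MemLp (fun ω => ∫ s in Icc (0 : ℝ) T, ‖onPaths ψ.eval (ω, s) - onPaths ψ'.eval (ω, s)‖) 2 μ :=
  memLp_integral_time (f := fun p => ‖onPaths ψ.eval p - onPaths ψ'.eval p‖)
    ((ψ.memLp_onPaths μ T).sub (ψ'.memLp_onPaths μ T)).norm

theorem lintegral_sq_integral_norm_sub_le (ψ ψ' : SimpleProcess ℱ E) (T : ℝ≥0) :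
    ∫⁻ ω, ‖∫ s in Icc (0 : ℝ) T, ‖onPaths ψ.eval (ω, s) - onPaths ψ'.eval (ω, s)‖‖ₑ ^ 2 ∂μ
      ≤ ENNReal.ofReal (T * ∫ s in (0 : ℝ)..T, sqDist μ ψ ψ' s.toNNReal) := by
  refine (lintegral_enorm_sq_integral_time_le
    (f := fun p => ‖onPaths ψ.eval p - onPaths ψ'.eval p‖)
    ((ψ.memLp_onPaths μ T).sub (ψ'.memLp_onPaths μ T)).norm.1).trans_eq ?_
  simp only [enorm_norm]
  rw [lintegral_onPaths_sub, ENNReal.ofReal_mul T.coe_nonneg, ENNReal.ofReal_coe_nnreal]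

theorem memLp_integral_clock (ψ : SimpleProcess ℱ E) (t : ℝ≥0) :
    MemLp (ψ.integral (fun t _ => (t : ℝ)) t) 2 μ :=
  memLp_finsetSum _ fun k _ => (ψ.memLp_value k).const_smul _

theorem memLp_picardStep (ψ : SimpleProcess ℱ E) (hW : IsFilteredBrownian μ ℱ W) (t : ℝ≥0) :
    MemLp (ψ.picardStep a c x₀ W t) 2 μ :=
  ((memLp_const x₀).add ((ψ.map a).memLp_integral_clock t)).add ((ψ.map c).memLp_integral hW t)

theorem integral_norm_sq_clock_sub_le (ψ ψ' : SimpleProcess ℱ E) (t : ℝ≥0) :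
    ∫ ω, ‖ψ.integral (fun t _ => (t : ℝ)) t ω - ψ'.integral (fun t _ => (t : ℝ)) t ω‖ ^ 2 ∂μ
      ≤ t * ∫ s in (0 : ℝ)..t, sqDist μ ψ ψ' s.toNNReal := by
  have hnn : 0 ≤ ∫ s in (0 : ℝ)..t, sqDist μ ψ ψ' s.toNNReal :=
    intervalIntegral.integral_nonneg t.coe_nonneg fun s _ => sqDist_nonneg _ _ _
  have h := lintegral_enorm_sq_eq_ofReal (μ := μ)
    ((ψ.memLp_integral_clock t).sub (ψ'.memLp_integral_clock t))
  simp only [Pi.sub_apply] at h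
  rw [← ENNReal.ofReal_le_ofReal_iff (by positivity), ← h]
  refine le_trans (lintegral_mono fun ω => ?_) (lintegral_sq_integral_norm_sub_le ψ ψ' t)
  gcongr
  rw [enorm_le_iff_norm_le]
  exact (norm_integral_clock_sub_le ψ ψ' le_rfl ω).trans (le_abs_self _)

/-- The mean square Lipschitz estimate for the Picard map. -/
theorem integral_norm_sq_picardStep_sub_le (ψ ψ' : SimpleProcess ℱ E)
    (hW : IsFilteredBrownian μ ℱ W) {t T : ℝ≥0} (htT : t ≤ T) :
    ∫ ω, ‖ψ.picardStep a c x₀ W t ω - ψ'.picardStep a c x₀ W t ω‖ ^ 2 ∂μ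
      ≤ 2 * (T * ‖a‖ ^ 2 + ‖c‖ ^ 2) * ∫ s in (0 : ℝ)..t, sqDist μ ψ ψ' s.toNNReal := by
  have hnn : 0 ≤ ∫ s in (0 : ℝ)..t, sqDist μ ψ ψ' s.toNNReal :=
    intervalIntegral.integral_nonneg t.coe_nonneg fun s _ => sqDist_nonneg _ _ _
  have hA := ((ψ.map a).memLp_integral_clock (μ := μ) t).sub ((ψ'.map a).memLp_integral_clock t)
  have hC := ((ψ.map c).memLp_integral hW t).sub ((ψ'.map c).memLp_integral hW t)
  have hAi : Integrable (fun ω => ‖(ψ.map a).integral (fun t _ => (t : ℝ)) t ω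
      - (ψ'.map a).integral (fun t _ => (t : ℝ)) t ω‖ ^ 2) μ := (memLp_two_iff_integrable_sq_norm hA.1).1 hA
  have hCi : Integrable (fun ω => ‖(ψ.map c).integral W t ω - (ψ'.map c).integral W t ω‖ ^ 2) μ :=
    (memLp_two_iff_integrable_sq_norm hC.1).1 hC
  have hJ := (ψ.memLp_picardStep a c x₀ hW t).sub (ψ'.memLp_picardStep a c x₀ hW t)
  have hJi := (memLp_two_iff_integrable_sq_norm hJ.1).1 hJ
  have h1 : ∫ ω, ‖ψ.picardStep a c x₀ W t ω - ψ'.picardStep a c x₀ W t ω‖ ^ 2 ∂μ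
      ≤ 2 * ∫ ω, ‖(ψ.map a).integral (fun t _ => (t : ℝ)) t ω
            - (ψ'.map a).integral (fun t _ => (t : ℝ)) t ω‖ ^ 2 ∂μ
        + 2 * ∫ ω, ‖(ψ.map c).integral W t ω - (ψ'.map c).integral W t ω‖ ^ 2 ∂μ := by
    rw [← integral_const_mul, ← integral_const_mul,
      ← integral_add (hAi.const_mul 2) (hCi.const_mul 2)]
    refine integral_mono hJi ((hAi.const_mul 2).add (hCi.const_mul 2)) fun ω => ?_
    have e : ψ.picardStep a c x₀ W t ω - ψ'.picardStep a c x₀ W t ω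
        = ((ψ.map a).integral (fun t _ => (t : ℝ)) t ω
            - (ψ'.map a).integral (fun t _ => (t : ℝ)) t ω)
          + ((ψ.map c).integral W t ω - (ψ'.map c).integral W t ω) := by
      simp only [picardStep]; abel
    rw [e]
    refine (pow_le_pow_left₀ (norm_nonneg _) (norm_add_le _ _) 2).trans ?_
    nlinarith [sq_nonneg (‖(ψ.map a).integral (fun t _ => (t : ℝ)) t ω
      - (ψ'.map a).integral (fun t _ => (t : ℝ)) t ω‖
      - ‖(ψ.map c).integral W t ω - (ψ'.map c).integral W t ω‖)]
  have h2 := integral_norm_sq_clock_sub_le (μ := μ) (ψ.map a) (ψ'.map a) t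
  have h3 := integral_norm_sq_integral_sub (ψ.map c) (ψ'.map c) hW t
  have h4 := intervalIntegral_sqDist_map_le (μ := μ) ψ ψ' a t
  have h5 := intervalIntegral_sqDist_map_le (μ := μ) ψ ψ' c t
  have htT' : (t : ℝ) ≤ T := by exact_mod_cast htT
  have h6 : (t : ℝ) * ∫ s in (0 : ℝ)..t, sqDist μ (ψ.map a) (ψ'.map a) s.toNNReal
      ≤ T * (‖a‖ ^ 2 * ∫ s in (0 : ℝ)..t, sqDist μ ψ ψ' s.toNNReal) :=
    (mul_le_mul_of_nonneg_left h4 t.coe_nonneg).trans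
      (mul_le_mul_of_nonneg_right htT' (by positivity))
  have h7 := h3.trans_le h5
  nlinarith

/-- The maximal inequality for the Picard map. -/
theorem measure_picardStep_sub_le (ψ ψ' : SimpleProcess ℱ E)
    (hW : IsFilteredBrownian μ ℱ W) (T : ℝ≥0) {η : ℝ} (hη : 0 < η) :
    μ {ω | ∃ t ≤ T, 2 * η < ‖ψ.picardStep a c x₀ W t ω - ψ'.picardStep a c x₀ W t ω‖}
      ≤ ENNReal.ofReal ((T * ‖a‖ ^ 2 + ‖c‖ ^ 2) / η ^ 2
          * ∫ s in (0 : ℝ)..T, sqDist μ ψ ψ' s.toNNReal) := by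
  set I := ∫ s in (0 : ℝ)..T, sqDist μ ψ ψ' s.toNNReal with hI
  have hnn : 0 ≤ I :=
    intervalIntegral.integral_nonneg T.coe_nonneg fun s _ => sqDist_nonneg _ _ _
  set H : Ω → ℝ := fun ω => ∫ s in Icc (0 : ℝ) T,
    ‖onPaths (ψ.map a).eval (ω, s) - onPaths (ψ'.map a).eval (ω, s)‖ with hH
  set M : ℝ≥0 → Ω → E := fun t ω => (ψ.map c).integral W t ω - (ψ'.map c).integral W t ω with hM
  -- Either the time integral or the stochastic integral has to exceed `η`.
  have hsub : {ω | ∃ t ≤ T, 2 * η < ‖ψ.picardStep a c x₀ W t ω - ψ'.picardStep a c x₀ W t ω‖}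
      ⊆ {ω | η ≤ ‖H ω‖} ∪ {ω | ∃ t ≤ T, η < ‖M t ω‖} := by
    rintro ω ⟨t, ht, h⟩
    by_contra hcon
    simp only [mem_union, mem_ofPred_eq, not_or, not_exists, not_and, not_le, not_lt] at hcon
    have h1 := (norm_integral_clock_sub_le (ψ.map a) (ψ'.map a) ht ω).trans (le_abs_self _)
    have h2 := hcon.2 t ht
    have e : ψ.picardStep a c x₀ W t ω - ψ'.picardStep a c x₀ W t ω
        = ((ψ.map a).integral (fun t _ => (t : ℝ)) t ω
            - (ψ'.map a).integral (fun t _ => (t : ℝ)) t ω) + M t ω := by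
      simp only [picardStep, hM]; abel
    rw [e] at h
    have h3 := norm_add_le ((ψ.map a).integral (fun t _ => (t : ℝ)) t ω
            - (ψ'.map a).integral (fun t _ => (t : ℝ)) t ω) (M t ω)
    have h4 : ‖(ψ.map a).integral (fun t _ => (t : ℝ)) t ω
            - (ψ'.map a).integral (fun t _ => (t : ℝ)) t ω‖ < η := h1.trans_lt hcon.1
    linarith
  have hHm : MemLp H 2 μ := memLp_integral_norm_sub _ _ T
  -- Markov inequality for the time integral.
  have hb1 : μ {ω | η ≤ ‖H ω‖} ≤ ENNReal.ofReal (T * ‖a‖ ^ 2 / η ^ 2 * I) := by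
    have h1 := lintegral_sq_integral_norm_sub_le (μ := μ) (ψ.map a) (ψ'.map a) T
    have h2 : {ω | η ≤ ‖H ω‖} ⊆ {ω | ENNReal.ofReal (η ^ 2) ≤ ‖H ω‖ₑ ^ 2} := by
      intro ω hω
      simp only [mem_ofPred_eq] at hω ⊢
      rw [ENNReal.ofReal_pow hη.le, ← ofReal_norm]
      gcongr
    have hη2 : ENNReal.ofReal (η ^ 2) ≠ 0 := by
      rw [Ne, ENNReal.ofReal_eq_zero, not_le]; positivity
    refine (measure_mono h2).trans ((meas_ge_le_lintegral_div (hHm.1.enorm.pow_const 2) hη2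
      ENNReal.ofReal_ne_top).trans ?_)
    refine (ENNReal.div_le_div_right h1 _).trans ?_
    rw [← ENNReal.ofReal_div_of_pos (by positivity)]
    refine ENNReal.ofReal_le_ofReal ?_
    have h3 := intervalIntegral_sqDist_map_le (μ := μ) ψ ψ' a T
    rw [div_mul_eq_mul_div]
    refine div_le_div_of_nonneg_right ?_ (by positivity)
    rw [mul_assoc]
    exact mul_le_mul_of_nonneg_left h3 T.coe_nonneg
  -- Maximal inequality for the stochastic integral.
  have hb2 : μ {ω | ∃ t ≤ T, η < ‖M t ω‖} ≤ ENNReal.ofReal (‖c‖ ^ 2 / η ^ 2 * I) := by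
    have hML : ∀ t, MemLp (M t) 2 μ := fun t =>
      ((ψ.map c).memLp_integral hW t).sub ((ψ'.map c).memLp_integral hW t)
    refine (measure_exists_le_lt_le (ℱ := ℱ) (fun t => ?_) hML (fun t ht Y hY hY2 => ?_) ?_
      hη).trans ?_
    · exact ((ψ.map c).stronglyMeasurable_integral hW.adapted t).sub
        ((ψ'.map c).stronglyMeasurable_integral hW.adapted t)
    · have h1 := fun φ : SimpleProcess ℱ E => integrable_inner_of_memLp
        (((φ.map c).memLp_integral hW T).sub ((φ.map c).memLp_integral hW t)) hY2
      have e : ∀ ω, inner ℝ (M T ω - M t ω) (Y ω)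
          = inner ℝ ((ψ.map c).integral W T ω - (ψ.map c).integral W t ω) (Y ω)
            - inner ℝ ((ψ'.map c).integral W T ω - (ψ'.map c).integral W t ω) (Y ω) := by
        intro ω
        rw [← inner_sub_left]
        congr 1
        simp only [hM]; abel
      simp_rw [e]
      refine (integral_sub (h1 ψ) (h1 ψ')).trans ?_
      rw [show (∫ ω, inner ℝ (((ψ.map c).integral W T - (ψ.map c).integral W t) ω) (Y ω) ∂μ) = 0
        from (ψ.map c).integral_inner_integral_sub hW ht hY hY2,
        show (∫ ω, inner ℝ (((ψ'.map c).integral W T - (ψ'.map c).integral W t) ω) (Y ω) ∂μ) = 0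
        from (ψ'.map c).integral_inner_integral_sub hW ht hY hY2, sub_zero]
    · filter_upwards [hW.brownian.cont] with ω hω
      exact ((ψ.map c).continuous_integral hω).sub ((ψ'.map c).continuous_integral hω)
    · refine ENNReal.ofReal_le_ofReal ?_
      have h3 := (integral_norm_sq_integral_sub (ψ.map c) (ψ'.map c) hW T).trans_le
        (intervalIntegral_sqDist_map_le (μ := μ) ψ ψ' c T)
      rw [div_mul_eq_mul_div]
      gcongr
  refine (measure_mono hsub).trans ((measure_union_le _ _).trans ((add_le_add hb1 hb2).trans_eq ?_))
  rw [← ENNReal.ofReal_add (by positivity) (by positivity)]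
  congr 1; ring

end SimpleProcess

end PicardStep

/-! ### Simple approximation of mean square continuous processes -/

section MeanSquare

variable {Ω : Type*} {m : MeasurableSpace Ω} {μ : Measure Ω} [IsProbabilityMeasure μ]
  {ℱ : Filtration ℝ≥0 m} {W : ℝ≥0 → Ω → ℝ}
  {E : Type*} [NormedAddCommGroup E] [InnerProductSpace ℝ E] [CompleteSpace E]

/-- Continuity of a process as a map from time to `L²(μ)`. -/
def MeanSquareContinuous (μ : Measure Ω) (X : ℝ≥0 → Ω → E) : Prop :=
  ∀ t, Tendsto (fun s => eLpNorm (X s - X t) 2 μ) (𝓝 t) (𝓝 0)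

namespace MeanSquareContinuous

theorem of_const (f : Ω → E) : MeanSquareContinuous μ (fun _ => f) := fun t => by
  simp

theorem comp {X : ℝ≥0 → Ω → E} (hX : MeanSquareContinuous μ X) {f : ℝ≥0 → ℝ≥0}
    (hf : Continuous f) : MeanSquareContinuous μ (fun t => X (f t)) := fun t =>
  (hX (f t)).comp (hf.tendsto t)

theorem add {X Y : ℝ≥0 → Ω → E} (hX : MeanSquareContinuous μ X) (hY : MeanSquareContinuous μ Y)
    (hXm : ∀ t, AEStronglyMeasurable (X t) μ) (hYm : ∀ t, AEStronglyMeasurable (Y t) μ) :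
    MeanSquareContinuous μ (fun t => X t + Y t) := fun t => by
  have h := (hX t).add (hY t)
  rw [add_zero] at h
  refine tendsto_of_tendsto_of_tendsto_of_le_of_le tendsto_const_nhds h (fun _ => zero_le)
    fun s => ?_
  have e : X s + Y s - (X t + Y t) = (X s - X t) + (Y s - Y t) := by abel
  simp only [e]
  exact eLpNorm_add_le ((hXm s).sub (hXm t)) ((hYm s).sub (hYm t)) (by norm_num)

theorem sub {X Y : ℝ≥0 → Ω → E} (hX : MeanSquareContinuous μ X) (hY : MeanSquareContinuous μ Y)
    (hXm : ∀ t, AEStronglyMeasurable (X t) μ) (hYm : ∀ t, AEStronglyMeasurable (Y t) μ) :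
    MeanSquareContinuous μ (fun t => X t - Y t) := by
  have h := hX.add (Y := fun t => - Y t) (fun t => ?_) hXm (fun t => (hYm t).neg)
  · simpa only [sub_eq_add_neg] using h
  · have h := hY t
    have e : ∀ s, eLpNorm (-Y s - -Y t) 2 μ = eLpNorm (Y s - Y t) 2 μ := fun s => by
      rw [← eLpNorm_neg]; congr 1; abel
    simpa only [e] using h

theorem finsetSum {ι : Type*} (s : Finset ι) {X : ι → ℝ≥0 → Ω → E}
    (hX : ∀ i ∈ s, MeanSquareContinuous μ (X i))
    (hXm : ∀ i ∈ s, ∀ t, AEStronglyMeasurable (X i t) μ) :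
    MeanSquareContinuous μ (fun t => ∑ i ∈ s, X i t) := by
  classical
  induction s using Finset.induction_on with
  | empty => simpa using of_const (μ := μ) (0 : Ω → E)
  | insert i s hi ih =>
    simp only [Finset.sum_insert hi]
    refine (hX i (Finset.mem_insert_self i s)).add
      (ih (fun j hj => hX j (Finset.mem_insert_of_mem hj))
        (fun j hj => hXm j (Finset.mem_insert_of_mem hj)))
      (hXm i (Finset.mem_insert_self i s)) (fun t => ?_)
    exact Finset.aestronglyMeasurable_sum s
      fun j hj => hXm j (Finset.mem_insert_of_mem hj) t

theorem smul_bdd {X : ℝ≥0 → Ω → ℝ} (hX : MeanSquareContinuous μ X) {v : Ω → E} {c : ℝ}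
    (hv : ∀ ω, ‖v ω‖ ≤ c) : MeanSquareContinuous μ (fun t ω => X t ω • v ω) := fun t => by
  have h := ENNReal.Tendsto.const_mul (a := ENNReal.ofReal c) (hX t) (Or.inr ENNReal.ofReal_ne_top)
  rw [mul_zero] at h
  refine tendsto_of_tendsto_of_tendsto_of_le_of_le tendsto_const_nhds h (fun _ => zero_le)
    fun s => ?_
  refine eLpNorm_le_mul_eLpNorm_of_ae_le_mul (Eventually.of_forall fun ω => ?_) 2
  simp only [Pi.sub_apply]
  rw [← sub_smul, norm_smul, mul_comm]
  exact mul_le_mul_of_nonneg_right (hv ω) (norm_nonneg _)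

end MeanSquareContinuous

theorem meanSquareContinuous_clock :
    MeanSquareContinuous μ (fun (t : ℝ≥0) (_ : Ω) => (t : ℝ)) := fun t => by
  have e : ∀ s : ℝ≥0, eLpNorm ((fun _ : Ω => (s : ℝ)) - fun _ => (t : ℝ)) 2 μ
      = ‖(s : ℝ) - t‖ₑ := fun s => by
    have : ((fun _ : Ω => (s : ℝ)) - fun _ => (t : ℝ)) = fun _ => (s : ℝ) - t := rfl
    rw [this, eLpNorm_const _ (by norm_num) (IsProbabilityMeasure.ne_zero μ)]
    simp
  simp only [e]
  have h : Continuous fun s : ℝ≥0 => ‖(s : ℝ) - t‖ₑ :=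
    (NNReal.continuous_coe.sub continuous_const).enorm
  simpa using h.tendsto t

theorem IsFilteredBrownian.meanSquareContinuous (hW : IsFilteredBrownian μ ℱ W) :
    MeanSquareContinuous μ W := fun t => by
  have hsq : ∀ s : ℝ≥0, ∫ ω, (W s ω - W t ω) ^ 2 ∂μ = |(s : ℝ) - t| := fun s => by
    rcases le_total t s with h | h
    · rw [hW.integral_increment_sq h, abs_of_nonneg (sub_nonneg.2 (by exact_mod_cast h))]
    · rw [abs_sub_comm, abs_of_nonneg (sub_nonneg.2 (by exact_mod_cast h)),
        ← hW.integral_increment_sq h]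
      congr 1; ext ω; ring
  refine (tendsto_lintegral_enorm_sq_iff (fun s => W s - W t)).1 ?_
  have e : ∀ s, ∫⁻ ω, ‖(W s - W t) ω‖ₑ ^ 2 ∂μ = ENNReal.ofReal |(s : ℝ) - t| := fun s => by
    refine (lintegral_enorm_sq_eq_ofReal (hW.memLp_increment t s)).trans ?_
    simp only [Real.norm_eq_abs, sq_abs, hsq]
  simp only [e]
  have h : Continuous fun s : ℝ≥0 => ENNReal.ofReal |(s : ℝ) - t| :=
    ENNReal.continuous_ofReal.comp (NNReal.continuous_coe.sub continuous_const).abs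
  simpa using h.tendsto t

namespace SimpleProcess

theorem meanSquareContinuous_integral (ψ : SimpleProcess ℱ E) {V : ℝ≥0 → Ω → ℝ}
    (hV : MeanSquareContinuous μ V) (hVm : ∀ t, AEStronglyMeasurable (V t) μ) :
    MeanSquareContinuous μ (ψ.integral V) := by
  obtain ⟨c, hc⟩ := ψ.bounded_value
  have h := MeanSquareContinuous.finsetSum (μ := μ) (Finset.range ψ.card)
    (X := fun k t ω => (V (min (ψ.time (k + 1)) t) ω - V (min (ψ.time k) t) ω) • ψ.value k ω)
    (fun k _ => ?_) (fun k _ t => ?_)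
  · intro t
    refine (h t).congr fun s => ?_
    congr 1
    ext ω
    simp [integral]
  · refine MeanSquareContinuous.smul_bdd (X := fun t ω => V (min (ψ.time (k + 1)) t) ω
      - V (min (ψ.time k) t) ω) ?_ (hc k)
    exact (hV.comp (continuous_const.min continuous_id)).sub
      (hV.comp (continuous_const.min continuous_id)) (fun _ => hVm _) (fun _ => hVm _)
  · exact ((hVm _).sub (hVm _)).smul (ψ.stronglyMeasurable_value k).aestronglyMeasurable

theorem meanSquareContinuous_picardStep (a c : E →L[ℝ] E) (x₀ : E) (ψ : SimpleProcess ℱ E)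
    (hW : IsFilteredBrownian μ ℱ W) : MeanSquareContinuous μ (ψ.picardStep a c x₀ W) := by
  have h1 := (ψ.map a).meanSquareContinuous_integral (μ := μ) meanSquareContinuous_clock
    (fun _ => aestronglyMeasurable_const)
  have h2 := (ψ.map c).meanSquareContinuous_integral hW.meanSquareContinuous
    (fun t => ((hW.adapted t).mono (ℱ.le t)).aestronglyMeasurable)
  have m1 := fun t => ((ψ.map a).memLp_integral_clock (μ := μ) t).1
  exact ((MeanSquareContinuous.of_const fun _ => x₀).add h1
    (fun _ => aestronglyMeasurable_const) m1).add h2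
    (fun t => aestronglyMeasurable_const.add (m1 t)) (fun t => ((ψ.map c).memLp_integral hW t).1)

theorem eval_eq_of_mem (ψ : SimpleProcess ℱ E) {k : ℕ} (hk : k < ψ.card) {t : ℝ≥0}
    (ht : t ∈ Ioc (ψ.time k) (ψ.time (k + 1))) (ω : Ω) : ψ.eval t ω = ψ.value k ω := by
  rw [eval, Finset.sum_eq_single k]
  · simp [ht]
  · intro j _ hj
    rw [Set.indicator_of_notMem]
    rintro ⟨h1, h2⟩
    rcases lt_or_gt_of_ne hj with h | h
    · exact absurd (h2.trans (ψ.time_mono (Nat.succ_le_of_lt h))) (not_le.2 ht.1)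
    · exact absurd (ht.2.trans (ψ.time_mono (Nat.succ_le_of_lt h))) (not_le.2 h1)
  · intro h
    exact absurd (Finset.mem_range.2 hk) h

end SimpleProcess

/-- Sampling on a fine grid and truncating approximates an adapted, mean square continuous
process by simple processes, uniformly in mean square on bounded time intervals. -/
theorem MeanSquareContinuous.exists_simple_approximation {X : ℝ≥0 → Ω → E}
    (hX : MeanSquareContinuous μ X) (hXa : StronglyAdapted ℱ X) (hX2 : ∀ t, MemLp (X t) 2 μ)
    (T : ℝ≥0) {ε : ℝ} (hε : 0 < ε) :
    ∃ ψ : SimpleProcess ℱ E, ∀ t, 0 < t → t ≤ T →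
      eLpNorm (ψ.eval t - X t) 2 μ ≤ ENNReal.ofReal ε := by
  set f : ℝ≥0 → Lp E 2 μ := fun t => (hX2 t).toLp (X t) with hf
  have hfe : ∀ s t, edist (f s) (f t) = eLpNorm (X s - X t) 2 μ := fun s t =>
    Lp.edist_toLp_toLp _ _ _ _
  have hfc : Continuous f := continuous_iff_continuousAt.2 fun t => by
    rw [ContinuousAt, tendsto_iff_edist_tendsto_0]
    simpa only [hfe] using hX t
  have hu := isCompact_Icc.uniformContinuousOn_of_continuous (s := Icc 0 T) hfc.continuousOn
  -- The grid width `h < δ` costs `ε / 2` by uniform continuity, the truncation another `ε / 2`.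
  obtain ⟨δ, hδ, hδf⟩ := Metric.uniformContinuousOn_iff.1 hu (ε / 2) (by positivity)
  obtain ⟨N, hN⟩ := exists_nat_gt ((T : ℝ) / δ)
  set h : ℝ≥0 := T / (N + 1) with hh
  have hhδ : (h : ℝ) < δ := by
    rw [hh, NNReal.coe_div, div_lt_iff₀ (by positivity)]
    rw [div_lt_iff₀ hδ] at hN
    push_cast
    linarith
  have hX0 : ∀ k : ℕ, ∃ M : ℝ, eLpNorm ({ω | M ≤ ‖X (k * h) ω‖₊}.indicator (X (k * h))) 2 μ
      ≤ ENNReal.ofReal (ε / 2) := fun k =>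
    (hX2 (k * h)).eLpNorm_indicator_norm_ge_le ((hXa _).mono (ℱ.le _)) (by positivity)
  choose M hM using hX0
  have hset : ∀ k : ℕ, MeasurableSet[ℱ (k * h)] {ω | M k ≤ ‖X (k * h) ω‖₊} := fun k =>
    (hXa (k * h)).norm.measurable measurableSet_Ici
  have hval : ∀ k : ℕ, StronglyMeasurable[ℱ (k * h)]
      ({ω | M k ≤ ‖X (k * h) ω‖₊}ᶜ.indicator (X (k * h))) := fun k =>
    (hXa (k * h)).indicator (hset k).compl
  let ψ : SimpleProcess ℱ E :=
    { card := N + 1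
      time := fun k => k * h
      time_mono := fun i j hij => by
        have : (i : ℝ≥0) ≤ j := by exact_mod_cast hij
        exact mul_le_mul_left this h
      value := fun k ω => if k < N + 1 then
        {ω | M k ≤ ‖X (k * h) ω‖₊}ᶜ.indicator (X (k * h)) ω else 0
      measurable_value := fun k => by
        split_ifs
        · exact hval k
        · exact stronglyMeasurable_const
      bounded_value := by
        refine ⟨∑ k ∈ Finset.range (N + 1), |M k|, fun k ω => ?_⟩
        have h0 : 0 ≤ ∑ k ∈ Finset.range (N + 1), |M k| :=
          Finset.sum_nonneg fun _ _ => abs_nonneg _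
        split_ifs with hk
        · by_cases hω : M k ≤ ‖X (k * h) ω‖₊
          · rw [Set.indicator_of_notMem (by simpa using hω)]
            simpa using h0
          · rw [Set.indicator_of_mem (by simpa using hω)]
            have h1 : ‖X (k * h) ω‖ ≤ |M k| := (not_le.1 hω).le.trans (le_abs_self _)
            exact h1.trans (Finset.single_le_sum (f := fun k => |M k|)
              (fun _ _ => abs_nonneg _) (Finset.mem_range.2 hk))
        · simpa using h0 }
  refine ⟨ψ, fun t ht0 htT => ?_⟩
  have hT0 : 0 < T := ht0.trans_le htT
  have hh0 : 0 < h := by positivity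
  -- `(k h, (k + 1) h]` is the grid interval which contains `t`.
  obtain ⟨k, hk⟩ : ∃ k : ℕ, ⌈t / h⌉₊ = k + 1 :=
    Nat.exists_eq_succ_of_ne_zero (Nat.ceil_pos.2 (by positivity)).ne'
  have hk1 : (k : ℝ≥0) * h < t := by
    rw [← lt_div_iff₀ hh0]
    exact Nat.lt_ceil.1 (by omega)
  have hk2 : t ≤ ((k + 1 : ℕ) : ℝ≥0) * h := by
    rw [← div_le_iff₀ hh0, ← hk]
    exact Nat.le_ceil _
  have hkN : k < N + 1 := by
    have : (k : ℝ≥0) < (N + 1 : ℕ) := by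
      have h1 : (k : ℝ≥0) * h < (N + 1) * h := hk1.trans_le (htT.trans_eq (by
        rw [hh]; field_simp))
      push_cast
      exact lt_of_mul_lt_mul_right h1 zero_le
    exact_mod_cast this
  have e : ψ.eval t = {ω | M k ≤ ‖X (k * h) ω‖₊}ᶜ.indicator (X (k * h)) := by
    ext ω
    rw [ψ.eval_eq_of_mem hkN ⟨hk1, hk2⟩]
    exact if_pos hkN
  have e2 : ψ.eval t - X t = (X (k * h) - X t)
      - {ω | M k ≤ ‖X (k * h) ω‖₊}.indicator (X (k * h)) := by
    rw [e, Set.indicator_compl]; abel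
  have hm : ∀ s, StronglyMeasurable (X s) := fun s => (hXa s).mono (ℱ.le s)
  have hd : dist (k * h) t < δ := by
    rw [dist_comm, NNReal.dist_eq, abs_of_nonneg (sub_nonneg.2 (by exact_mod_cast hk1.le))]
    have : (t : ℝ) ≤ (k + 1) * h := by exact_mod_cast hk2
    push_cast
    linarith
  have h1 : eLpNorm (X (k * h) - X t) 2 μ ≤ ENNReal.ofReal (ε / 2) := by
    rw [← hfe, edist_dist]
    exact ENNReal.ofReal_le_ofReal
      (hδf _ ⟨zero_le, hk1.le.trans htT⟩ _ ⟨zero_le, htT⟩ hd).le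
  rw [e2]
  refine (eLpNorm_sub_le ((hm _).sub (hm _)).aestronglyMeasurable
    (AEStronglyMeasurable.indicator (hm _).aestronglyMeasurable ?_) (by norm_num)).trans ?_
  · exact ℱ.le _ _ (hset k)
  · refine (add_le_add h1 (hM k)).trans_eq ?_
    rw [← ENNReal.ofReal_add (by positivity) (by positivity), add_halves]

end MeanSquare

/-! ### Existence of solutions of linear stochastic equations -/

section Analysis

theorem integral_norm_sq_le_of_eLpNorm_le {α E : Type*} {mα : MeasurableSpace α} {μ : Measure α}
    [NormedAddCommGroup E] {f : α → E} (hf : MemLp f 2 μ) {r : ℝ} (hr : 0 ≤ r)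
    (h : eLpNorm f 2 μ ≤ ENNReal.ofReal r) : ∫ x, ‖f x‖ ^ 2 ∂μ ≤ r ^ 2 := by
  rw [← ENNReal.ofReal_le_ofReal_iff (by positivity), ← lintegral_enorm_sq_eq_ofReal hf,
    lintegral_enorm_sq_eq_eLpNorm_sq, ENNReal.ofReal_pow hr]
  gcongr

theorem eLpNorm_le_of_integral_norm_sq_le {α E : Type*} {mα : MeasurableSpace α} {μ : Measure α}
    [NormedAddCommGroup E] {f : α → E} (hf : MemLp f 2 μ) {r : ℝ} (hr : 0 ≤ r)
    (h : ∫ x, ‖f x‖ ^ 2 ∂μ ≤ r ^ 2) : eLpNorm f 2 μ ≤ ENNReal.ofReal r := by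
  rw [← ENNReal.ofReal_le_ofReal_iff (by positivity), ← lintegral_enorm_sq_eq_ofReal hf,
    lintegral_enorm_sq_eq_eLpNorm_sq, ENNReal.ofReal_pow hr] at h
  exact (ENNReal.pow_le_pow_left_iff two_ne_zero).1 h

/-- The Gronwall-type recursion behind the Picard iteration: the weight `e^{l t}` with large `l`
makes the integral term contractive, and the errors `6 / 64 ^ k` are absorbed in the slower rate
`16 ^ {-k}`. -/
theorem exists_le_div_pow_of_le_integral {d : ℕ → ℝ → ℝ} {κ T B : ℝ} (hκ : 0 ≤ κ)
    (k₀ : ℕ) (hd : ∀ k, ∀ t ∈ Icc 0 T, IntervalIntegrable (d k) volume 0 t)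
    (hB : ∀ t ∈ Icc 0 T, d k₀ t ≤ B)
    (h : ∀ k ≥ k₀, ∀ t ∈ Icc 0 T, d (k + 1) t ≤ 6 / 64 ^ k + κ * ∫ s in 0..t, d k s) :
    ∃ K, 0 ≤ K ∧ ∀ k ≥ k₀, ∀ t ∈ Icc 0 T, d k t ≤ K / 16 ^ k := by
  set l : ℝ := 32 * κ + 1 with hl
  have hl0 : 0 < l := by positivity
  set K : ℝ := 192 + |B| * 16 ^ k₀ with hK
  have hK0 : 0 ≤ K := by positivity
  have key : ∀ k ≥ k₀, ∀ t ∈ Icc 0 T, d k t ≤ K / 16 ^ k * Real.exp (l * t) := by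
    intro k hk
    induction k, hk using Nat.le_induction with
    | base =>
      intro t ht
      have h1 : 1 ≤ Real.exp (l * t) := Real.one_le_exp (mul_nonneg hl0.le ht.1)
      have h2 : B ≤ K / 16 ^ k₀ := by
        rw [le_div_iff₀ (by positivity), hK]
        nlinarith [le_abs_self B, pow_pos (show (0 : ℝ) < 16 by norm_num) k₀]
      exact ((hB t ht).trans h2).trans (le_mul_of_one_le_right (by positivity) h1)
    | succ k hk ih =>
      intro t ht
      have h1 : 1 ≤ Real.exp (l * t) := Real.one_le_exp (mul_nonneg hl0.le ht.1)
      have h2 : ∫ s in 0..t, d k s ≤ K / 16 ^ k * (Real.exp (l * t) / l) := by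
        have h3 : ∫ s in 0..t, d k s ≤ ∫ s in 0..t, K / 16 ^ k * Real.exp (l * s) :=
          intervalIntegral.integral_mono_on ht.1 (hd k t ht)
            (Continuous.intervalIntegrable (by fun_prop) _ _)
            fun s hs => ih s ⟨hs.1, hs.2.trans ht.2⟩
        refine h3.trans ?_
        rw [intervalIntegral.integral_const_mul]
        gcongr
        rw [intervalIntegral.integral_comp_mul_left _ hl0.ne', integral_exp, smul_eq_mul,
          ← div_eq_inv_mul]
        gcongr
        simp only [mul_zero, Real.exp_zero]
        linarith
      have h4 : κ * ∫ s in 0..t, d k s ≤ K / 16 ^ k * Real.exp (l * t) / 32 := by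
        refine (mul_le_mul_of_nonneg_left h2 hκ).trans ?_
        rw [show κ * (K / 16 ^ k * (Real.exp (l * t) / l))
          = (K / 16 ^ k * Real.exp (l * t)) * (κ / l) by ring, div_eq_mul_inv _ (32 : ℝ)]
        refine mul_le_mul_of_nonneg_left ?_ (by positivity)
        rw [div_le_iff₀ hl0, hl]
        linarith
      have h5 : (6 : ℝ) / 64 ^ k ≤ K / 16 ^ k * Real.exp (l * t) / 32 := by
        have h6 : (6 : ℝ) / 64 ^ k ≤ 6 / 16 ^ k := by gcongr; norm_num
        have h7 : (192 : ℝ) / 16 ^ k ≤ K / 16 ^ k * Real.exp (l * t) := by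
          refine le_trans ?_ (le_mul_of_one_le_right (by positivity) h1)
          gcongr
          rw [hK]
          linarith [show 0 ≤ |B| * 16 ^ k₀ by positivity]
        have h8 : (192 : ℝ) / 16 ^ k = 32 * (6 / 16 ^ k) := by ring
        linarith
      have h9 : K / 16 ^ (k + 1) * Real.exp (l * t) = K / 16 ^ k * Real.exp (l * t) / 16 := by
        rw [pow_succ]; field_simp
      rw [h9]
      linarith [h k hk t ht]
  refine ⟨K * Real.exp (l * T), by positivity, fun k hk t ht => (key k hk t ht).trans ?_⟩
  rw [div_mul_eq_mul_div]
  gcongr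
  exact ht.2

/-- Continuous functions with locally uniformly summable increments converge to a continuous
limit. -/
theorem continuous_limUnder_of_norm_sub_le {E : Type*} [NormedAddCommGroup E] [CompleteSpace E]
    {u : ℕ → ℝ≥0 → E} (hu : ∀ k, Continuous (u k))
    (h : ∀ T : ℕ, ∀ᶠ k in atTop, ∀ t ≤ (T : ℝ≥0), ‖u (k + 1) t - u k t‖ ≤ 2 * (1 / 3) ^ k) :
    (∀ t, Tendsto (fun k => u k t) atTop (𝓝 (limUnder atTop fun k => u k t))) ∧
      Continuous fun t => limUnder atTop fun k => u k t := by
  have key : ∀ T : ℕ, ∃ k₁, ∀ t ≤ (T : ℝ≥0), ∀ k,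
      dist (u (k + k₁) t) (u (k + 1 + k₁) t) ≤ 2 * (1 / 3) ^ k := fun T => by
    obtain ⟨k₁, hk₁⟩ := eventually_atTop.1 (h T)
    refine ⟨k₁, fun t ht k => ?_⟩
    rw [dist_comm, dist_eq_norm, add_right_comm]
    refine (hk₁ _ (Nat.le_add_left _ _) t ht).trans ?_
    gcongr ?_ * ?_
    exact pow_le_pow_of_le_one (by norm_num) (by norm_num) (Nat.le_add_right _ _)
  have hlim : ∀ t, Tendsto (fun k => u k t) atTop (𝓝 (limUnder atTop fun k => u k t)) := by
    intro t
    obtain ⟨k₁, hk₁⟩ := key ⌈t⌉₊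
    have h1 := cauchySeq_of_le_geometric (1 / 3) 2 (by norm_num)
      (f := fun k => u (k + k₁) t) (hk₁ t (Nat.le_ceil t))
    obtain ⟨y, hy⟩ := cauchySeq_tendsto_of_complete h1
    exact tendsto_nhds_limUnder ⟨y, (tendsto_add_atTop_iff_nat (f := fun k => u k t) k₁).1 hy⟩
  refine ⟨hlim, ?_⟩
  refine continuous_iff_continuousAt.2 fun t => ?_
  obtain ⟨T, hT⟩ := exists_nat_gt t
  obtain ⟨k₁, hk₁⟩ := key T
  have hU : TendstoUniformlyOn (fun k => u (k + k₁)) (fun t => limUnder atTop fun k => u k t)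
      atTop (Iic (T : ℝ≥0)) := by
    rw [Metric.tendstoUniformlyOn_iff]
    intro ε hε
    have h2 : Tendsto (fun k : ℕ => 2 * (1 / 3 : ℝ) ^ k / (1 - 1 / 3)) atTop (𝓝 0) := by
      have := ((tendsto_pow_atTop_nhds_zero_of_lt_one (r := (1 / 3 : ℝ)) (by norm_num)
        (by norm_num)).const_mul 2).div_const (1 - 1 / 3)
      simpa using this
    filter_upwards [h2.eventually (gt_mem_nhds hε)] with k hk s hs
    rw [dist_comm]
    exact (dist_le_of_le_geometric_of_tendsto (1 / 3) 2 (by norm_num) (hk₁ s hs)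
      ((tendsto_add_atTop_iff_nat (f := fun k => u k s) k₁).2 (hlim s)) k).trans_lt hk
  exact (hU.continuousOn (Frequently.of_forall fun k => (hu _).continuousOn)).continuousAt
    (Iic_mem_nhds hT)

end Analysis

section Existence

variable {Ω : Type*} {m : MeasurableSpace Ω} {μ : Measure Ω} [IsProbabilityMeasure μ]
  {ℱ : Filtration ℝ≥0 m} {W : ℝ≥0 → Ω → ℝ}
  {E : Type*} [NormedAddCommGroup E] [InnerProductSpace ℝ E] [CompleteSpace E]
  {a c : E →L[ℝ] E} {x₀ : E}

/-- A Picard iteration in which each iterate is replaced by a simple process close to it, so that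
only elementary stochastic integrals occur. The `k`-th replacement is good on `(0, k]`; simple
processes vanish at time `0`, which is therefore excluded. -/
def IsPicardSequence (μ : Measure Ω) (W : ℝ≥0 → Ω → ℝ) (a c : E →L[ℝ] E) (x₀ : E)
    (ψ : ℕ → SimpleProcess ℱ E) : Prop :=
  ∀ (k : ℕ) (t : ℝ≥0), 0 < t → t ≤ k →
    eLpNorm ((ψ (k + 1)).eval t - (ψ k).picardStep a c x₀ W t) 2 μ ≤ ENNReal.ofReal ((1 / 8) ^ k)

theorem exists_isPicardSequence (hW : IsFilteredBrownian μ ℱ W) (hWp : IsStronglyProgressive ℱ W)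
    (a c : E →L[ℝ] E) (x₀ : E) : ∃ ψ : ℕ → SimpleProcess ℱ E, IsPicardSequence μ W a c x₀ ψ := by
  have h : ∀ (k : ℕ) (ψ : SimpleProcess ℱ E), ∃ ψ' : SimpleProcess ℱ E, ∀ t : ℝ≥0, 0 < t → t ≤ k →
      eLpNorm (ψ'.eval t - ψ.picardStep a c x₀ W t) 2 μ ≤ ENNReal.ofReal ((1 / 8) ^ k) :=
    fun k ψ => (ψ.meanSquareContinuous_picardStep a c x₀ hW).exists_simple_approximation
      (ψ.isStronglyProgressive_picardStep a c x₀ hWp).stronglyAdapted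
      (fun t => ψ.memLp_picardStep a c x₀ hW t) k (by positivity)
  choose next hnext using h
  let ψ₀ : SimpleProcess ℱ E :=
    { card := 0
      time := fun _ => 0
      time_mono := monotone_const
      value := fun _ _ => 0
      measurable_value := fun _ => stronglyMeasurable_const
      bounded_value := ⟨0, fun _ _ => by simp⟩ }
  obtain ⟨ψ, hψ⟩ : ∃ ψ : ℕ → SimpleProcess ℱ E, ∀ k, ψ (k + 1) = next k (ψ k) :=
    ⟨fun k => Nat.rec ψ₀ next k, fun _ => rfl⟩
  refine ⟨ψ, fun k t h0 ht => ?_⟩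
  rw [hψ k]
  exact hnext k (ψ k) t h0 ht

namespace IsPicardSequence

variable {ψ : ℕ → SimpleProcess ℱ E}

theorem integral_norm_sq_le (hψ : IsPicardSequence μ W a c x₀ ψ) (hW : IsFilteredBrownian μ ℱ W)
    {k : ℕ} {t : ℝ≥0} (h0 : 0 < t) (ht : t ≤ k) :
    ∫ ω, ‖(ψ (k + 1)).eval t ω - (ψ k).picardStep a c x₀ W t ω‖ ^ 2 ∂μ ≤ 1 / 64 ^ k := by
  refine (integral_norm_sq_le_of_eLpNorm_le (((ψ (k + 1)).memLp_eval t).sub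
    ((ψ k).memLp_picardStep a c x₀ hW t)) (by positivity) (hψ k t h0 ht)).trans_eq ?_
  rw [← pow_mul, mul_comm, pow_mul, ← one_div_pow]
  norm_num

/-- The recursion for the mean square distances of consecutive iterates, in which
`6 / 64 ^ k` bounds the errors of the two replacements. -/
theorem sqDist_succ_le (hψ : IsPicardSequence μ W a c x₀ ψ) (hW : IsFilteredBrownian μ ℱ W)
    {k : ℕ} {t T : ℝ≥0} (htT : t ≤ T) (hT : T ≤ k) :
    (ψ (k + 2)).sqDist μ (ψ (k + 1)) t ≤ 6 / 64 ^ k + 3 * (2 * (T * ‖a‖ ^ 2 + ‖c‖ ^ 2))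
      * ∫ s in (0 : ℝ)..t, (ψ (k + 1)).sqDist μ (ψ k) s.toNNReal := by
  rcases eq_or_lt_of_le (zero_le (a := t)) with rfl | h0
  · simp only [SimpleProcess.sqDist, SimpleProcess.eval_zero, NNReal.coe_zero,
      intervalIntegral.integral_same, mul_zero, add_zero, sub_self, norm_zero]
    norm_num
    positivity
  have ht : t ≤ k := htT.trans hT
  have h1 := hψ.integral_norm_sq_le hW (k := k + 1) h0 (ht.trans (by simp))
  have h2 := hψ.integral_norm_sq_le hW (k := k) h0 ht
  have h3 := (ψ (k + 1)).integral_norm_sq_picardStep_sub_le (a := a) (c := c) (x₀ := x₀) (ψ k)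
    hW htT
  have i1 : Integrable (fun ω => ‖(ψ (k + 2)).eval t ω
      - (ψ (k + 1)).picardStep a c x₀ W t ω‖ ^ 2) μ :=
    (((ψ (k + 2)).memLp_eval t).sub ((ψ (k + 1)).memLp_picardStep a c x₀ hW t)).norm.integrable_sq
  have i2 : Integrable (fun ω => ‖(ψ (k + 1)).eval t ω - (ψ k).picardStep a c x₀ W t ω‖ ^ 2) μ :=
    (((ψ (k + 1)).memLp_eval t).sub ((ψ k).memLp_picardStep a c x₀ hW t)).norm.integrable_sq
  have i3 : Integrable (fun ω => ‖(ψ (k + 1)).picardStep a c x₀ W t ω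
      - (ψ k).picardStep a c x₀ W t ω‖ ^ 2) μ :=
    (((ψ (k + 1)).memLp_picardStep a c x₀ hW t).sub
      ((ψ k).memLp_picardStep a c x₀ hW t)).norm.integrable_sq
  have i12 : Integrable (fun ω => ‖(ψ (k + 2)).eval t ω - (ψ (k + 1)).picardStep a c x₀ W t ω‖ ^ 2
    + ‖(ψ (k + 1)).eval t ω - (ψ k).picardStep a c x₀ W t ω‖ ^ 2) μ := i1.add i2
  have i4 : Integrable (fun ω => ‖(ψ (k + 2)).eval t ω - (ψ (k + 1)).eval t ω‖ ^ 2) μ :=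
    (((ψ (k + 2)).memLp_eval t).sub ((ψ (k + 1)).memLp_eval t)).norm.integrable_sq
  have h4 : (ψ (k + 2)).sqDist μ (ψ (k + 1)) t ≤
      3 * (∫ ω, ‖(ψ (k + 2)).eval t ω - (ψ (k + 1)).picardStep a c x₀ W t ω‖ ^ 2 ∂μ
        + ∫ ω, ‖(ψ (k + 1)).eval t ω - (ψ k).picardStep a c x₀ W t ω‖ ^ 2 ∂μ
        + ∫ ω, ‖(ψ (k + 1)).picardStep a c x₀ W t ω
            - (ψ k).picardStep a c x₀ W t ω‖ ^ 2 ∂μ) := by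
    rw [← integral_add i1 i2, ← integral_add i12 i3, ← integral_const_mul]
    refine integral_mono i4 ((i12.add i3).const_mul 3) fun ω => ?_
    have e : (ψ (k + 2)).eval t ω - (ψ (k + 1)).eval t ω
        = ((ψ (k + 2)).eval t ω - (ψ (k + 1)).picardStep a c x₀ W t ω)
          + ((ψ (k + 1)).picardStep a c x₀ W t ω - (ψ k).picardStep a c x₀ W t ω)
          + -((ψ (k + 1)).eval t ω - (ψ k).picardStep a c x₀ W t ω) := by abel
    simp only
    rw [e]
    generalize (ψ (k + 2)).eval t ω - (ψ (k + 1)).picardStep a c x₀ W t ω = u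
    generalize (ψ (k + 1)).picardStep a c x₀ W t ω - (ψ k).picardStep a c x₀ W t ω = v
    generalize (ψ (k + 1)).eval t ω - (ψ k).picardStep a c x₀ W t ω = w
    have h5 := norm_add₃_le (a := u) (b := v) (c := -w)
    rw [norm_neg] at h5
    refine (pow_le_pow_left₀ (norm_nonneg _) h5 2).trans ?_
    -- `(u + v + w)² ≤ 3 (u² + v² + w²)`
    nlinarith [sq_nonneg (‖u‖ - ‖v‖), sq_nonneg (‖v‖ - ‖w‖), sq_nonneg (‖u‖ - ‖w‖)]
  have h6 : (1 : ℝ) / 64 ^ (k + 1) ≤ 1 / 64 ^ k := by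
    gcongr
    · norm_num
    · omega
  have h7 : (6 : ℝ) / 64 ^ k = 6 * (1 / 64 ^ k) := by ring
  rw [h7]
  linarith

/-- Consecutive iterates approach each other geometrically in mean square. -/
theorem exists_sqDist_le (hψ : IsPicardSequence μ W a c x₀ ψ) (hW : IsFilteredBrownian μ ℱ W)
    (T : ℝ≥0) : ∃ K : ℝ, 0 ≤ K ∧ ∀ k ≥ ⌈T⌉₊,
      ∫ s in (0 : ℝ)..T, (ψ (k + 1)).sqDist μ (ψ k) s.toNNReal ≤ K / 16 ^ k := by
  obtain ⟨b, hb⟩ := (ψ (⌈T⌉₊ + 1)).norm_eval_le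
  obtain ⟨b', hb'⟩ := (ψ ⌈T⌉₊).norm_eval_le
  have hd : ∀ k, ∀ t ∈ Icc (0 : ℝ) T, IntervalIntegrable
      (fun s : ℝ => (ψ (k + 1)).sqDist μ (ψ k) s.toNNReal) volume 0 t := fun k t ht =>
    SimpleProcess.intervalIntegrable_sqDist (μ := μ) (ψ (k + 1)) (ψ k) ⟨t, ht.1⟩
  have hB : ∀ t ∈ Icc (0 : ℝ) T, (ψ (⌈T⌉₊ + 1)).sqDist μ (ψ ⌈T⌉₊) t.toNNReal ≤ (b + b') ^ 2 := by
    intro t _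
    have h := integral_mono (μ := μ) (f := fun ω => ‖(ψ (⌈T⌉₊ + 1)).eval t.toNNReal ω
      - (ψ ⌈T⌉₊).eval t.toNNReal ω‖ ^ 2) (g := fun _ => (b + b') ^ 2)
      (((ψ (⌈T⌉₊ + 1)).memLp_eval _).sub ((ψ ⌈T⌉₊).memLp_eval _)).norm.integrable_sq
      (integrable_const _) fun ω => pow_le_pow_left₀ (norm_nonneg _)
        ((norm_sub_le _ _).trans (add_le_add (hb _ _) (hb' _ _))) 2
    simpa [SimpleProcess.sqDist] using h
  obtain ⟨K, hK0, hK⟩ := exists_le_div_pow_of_le_integral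
    (κ := 3 * (2 * (T * ‖a‖ ^ 2 + ‖c‖ ^ 2))) (by positivity) ⌈T⌉₊ hd hB fun k hk t ht => by
      have h := hψ.sqDist_succ_le hW (k := k) (t := t.toNNReal) (T := T)
        (Real.toNNReal_le_iff_le_coe.2 ht.2) ((Nat.le_ceil T).trans (by exact_mod_cast hk))
      rwa [Real.coe_toNNReal t ht.1] at h
  refine ⟨T * K, by positivity, fun k hk => ?_⟩
  have h := intervalIntegral.integral_mono_on T.coe_nonneg (hd k T ⟨T.coe_nonneg, le_rfl⟩)
    (intervalIntegrable_const (c := K / 16 ^ k)) (fun t ht => hK k hk t ht)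
  refine h.trans_eq ?_
  rw [intervalIntegral.integral_const, smul_eq_mul, sub_zero, mul_div_assoc]

/-- Almost surely the iterates converge locally uniformly: the mean square distances decay like
`16 ^ {-k}`, so by the maximal inequality the probability that consecutive iterates differ
somewhere by more than `2 / 3 ^ k` is of order `(9 / 16) ^ k`, and the Borel-Cantelli lemma applies. -/
theorem ae_eventually_norm_sub_le (hψ : IsPicardSequence μ W a c x₀ ψ)
    (hW : IsFilteredBrownian μ ℱ W) :
    ∀ᵐ ω ∂μ, ∀ T : ℕ, ∀ᶠ k in atTop, ∀ t ≤ (T : ℝ≥0),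
      ‖(ψ (k + 1)).picardStep a c x₀ W t ω - (ψ k).picardStep a c x₀ W t ω‖
        ≤ 2 * (1 / 3) ^ k := by
  refine ae_all_iff.2 fun T => ?_
  obtain ⟨K, hK0, hK⟩ := hψ.exists_sqDist_le hW T
  set κ : ℝ := (T : ℝ≥0) * ‖a‖ ^ 2 + ‖c‖ ^ 2 with hκ
  have hκ0 : 0 ≤ κ := by positivity
  set S : ℕ → Set Ω := fun k => {ω | ∃ t ≤ (T : ℝ≥0), 2 * (1 / 3 : ℝ) ^ (k + T)
    < ‖(ψ (k + T + 1)).picardStep a c x₀ W t ω - (ψ (k + T)).picardStep a c x₀ W t ω‖} with hS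
  have hb : ∀ k, μ (S k) ≤ ENNReal.ofReal (κ * K * (9 / 16) ^ (k + T)) := fun k => by
    refine ((ψ (k + T + 1)).measure_picardStep_sub_le a c x₀ (ψ (k + T)) hW T
      (η := (1 / 3) ^ (k + T)) (by positivity)).trans (ENNReal.ofReal_le_ofReal ?_)
    refine (mul_le_mul_of_nonneg_left (hK (k + T) (by simp)) (by positivity)).trans_eq ?_
    rw [← pow_mul, mul_comm (k + T) 2, pow_mul, div_mul_div_comm, div_pow, mul_div_assoc,
      ← hκ, div_pow 9 16, mul_assoc]
    congr 1
    rw [div_eq_mul_inv, mul_inv, ← inv_pow, div_eq_mul_inv (9 ^ (k + T) : ℝ)]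
    norm_num
  have hsum : ∑' k, μ (S k) ≠ ∞ := by
    refine ne_top_of_le_ne_top ?_ (ENNReal.tsum_le_tsum hb)
    refine Summable.tsum_ofReal_ne_top ?_
    exact (((summable_geometric_of_lt_one (by norm_num) (by norm_num : (9 / 16 : ℝ) < 1)).mul_left
      (κ * K)).comp_injective (add_left_injective T))
  filter_upwards [ae_eventually_notMem hsum] with ω hω
  obtain ⟨N, hN⟩ := eventually_atTop.1 hω
  refine eventually_atTop.2 ⟨N + T, fun k hk t ht => ?_⟩
  have h := hN (k - T) (by omega)
  simp only [hS, mem_ofPred_eq, Nat.sub_add_cancel (show T ≤ k by omega), not_exists, not_and,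
    not_lt] at h
  exact h t ht

/-- The pointwise limit of a Picard sequence, with a junk value where the sequence diverges. -/
noncomputable def limit (W : ℝ≥0 → Ω → ℝ) (a c : E →L[ℝ] E) (x₀ : E)
    (ψ : ℕ → SimpleProcess ℱ E) (t : ℝ≥0) (ω : Ω) : E :=
  limUnder atTop fun k => (ψ k).picardStep a c x₀ W t ω

theorem ae_tendsto_limit (hψ : IsPicardSequence μ W a c x₀ ψ) (hW : IsFilteredBrownian μ ℱ W) :
    ∀ᵐ ω ∂μ, (∀ t, Tendsto (fun k => (ψ k).picardStep a c x₀ W t ω) atTop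
      (𝓝 (limit W a c x₀ ψ t ω))) ∧ Continuous fun t => limit W a c x₀ ψ t ω := by
  filter_upwards [hψ.ae_eventually_norm_sub_le hW, hW.brownian.cont] with ω hω hc
  exact continuous_limUnder_of_norm_sub_le (fun k => (ψ k).continuous_picardStep a c x₀ hc) hω

/-- The iterates converge to the limit in mean square, with a geometric rate, by the triangle
inequality and Fatou. -/
theorem eLpNorm_limit_sub_le (hψ : IsPicardSequence μ W a c x₀ ψ)
    (hW : IsFilteredBrownian μ ℱ W) (T : ℝ≥0) : ∃ K : ℝ, 0 ≤ K ∧ ∀ k ≥ ⌈T⌉₊, ∀ t ≤ T,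
      eLpNorm (limit W a c x₀ ψ t - (ψ k).picardStep a c x₀ W t) 2 μ
        ≤ ENNReal.ofReal (K * (1 / 4) ^ k) := by
  obtain ⟨K, hK0, hK⟩ := hψ.exists_sqDist_le hW T
  set κ : ℝ := 2 * (T * ‖a‖ ^ 2 + ‖c‖ ^ 2) with hκ
  have hκ0 : 0 ≤ κ := by positivity
  have hL : ∀ k t, MemLp ((ψ k).picardStep a c x₀ W t) 2 μ := fun k t =>
    (ψ k).memLp_picardStep a c x₀ hW t
  set C := Real.sqrt (κ * K) with hC
  have hstep : ∀ k ≥ ⌈T⌉₊, ∀ t ≤ T,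
      eLpNorm ((ψ (k + 1)).picardStep a c x₀ W t - (ψ k).picardStep a c x₀ W t) 2 μ
        ≤ ENNReal.ofReal (C * (1 / 4) ^ k) := by
    intro k hk t ht
    refine eLpNorm_le_of_integral_norm_sq_le ((hL _ _).sub (hL _ _)) (by positivity) ?_
    refine ((ψ (k + 1)).integral_norm_sq_picardStep_sub_le a c x₀ (ψ k) hW ht).trans ?_
    have h1 : ∫ s in (0 : ℝ)..t, (ψ (k + 1)).sqDist μ (ψ k) s.toNNReal ≤ K / 16 ^ k :=
      (intervalIntegral.integral_mono_interval le_rfl t.coe_nonneg (by exact_mod_cast ht)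
        (Eventually.of_forall fun _ => SimpleProcess.sqDist_nonneg _ _ _)
        (SimpleProcess.intervalIntegrable_sqDist _ _ T)).trans (hK k hk)
    refine (mul_le_mul_of_nonneg_left h1 hκ0).trans_eq ?_
    rw [mul_pow, hC, Real.sq_sqrt (by positivity), ← pow_mul, mul_comm k 2, pow_mul, one_div_pow,
      one_div_pow]
    norm_num
    ring
  have hsum : ∀ k ≥ ⌈T⌉₊, ∀ t ≤ T, ∀ n : ℕ,
      eLpNorm ((ψ (k + n)).picardStep a c x₀ W t - (ψ k).picardStep a c x₀ W t) 2 μ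
        ≤ ENNReal.ofReal (2 * C * ((1 / 4) ^ k - (1 / 4) ^ (k + n))) := by
    intro k hk t ht n
    induction n with
    | zero => simp
    | succ n ih =>
      have e : (ψ (k + (n + 1))).picardStep a c x₀ W t - (ψ k).picardStep a c x₀ W t
          = ((ψ (k + n + 1)).picardStep a c x₀ W t - (ψ (k + n)).picardStep a c x₀ W t)
            + ((ψ (k + n)).picardStep a c x₀ W t - (ψ k).picardStep a c x₀ W t) := by
        rw [add_assoc k n 1]; abel
      have hp : (1 / 4 : ℝ) ^ (k + n) ≤ (1 / 4) ^ k :=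
        pow_le_pow_of_le_one (by norm_num) (by norm_num) (Nat.le_add_right _ _)
      rw [e]
      refine (eLpNorm_add_le ((hL _ _).sub (hL _ _)).1 ((hL _ _).sub (hL _ _)).1
        (by norm_num)).trans ((add_le_add (hstep (k + n) (by omega) t ht) ih).trans ?_)
      rw [← ENNReal.ofReal_add (by positivity)
        (mul_nonneg (by positivity) (sub_nonneg.2 hp))]
      refine ENNReal.ofReal_le_ofReal ?_
      rw [← add_assoc k n 1, pow_succ]
      have : 0 ≤ C * (1 / 4) ^ (k + n) := by positivity
      linarith
  refine ⟨2 * C, by positivity, fun k hk t ht => ?_⟩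
  refine (Lp.eLpNorm_lim_le_liminf_eLpNorm
    (f := fun n => (ψ (k + n)).picardStep a c x₀ W t - (ψ k).picardStep a c x₀ W t)
    (fun n => ((hL _ _).sub (hL _ _)).1) _ ?_).trans ?_
  · filter_upwards [hψ.ae_tendsto_limit hW] with ω hω
    exact (((tendsto_add_atTop_iff_nat (f := fun k => (ψ k).picardStep a c x₀ W t ω) k).2
      (hω.1 t)).congr fun n => by rw [add_comm]).sub tendsto_const_nhds
  · refine liminf_le_of_le (by isBoundedDefault) fun b hb => ?_
    obtain ⟨n, hn⟩ := hb.exists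
    refine hn.trans ((hsum k hk t ht n).trans (ENNReal.ofReal_le_ofReal ?_))
    gcongr
    linarith [show (0 : ℝ) ≤ (1 / 4) ^ (k + n) by positivity]

theorem isStronglyProgressive_limit (hWp : IsStronglyProgressive ℱ W) :
    IsStronglyProgressive ℱ (limit W a c x₀ ψ) :=
  isStronglyProgressive_limUnder fun k => (ψ k).isStronglyProgressive_picardStep a c x₀ hWp

/-- The simple processes converge to the limit in `L²` of the product measure. -/
theorem tendsto_eLpNorm_onPaths (hψ : IsPicardSequence μ W a c x₀ ψ)
    (hW : IsFilteredBrownian μ ℱ W) (hWp : IsStronglyProgressive ℱ W) (T : ℝ≥0) :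
    Tendsto (fun k => eLpNorm (onPaths (ψ k).eval - onPaths (limit W a c x₀ ψ)) 2
      (pathMeasure μ T)) atTop (𝓝 0) := by
  obtain ⟨K, hK0, hK⟩ := hψ.eLpNorm_limit_sub_le hW T
  have hm := aestronglyMeasurable_onPaths (μ := μ)
    (isStronglyProgressive_limit (a := a) (c := c) (x₀ := x₀) (ψ := ψ) hWp) T
  have hlm : ∀ t, AEStronglyMeasurable (limit W a c x₀ ψ t) μ := fun t =>
    (((isStronglyProgressive_limit hWp).stronglyAdapted t).mono (ℱ.le t)).aestronglyMeasurable
  have hpt : ∀ k ≥ ⌈T⌉₊, ∀ t, 0 < t → t ≤ T →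
      eLpNorm ((ψ (k + 1)).eval t - limit W a c x₀ ψ t) 2 μ
        ≤ ENNReal.ofReal ((1 + K) * (1 / 4) ^ k) := by
    intro k hk t h0 ht
    have hL := (ψ k).memLp_picardStep (μ := μ) a c x₀ hW t
    have e : (ψ (k + 1)).eval t - limit W a c x₀ ψ t
        = ((ψ (k + 1)).eval t - (ψ k).picardStep a c x₀ W t)
          - (limit W a c x₀ ψ t - (ψ k).picardStep a c x₀ W t) := by abel
    rw [e]
    refine (eLpNorm_sub_le (((ψ (k + 1)).memLp_eval t).sub hL).1 ((hlm t).sub hL.1)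
      (by norm_num)).trans ((add_le_add (hψ k t h0 (ht.trans ((Nat.le_ceil T).trans
        (by exact_mod_cast hk)))) (hK k hk t ht)).trans ?_)
    rw [← ENNReal.ofReal_add (by positivity) (by positivity)]
    refine ENNReal.ofReal_le_ofReal ?_
    have : (1 / 8 : ℝ) ^ k ≤ (1 / 4) ^ k := by gcongr; norm_num
    linarith
  rw [← tendsto_lintegral_enorm_sq_iff, ← tendsto_add_atTop_iff_nat 1]
  have hlim : Tendsto (fun k : ℕ => ENNReal.ofReal (((1 + K) * (1 / 4) ^ k) ^ 2) * (T : ℝ≥0∞)) atTop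
      (𝓝 0) := by
    have h1 : Tendsto (fun k : ℕ => ((1 + K) * (1 / 4) ^ k) ^ 2) atTop (𝓝 0) := by
      have := ((tendsto_pow_atTop_nhds_zero_of_lt_one (r := (1 / 4 : ℝ)) (by norm_num)
        (by norm_num)).const_mul (1 + K)).pow 2
      simpa using this
    have h2 := ENNReal.Tendsto.mul_const (ENNReal.tendsto_ofReal h1)
      (b := (T : ℝ≥0∞)) (Or.inr ENNReal.coe_ne_top)
    simpa using h2
  refine tendsto_of_tendsto_of_tendsto_of_le_of_le' tendsto_const_nhds hlim
    (Eventually.of_forall fun _ => zero_le) ?_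
  filter_upwards [eventually_ge_atTop ⌈T⌉₊] with k hk
  rw [pathMeasure, lintegral_prod_symm _
    ((((ψ (k + 1)).memLp_onPaths μ T).1.sub hm).enorm.pow_const 2)]
  rw [← restrict_Ioc_eq_restrict_Icc]
  refine (setLIntegral_mono' (g := fun _ => ENNReal.ofReal (((1 + K) * (1 / 4) ^ k) ^ 2))
    measurableSet_Ioc fun s hs => ?_).trans_eq ?_
  · have h := hpt k hk s.toNNReal (Real.toNNReal_pos.2 hs.1) (Real.toNNReal_le_iff_le_coe.2 hs.2)
    rw [ENNReal.ofReal_pow (by positivity)]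
    refine le_trans (le_of_eq ?_) (pow_le_pow_left' h 2)
    rw [← lintegral_enorm_sq_eq_eLpNorm_sq]
    rfl
  · simp

/-- The simple processes themselves witness the stochastic integral of the limit, since both
sides of the Picard recursion converge in mean square. -/
theorem isSDESolution_limit (hψ : IsPicardSequence μ W a c x₀ ψ)
    (hW : IsFilteredBrownian μ ℱ W) (hWp : IsStronglyProgressive ℱ W) :
    IsSDESolution μ ℱ W a c x₀ (limit W a c x₀ ψ) := by
  set x := limit W a c x₀ ψ with hx
  have hp : IsStronglyProgressive ℱ x := isStronglyProgressive_limit hWp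
  have hm := fun T => aestronglyMeasurable_onPaths (μ := μ) hp T
  have ht := hψ.tendsto_eLpNorm_onPaths hW hWp
  have hmem : ∀ T, MemLp (onPaths x) 2 (pathMeasure μ T) := fun T =>
    memLp_of_tendsto_eLpNorm (fun k => (ψ k).memLp_onPaths μ T) (hm T) (ht T)
  have hxm : ∀ t, AEStronglyMeasurable (x t) μ := fun t =>
    ((hp.stronglyAdapted t).mono (ℱ.le t)).aestronglyMeasurable
  have hdm : ∀ t : ℝ≥0, MemLp (fun ω => ∫ s in (0 : ℝ)..t, a (x s.toNNReal ω)) 2 μ := by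
    intro t
    simp_rw [intervalIntegral.integral_of_le t.coe_nonneg, ← integral_Icc_eq_integral_Ioc]
    exact memLp_integral_time (f := fun p => a (onPaths x p)) (a.comp_memLp' (hmem t))
  refine ⟨hp, (hψ.ae_tendsto_limit hW).mono fun ω h => h.2, fun T => ?_, ?_, fun t => ?_⟩
  · have h := lintegral_enorm_sq_eq_eLpNorm_sq (onPaths x) (pathMeasure μ T)
    rw [pathMeasure, lintegral_prod _ ((hm T).enorm.pow_const 2), ← pathMeasure] at h
    have h2 := (hmem T).2
    refine h.trans_lt ?_
    finiteness
  · refine Eventually.of_forall fun ω => ?_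
    -- All iterates start at `x₀`.
    have e : (fun k => (ψ k).picardStep a c x₀ W 0 ω) = fun _ => x₀ := by
      ext k
      simp [SimpleProcess.picardStep]
    rw [hx, limit, e]
    exact tendsto_const_nhds.limUnder_eq
  · have hlin : ∀ L : E →L[ℝ] E, Tendsto (fun k => eLpNorm
        (onPaths ((ψ k).map L).eval - onPaths fun s ω => L (x s ω)) 2 (pathMeasure μ t))
        atTop (𝓝 0) := fun L => by
      have h := ENNReal.Tendsto.const_mul (a := ENNReal.ofReal ‖L‖) (ht t)
        (Or.inr ENNReal.ofReal_ne_top)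
      rw [mul_zero] at h
      refine tendsto_of_tendsto_of_tendsto_of_le_of_le tendsto_const_nhds h (fun _ => zero_le)
        fun k => eLpNorm_le_mul_eLpNorm_of_ae_le_mul (Eventually.of_forall fun p => ?_) 2
      simp only [Pi.sub_apply, onPaths, SimpleProcess.eval_map, ← map_sub]
      exact L.le_opNorm _
    refine ⟨((hxm t).sub aestronglyMeasurable_const).sub (hdm t).1, fun k => (ψ k).map c, ?_, ?_⟩
    · exact (tendsto_onPaths_iff (φ := fun s ω => c (x s ω)) (fun k => (ψ k).map c)
        (c.continuous.comp_aestronglyMeasurable (hm t))).2 (hlin c)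
    · rw [tendsto_lintegral_enorm_sq_iff (fun k ω => ((ψ k).map c).integral W t ω
        - (x t ω - x₀ - ∫ s in (0 : ℝ)..t, a (x s.toNNReal ω)))]
      obtain ⟨K, hK0, hK⟩ := hψ.eLpNorm_limit_sub_le hW t
      have h1 : Tendsto (fun k => eLpNorm (x t - (ψ k).picardStep a c x₀ W t) 2 μ) atTop (𝓝 0) := by
        have h2 : Tendsto (fun k : ℕ => ENNReal.ofReal (K * (1 / 4) ^ k)) atTop (𝓝 0) := by
          have := ENNReal.tendsto_ofReal ((tendsto_pow_atTop_nhds_zero_of_lt_one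
            (r := (1 / 4 : ℝ)) (by norm_num) (by norm_num)).const_mul K)
          simpa using this
        refine tendsto_of_tendsto_of_tendsto_of_le_of_le' tendsto_const_nhds h2
          (Eventually.of_forall fun _ => zero_le) ?_
        filter_upwards [eventually_ge_atTop ⌈t⌉₊] with k hk using hK k hk t le_rfl
      set D : ℕ → Ω → E := fun k ω => ∫ s in Icc (0 : ℝ) t,
        (onPaths ((ψ k).map a).eval - onPaths fun s ω => a (x s ω)) (ω, s) with hD
      have hsubm : ∀ k, MemLp (onPaths ((ψ k).map a).eval - onPaths fun s ω => a (x s ω)) 2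
          (pathMeasure μ t) := fun k =>
        (((ψ k).map a).memLp_onPaths μ t).sub (a.comp_memLp' (hmem t))
      have h2 : Tendsto (fun k => eLpNorm (D k) 2 μ) atTop (𝓝 0) := by
        rw [← tendsto_lintegral_enorm_sq_iff]
        have h3 := ENNReal.Tendsto.const_mul (a := (t : ℝ≥0∞))
          ((tendsto_lintegral_enorm_sq_iff _).2 (hlin a)) (Or.inr ENNReal.coe_ne_top)
        rw [mul_zero] at h3
        exact tendsto_of_tendsto_of_tendsto_of_le_of_le tendsto_const_nhds h3 (fun _ => zero_le)
          fun k => lintegral_enorm_sq_integral_time_le (hsubm k).1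
      have h3 := h1.add h2
      rw [add_zero] at h3
      refine tendsto_of_tendsto_of_tendsto_of_le_of_le tendsto_const_nhds h3 (fun _ => zero_le)
        fun k => ?_
      have hDm : AEStronglyMeasurable (D k) μ := (memLp_integral_time (hsubm k)).1
      have hPm := ((ψ k).memLp_picardStep (μ := μ) a c x₀ hW t).1
      refine le_trans (le_of_eq ?_) (eLpNorm_add_le ((hxm t).sub hPm) hDm (by norm_num))
      rw [← eLpNorm_neg]
      refine eLpNorm_congr_ae ?_
      filter_upwards [hψ.ae_tendsto_limit hW] with ω hω
      have hxc : Continuous fun s : ℝ => a (x s.toNNReal ω) :=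
        a.continuous.comp (hω.2.comp continuous_real_toNNReal)
      have e1 : D k ω = (∫ s in (0 : ℝ)..t, ((ψ k).map a).eval s.toNNReal ω)
          - ∫ s in (0 : ℝ)..t, a (x s.toNNReal ω) := by
        rw [← intervalIntegral.integral_sub (((ψ k).map a).intervalIntegrable_eval ω t)
          (hxc.intervalIntegrable _ _), intervalIntegral.integral_of_le t.coe_nonneg,
          ← integral_Icc_eq_integral_Ioc]
        rfl
      simp only [Pi.neg_apply, Pi.add_apply, Pi.sub_apply, e1, SimpleProcess.picardStep,
        SimpleProcess.integral_clock]
      abel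

end IsPicardSequence

/-- Linear stochastic differential equations have solutions. The iteration runs with a progressive
modification of `W`; elementary integrals with respect to the two processes agree almost surely. -/
theorem exists_isSDESolution (hW : IsFilteredBrownian μ ℱ W) (a c : E →L[ℝ] E) (x₀ : E) :
    ∃ x, IsSDESolution μ ℱ W a c x₀ x := by
  obtain ⟨W', hp, he⟩ := exists_isStronglyProgressive_modification hW.adapted hW.brownian.cont
  have hW' := hW.congr hp.stronglyAdapted he
  obtain ⟨ψ, hψ⟩ := exists_isPicardSequence hW' hp a c x₀
  have h := hψ.isSDESolution_limit hW' hp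
  refine ⟨_, h.progressive, h.continuous_paths, h.sq_integrable, h.initial, fun t => ?_⟩
  obtain ⟨hI, φ, h1, h2⟩ := h.equation t
  refine ⟨hI, φ, h1, h2.congr fun j => lintegral_congr_ae ?_⟩
  filter_upwards [he] with ω hω
  simp only [SimpleProcess.integral, hω]

end Existence

/-! ### Square integrable solutions of linear differential equations -/

section ExpFlow

variable {𝕜 V : Type*} [RCLike 𝕜] [NormedAddCommGroup V] [NormedSpace 𝕜 V] [CompleteSpace V]

/-- The solution at time `t` of `f' = L f`, `f(0) = v`. -/
noncomputable def expFlow (L : V →L[𝕜] V) (t : ℝ) (v : V) : V := NormedSpace.exp ((t : 𝕜) • L) v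

theorem hasSum_expFlow (L : V →L[𝕜] V) (t : ℝ) (v : V) :
    HasSum (fun j : ℕ => (((j.factorial : ℝ)⁻¹ * t ^ j : ℝ) : 𝕜) • (L ^ j) v) (expFlow L t v) := by
  have h := NormedSpace.exp_series_hasSum_exp' (𝕂 := 𝕜) ((t : 𝕜) • L)
  have h2 := h.mapL (ContinuousLinearMap.apply 𝕜 V v)
  refine h2.congr_fun fun j => ?_
  change _ = (j.factorial : 𝕜)⁻¹ • (((t : 𝕜) • L) ^ j) v
  rw [smul_pow]
  change _ = (j.factorial : 𝕜)⁻¹ • (t : 𝕜) ^ j • (L ^ j) v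
  rw [smul_smul]
  simp

theorem expFlow_zero (L : V →L[𝕜] V) (v : V) : expFlow L 0 v = v := by
  rw [expFlow, RCLike.ofReal_zero, zero_smul, NormedSpace.exp_zero]
  rfl

theorem continuous_expFlow (L : V →L[𝕜] V) (v : V) : Continuous fun t => expFlow L t v := by
  let := NormedAlgebra.restrictScalars ℚ 𝕜 (V →L[𝕜] V)
  have h : Continuous fun t : ℝ => (t : 𝕜) • L :=
    (RCLike.continuous_ofReal (K := 𝕜)).smul (continuous_const (y := L))
  exact (ContinuousLinearMap.apply 𝕜 V v).continuous.comp (NormedSpace.exp_continuous.comp h)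

/-- Splitting off a scalar from the generator. -/
theorem expFlow_eq_exp_smul [NormedSpace ℂ V] (L : V →L[ℂ] V) (z : ℂ) (t : ℝ) (v : V) :
    expFlow L t v = Complex.exp (t * z) • expFlow (L - z • 1) t v := by
  let := NormedAlgebra.restrictScalars ℚ ℂ (V →L[ℂ] V)
  have e : (t : ℂ) • L = algebraMap ℂ (V →L[ℂ] V) (t * z) + (t : ℂ) • (L - z • 1) := by
    rw [Algebra.algebraMap_eq_smul_one, smul_sub, smul_smul, add_sub_cancel]
  have e2 : NormedSpace.exp (algebraMap ℂ (V →L[ℂ] V) (t * z))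
      = algebraMap ℂ (V →L[ℂ] V) (Complex.exp (t * z)) := by
    rw [Complex.exp_eq_exp_ℂ, NormedSpace.algebraMap_exp_comm]
  change NormedSpace.exp ((t : ℂ) • L) v = _
  rw [e, NormedSpace.exp_add_of_commute (Algebra.commutes _ _), e2, mul_apply_eq_comp,
    Algebra.algebraMap_eq_smul_one]
  rfl

theorem hasDerivAt_expFlow [NormedSpace ℝ V] (L : V →L[ℝ] V) (v : V) (t : ℝ) :
    HasDerivAt (fun t => expFlow L t v) (L (expFlow L t v)) t := by
  have h := hasDerivAt_exp_smul_const' (𝕂 := ℝ) L t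
  have h2 := h.clm_apply (hasDerivAt_const t v)
  simpa [expFlow] using h2

end ExpFlow

namespace Matrix

section Flow

variable {ι κ : Type*} [Fintype ι] [DecidableEq ι] [Fintype κ] [DecidableEq κ]
  {𝕜 : Type*} [RCLike 𝕜]

/-- The solution at time `t` of `f' = N f`, `f(0) = v`. -/
noncomputable def flow (N : Matrix ι ι 𝕜) (t : ℝ) (v : ι → 𝕜) : ι → 𝕜 :=
  expFlow (LinearMap.toContinuousLinearMap (toLin' N)) t v

theorem toContinuousLinearMap_toLin'_pow_apply (N : Matrix ι ι 𝕜) (j : ℕ) (v : ι → 𝕜) :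
    ((LinearMap.toContinuousLinearMap (toLin' N)) ^ j) v = (N ^ j) *ᵥ v := by
  induction j generalizing v with
  | zero => simp
  | succ j ih =>
    rw [pow_succ, mul_apply_eq_comp, ih, pow_succ, ← mulVec_mulVec]
    simp

theorem hasSum_flow (N : Matrix ι ι 𝕜) (t : ℝ) (v : ι → 𝕜) :
    HasSum (fun j : ℕ => ((j.factorial : ℝ)⁻¹ * t ^ j : ℝ) • ((N ^ j) *ᵥ v)) (flow N t v) := by
  refine (hasSum_expFlow (LinearMap.toContinuousLinearMap (toLin' N)) t v).congr_fun fun j => ?_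
  rw [toContinuousLinearMap_toLin'_pow_apply]
  ext i
  simp [RCLike.real_smul_eq_coe_mul]

@[simp]
theorem flow_zero (N : Matrix ι ι 𝕜) (v : ι → 𝕜) : flow N 0 v = v := expFlow_zero _ _

theorem flow_add_right (N : Matrix ι ι 𝕜) (t : ℝ) (v w : ι → 𝕜) :
    flow N t (v + w) = flow N t v + flow N t w := map_add _ _ _

/-- Linear maps which intertwine the powers of two matrices intertwine the flows. -/
theorem map_flow {N : Matrix ι ι 𝕜} {N' : Matrix κ κ ℝ} {v : ι → 𝕜} {v' : κ → ℝ}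
    (L : (ι → 𝕜) →ₗ[ℝ] (κ → ℝ)) (h : ∀ j : ℕ, L ((N ^ j) *ᵥ v) = (N' ^ j) *ᵥ v') (t : ℝ) :
    L (flow N t v) = flow N' t v' := by
  have h1 := (hasSum_flow N t v).mapL (LinearMap.toContinuousLinearMap L)
  refine h1.unique ((hasSum_flow N' t v').congr_fun fun j => ?_)
  simp [h]

theorem continuous_flow (N : Matrix ι ι 𝕜) (v : ι → 𝕜) : Continuous fun t => flow N t v :=
  continuous_expFlow _ v

theorem hasDerivAt_flow (N : Matrix ι ι ℝ) (v : ι → ℝ) (t : ℝ) :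
    HasDerivAt (fun t => flow N t v) (N *ᵥ flow N t v) t :=
  hasDerivAt_expFlow _ v t

/-- Solutions of `f' = N f` on `[0, ∞)` are unique. -/
theorem eq_flow_of_hasDerivWithinAt {N : Matrix ι ι ℝ} {f : ℝ → ι → ℝ}
    (hf : ∀ t, 0 ≤ t → HasDerivWithinAt f (N *ᵥ f t) (Ici 0) t) {t : ℝ} (ht : 0 ≤ t) :
    f t = flow N t (f 0) := by
  set L := LinearMap.toContinuousLinearMap (toLin' N) with hL
  refine ODE_solution_unique (v := fun _ => L) (K := ‖L‖₊) (fun _ => L.lipschitz)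
    (a := 0) (b := t) (fun s hs => ?_) (fun s hs => ?_)
    (continuous_flow N (f 0)).continuousOn (fun s _ => ?_) (by simp) ⟨ht, le_rfl⟩
  · exact ((hf s hs.1).continuousWithinAt).mono fun x hx => hx.1
  · exact (hf s hs.1).mono (Ici_subset_Ici.2 hs.1)
  · exact (hasDerivAt_flow N _ s).hasDerivWithinAt

/-- Solutions starting in a generalised eigenspace are exponentials times polynomials. -/
theorem flow_eq_of_pow_mulVec_eq_zero {N : Matrix ι ι ℂ} {z : ℂ} {v : ι → ℂ} {k : ℕ}
    (h : ((N - z • 1) ^ k) *ᵥ v = 0) (t : ℝ) :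
    flow N t v = Complex.exp (t * z) • ∑ j ∈ Finset.range k,
      (((j.factorial : ℝ)⁻¹ * t ^ j : ℝ)) • (((N - z • 1) ^ j) *ᵥ v) := by
  have hsum : flow (N - z • 1) t v = ∑ j ∈ Finset.range k,
      (((j.factorial : ℝ)⁻¹ * t ^ j : ℝ)) • (((N - z • 1) ^ j) *ᵥ v) := by
    refine (hasSum_flow (N - z • 1) t v).unique (hasSum_sum_of_ne_finset_zero fun j hj => ?_)
    obtain ⟨i, rfl⟩ := Nat.exists_eq_add_of_le (not_lt.1 fun h => hj (Finset.mem_range.2 h))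
    rw [add_comm k i, pow_add (N - z • 1), ← mulVec_mulVec, h, mulVec_zero, smul_zero]
  rw [← hsum, flow, flow, expFlow_eq_exp_smul _ z]
  congr 2
  ext x i
  simp

theorem memLp_exp_mul_pow {z : ℂ} (hz : z.re < 0) (j : ℕ) :
    MemLp (fun t : ℝ => Complex.exp (t * z) * (t : ℂ) ^ j) 2 (volume.restrict (Ici 0)) := by
  have hc : Continuous fun t : ℝ => Complex.exp (t * z) * (t : ℂ) ^ j := by fun_prop
  rw [memLp_two_iff_integrable_sq_norm hc.aestronglyMeasurable]
  change IntegrableOn _ _ _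
  rw [integrableOn_Ici_iff_integrableOn_Ioi]
  refine integrable_of_isBigO_exp_neg (b := -z.re) (by linarith) (by fun_prop) ?_
  have e : (fun t : ℝ => ‖Complex.exp (t * z) * (t : ℂ) ^ j‖ ^ 2)
      = fun t : ℝ => Real.exp (2 * z.re * t) * t ^ (2 * j) := by
    ext t
    rw [norm_mul, Complex.norm_exp, norm_pow, Complex.norm_real, mul_pow, ← Real.exp_nat_mul,
      ← pow_mul, mul_comm j 2, pow_mul ‖t‖, Real.norm_eq_abs, sq_abs, ← pow_mul]
    congr 2
    simp
    ring
  rw [e]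
  have h := (isLittleO_pow_exp_pos_mul_atTop (2 * j) (b := -z.re) (by linarith)).isBigO
  refine ((Asymptotics.isBigO_refl (fun t : ℝ => Real.exp (2 * z.re * t)) atTop).mul h).congr_right
    fun t => ?_
  rw [← Real.exp_add]
  congr 1
  ring

theorem memLp_flow_of_pow_mulVec_eq_zero {N : Matrix ι ι ℂ} {z : ℂ} (hz : z.re < 0)
    {v : ι → ℂ} {k : ℕ} (h : ((N - z • 1) ^ k) *ᵥ v = 0) :
    MemLp (fun t => flow N t v) 2 (volume.restrict (Ici 0)) := by
  have e : (fun t => flow N t v) = fun t : ℝ => ∑ j ∈ Finset.range k,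
      (Complex.exp (t * z) * (t : ℂ) ^ j) • ((j.factorial : ℂ)⁻¹ • (((N - z • 1) ^ j) *ᵥ v)) := by
    ext t i
    rw [flow_eq_of_pow_mulVec_eq_zero h, Finset.smul_sum]
    simp only [Finset.sum_apply, Pi.smul_apply, Complex.real_smul, smul_eq_mul]
    refine Finset.sum_congr rfl fun j _ => ?_
    push_cast
    ring
  rw [e]
  refine memLp_finsetSum _ fun j _ => ?_
  exact ((ContinuousLinearMap.toSpanSingleton ℂ _).comp_memLp' (memLp_exp_mul_pow hz j))

/-- The initial values of the square integrable solutions of `f' = M f` on `[0, ∞)`. -/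
def stableSpace (M : Matrix ι ι ℝ) : Submodule ℝ (ι → ℝ) where
  carrier := {w | MemLp (fun t => flow M t w) 2 (volume.restrict (Ici 0))}
  zero_mem' := by
    have : (fun t => flow M t (0 : ι → ℝ)) = 0 := by ext t; simp [flow, expFlow]
    simp [this]
  add_mem' {v w} hv hw := by
    simp only [mem_ofPred_eq, flow_add_right] at hv hw ⊢
    exact hv.add hw
  smul_mem' c w hw := by
    have : (fun t => flow M t (c • w)) = c • fun t => flow M t w := by ext t; simp [flow, expFlow]
    simp only [mem_ofPred_eq, this] at hw ⊢
    exact hw.const_smul c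

/-- Linear maps which intertwine the powers map square integrable solutions to such solutions. -/
theorem mem_stableSpace_of_map {M : Matrix ι ι 𝕜} {M' : Matrix κ κ ℝ} {v : ι → 𝕜} {v' : κ → ℝ}
    (L : (ι → 𝕜) →ₗ[ℝ] (κ → ℝ)) (h : ∀ j : ℕ, L ((M ^ j) *ᵥ v) = (M' ^ j) *ᵥ v')
    (hv : MemLp (fun t => flow M t v) 2 (volume.restrict (Ici 0))) : v' ∈ stableSpace M' := by
  have := (LinearMap.toContinuousLinearMap L).comp_memLp' hv
  refine this.ae_eq (Eventually.of_forall fun t => ?_)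
  exact map_flow L h t

theorem mulVec_mem_stableSpace {M : Matrix ι ι ℝ} {w : ι → ℝ} (hw : w ∈ stableSpace M) :
    M *ᵥ w ∈ stableSpace M :=
  mem_stableSpace_of_map (toLin' M) (fun j => by
    rw [toLin'_apply, mulVec_mulVec, mulVec_mulVec, ← pow_succ, ← pow_succ']) hw

/-- The componentwise real part. -/
noncomputable def reVec : (ι → ℂ) →ₗ[ℝ] (ι → ℝ) :=
  LinearMap.pi fun i => Complex.reLm ∘ₗ LinearMap.proj i

theorem reVec_map_mulVec (M : Matrix ι ι ℝ) (v : ι → ℂ) :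
    reVec (M.map (algebraMap ℝ ℂ) *ᵥ v) = M *ᵥ reVec v := by
  ext i
  simp [reVec, mulVec, dotProduct]

theorem reVec_map_pow_mulVec (M : Matrix ι ι ℝ) (v : ι → ℂ) (j : ℕ) :
    reVec ((M.map (algebraMap ℝ ℂ)) ^ j *ᵥ v) = (M ^ j) *ᵥ reVec v := by
  induction j generalizing v with
  | zero => simp
  | succ j ih => rw [pow_succ, pow_succ, ← mulVec_mulVec, ih, reVec_map_mulVec, mulVec_mulVec]

theorem reVec_mem_stableSpace {M : Matrix ι ι ℝ} {z : ℂ} (hz : z.re < 0) {v : ι → ℂ} {k : ℕ}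
    (h : ((M.map (algebraMap ℝ ℂ) - z • 1) ^ k) *ᵥ v = 0) : reVec v ∈ stableSpace M :=
  mem_stableSpace_of_map reVec (reVec_map_pow_mulVec M v) (memLp_flow_of_pow_mulVec_eq_zero hz h)

theorem exists_pow_mulVec_eq_zero {N : Matrix ι ι ℂ} {z : ℂ} {v : ι → ℂ}
    (hv : v ∈ Module.End.maxGenEigenspace (toLin' N) z) : ∃ k : ℕ, ((N - z • 1) ^ k) *ᵥ v = 0 := by
  obtain ⟨k, hk⟩ := Module.End.mem_maxGenEigenspace _ _ _ |>.1 hv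
  refine ⟨k, ?_⟩
  rw [← toLin'_apply, toLin'_pow, map_sub, map_smul, toLin'_one]
  exact hk

theorem hasEigenvalue_of_mem_maxGenEigenspace {N : Matrix ι ι ℂ} {z : ℂ} {v : ι → ℂ}
    (hv : v ∈ Module.End.maxGenEigenspace (toLin' N) z) (hv0 : v ≠ 0) :
    Module.End.HasEigenvalue (toLin' N) z := by
  obtain ⟨k, hk⟩ := Module.End.mem_maxGenEigenspace _ _ _ |>.1 hv
  refine Module.End.hasEigenvalue_of_hasGenEigenvalue (k := k) ?_
  intro h
  refine hv0 ?_
  have : v ∈ Module.End.genEigenspace (toLin' N) z k := Module.End.mem_genEigenspace_nat.2 hk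
  rw [h] at this
  simpa using this

/-- The real parts of the complex generalised eigenvectors span, so a real subspace which contains
them is everything. -/
theorem eq_top_of_forall_reVec_mem {M : Matrix ι ι ℝ} {V : Submodule ℝ (ι → ℝ)}
    (h : ∀ (z : ℂ) (v : ι → ℂ) (k : ℕ),
      Module.End.HasEigenvalue (toLin' (M.map (algebraMap ℝ ℂ))) z →
      ((M.map (algebraMap ℝ ℂ) - z • 1) ^ k) *ᵥ v = 0 → reVec v ∈ V) : V = ⊤ := by
  rw [eq_top_iff]
  intro w _
  have key : ∀ v : ι → ℂ, reVec v ∈ V := by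
    intro v
    have hv : v ∈ ⨆ z, Module.End.maxGenEigenspace (toLin' (M.map (algebraMap ℝ ℂ))) z := by
      rw [Module.End.iSup_maxGenEigenspace_eq_top]
      trivial
    induction hv using Submodule.iSup_induction' with
    | zero => simp
    | add x y _ _ hx hy => rw [map_add]; exact add_mem hx hy
    | mem z v hv =>
      by_cases hv0 : v = 0
      · simp [hv0]
      obtain ⟨k, hk⟩ := exists_pow_mulVec_eq_zero hv
      exact h z v k (hasEigenvalue_of_mem_maxGenEigenspace hv hv0) hk
  have h := key (fun i => (w i : ℂ))
  have e : reVec (fun i => (w i : ℂ)) = w := by ext i; simp [reVec]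
  rwa [e] at h

/-- If no eigenvalue is purely imaginary, every vector is the sum of the initial value of a
solution which is square integrable on `[0, ∞)` and of one which is so on `(-∞, 0]`. -/
theorem stableSpace_sup_stableSpace_neg {M : Matrix ι ι ℝ} (hM : NoImaginaryAxisEigenvalue M) :
    stableSpace M ⊔ stableSpace (-M) = ⊤ := by
  refine eq_top_of_forall_reVec_mem (M := M) fun z v k hz hk => ?_
  rcases lt_or_gt_of_ne (hM z hz) with h | h
  · exact Submodule.mem_sup_left (reVec_mem_stableSpace h hk)
  · refine Submodule.mem_sup_right (reVec_mem_stableSpace (z := -z) (k := k) (by simpa using h) ?_)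
    have e : (-M).map (algebraMap ℝ ℂ) - -z • (1 : Matrix ι ι ℂ)
        = -(M.map (algebraMap ℝ ℂ) - z • 1) := by
      ext i j
      simp
      ring
    rw [e, neg_pow, ← mulVec_mulVec, hk, mulVec_zero]

/-- A matrix all of whose eigenvalues have negative real part is exponentially stable. -/
theorem stableSpace_eq_top {M : Matrix ι ι ℝ}
    (hM : ∀ z, Module.End.HasEigenvalue (toLin' (M.map (algebraMap ℝ ℂ))) z → z.re < 0) :
    stableSpace M = ⊤ :=
  eq_top_of_forall_reVec_mem fun z _ _ hz hk => reVec_mem_stableSpace (hM z hz) hk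

/-- Solutions of `f' = M f` and of the adjoint equation `g' = -Mᵀ g` have constant scalar product;
when both are square integrable on `[0, ∞)` it vanishes. -/
theorem dotProduct_eq_zero_of_mem_stableSpace {M : Matrix ι ι ℝ} {v w : ι → ℝ}
    (hv : v ∈ stableSpace M) (hw : w ∈ stableSpace (-Mᵀ)) : v ⬝ᵥ w = 0 := by
  have hd : ∀ t, HasDerivAt (fun t => flow M t v ⬝ᵥ flow (-Mᵀ) t w) 0 t := by
    intro t
    have h1 := hasDerivAt_pi.1 (hasDerivAt_flow M v t)
    have h2 := hasDerivAt_pi.1 (hasDerivAt_flow (-Mᵀ) w t)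
    have h := HasDerivAt.fun_sum (u := Finset.univ) fun i _ => (h1 i).mul (h2 i)
    refine h.congr_deriv ?_
    rw [Finset.sum_add_distrib]
    change (M *ᵥ flow M t v) ⬝ᵥ flow (-Mᵀ) t w + flow M t v ⬝ᵥ (-Mᵀ *ᵥ flow (-Mᵀ) t w) = 0
    rw [neg_mulVec, dotProduct_neg, dotProduct_mulVec, vecMul_transpose, add_neg_cancel]
  have hconst : ∀ t, flow M t v ⬝ᵥ flow (-Mᵀ) t w = v ⬝ᵥ w := fun t => by
    have := is_const_of_deriv_eq_zero (fun t => (hd t).differentiableAt) (fun t => (hd t).deriv) t 0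
    simpa using this
  have hint : Integrable (fun t => flow M t v ⬝ᵥ flow (-Mᵀ) t w) (volume.restrict (Ici (0 : ℝ))) := by
    refine integrable_finsetSum _ fun i _ => ?_
    exact MemLp.integrable_mul (p := 2) (q := 2)
      ((ContinuousLinearMap.proj (R := ℝ) (φ := fun _ : ι => ℝ) i).comp_memLp' hv)
      ((ContinuousLinearMap.proj (R := ℝ) (φ := fun _ : ι => ℝ) i).comp_memLp' hw)
  simp only [hconst] at hint
  rw [integrable_const_iff] at hint
  rcases hint with h | h
  · exact h
  · exact absurd h.measure_univ_lt_top (by simp)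

end Flow

end Matrix

/-! ### Stable subspaces of Hamiltonian matrices -/

namespace Matrix

section Hamiltonian

variable {ι : Type*} [Fintype ι] [DecidableEq ι]

/-- The standard symplectic matrix. -/
def symplecticMatrix (ι : Type*) [DecidableEq ι] : Matrix (ι ⊕ ι) (ι ⊕ ι) ℝ := fromBlocks 0 1 (-1) 0

theorem symplecticMatrix_mulVec (x q : ι → ℝ) :
    symplecticMatrix ι *ᵥ Sum.elim x q = Sum.elim q (-x) := by
  simp [symplecticMatrix, fromBlocks_mulVec, neg_mulVec]

/-- A Hamiltonian matrix is conjugate to minus its transpose. -/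
theorem semiconjBy_symplecticMatrix (F S Q : Matrix ι ι ℝ) (hS : Sᵀ = S) (hQ : Qᵀ = Q) :
    SemiconjBy (symplecticMatrix ι) (fromBlocks F S (-Q) (-Fᵀ)) (-(fromBlocks F S (-Q) (-Fᵀ))ᵀ) := by
  rw [SemiconjBy, fromBlocks_transpose, fromBlocks_neg, symplecticMatrix, fromBlocks_multiply,
    fromBlocks_multiply]
  simp [hS, hQ]

variable {M : Matrix (ι ⊕ ι) (ι ⊕ ι) ℝ}

/-- The stable subspace of a Hamiltonian matrix is isotropic. -/
theorem dotProduct_symplecticMatrix_mulVec_eq_zero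
    (hM : SemiconjBy (symplecticMatrix ι) M (-Mᵀ)) {v w : ι ⊕ ι → ℝ}
    (hv : v ∈ stableSpace M) (hw : w ∈ stableSpace M) : v ⬝ᵥ symplecticMatrix ι *ᵥ w = 0 := by
  refine dotProduct_eq_zero_of_mem_stableSpace hv
    (mem_stableSpace_of_map (toLin' (symplecticMatrix ι)) (fun j => ?_) hw)
  rw [toLin'_apply, mulVec_mulVec, mulVec_mulVec, (hM.pow_right j).eq]

variable {F S Q : Matrix ι ι ℝ}

/-- When `F` is stable, the stable subspace of the Hamiltonian matrix is a graph over its image in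
the first component: isotropy gives `S q = 0` for its elements `(0, q)`, so that these form an
invariant subspace on which the flow is that of `-Fᵀ`, which has no square integrable solutions. -/
theorem eq_zero_of_elim_zero_mem_stableSpace (hS : S.PosSemidef) (hQ : Qᵀ = Q)
    (hF : stableSpace F = ⊤) {q : ι → ℝ}
    (hq : Sum.elim (0 : ι → ℝ) q ∈ stableSpace (fromBlocks F S (-Q) (-Fᵀ))) : q = 0 := by
  set M := fromBlocks F S (-Q) (-Fᵀ) with hMdef
  have hM := semiconjBy_symplecticMatrix F S Q (by simpa using hS.isHermitian.eq) hQ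
  have hMq : ∀ q, M *ᵥ Sum.elim (0 : ι → ℝ) q = Sum.elim (S *ᵥ q) (-Fᵀ *ᵥ q) := fun q => by
    simp [hMdef, fromBlocks_mulVec]
  have hSq : ∀ q : ι → ℝ, Sum.elim (0 : ι → ℝ) q ∈ stableSpace M → S *ᵥ q = 0 := fun q hq => by
    have h := dotProduct_symplecticMatrix_mulVec_eq_zero hM (mulVec_mem_stableSpace hq) hq
    rw [symplecticMatrix_mulVec, ← hMdef, hMq, sumElim_dotProduct_sumElim] at h
    simp only [neg_zero, dotProduct_zero, add_zero] at h
    rw [dotProduct_comm] at h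
    exact (hS.dotProduct_mulVec_zero_iff q).1 (by simpa using h)
  have hpow : ∀ j : ℕ, Sum.elim (0 : ι → ℝ) (((-Fᵀ) ^ j) *ᵥ q) ∈ stableSpace M
      ∧ (M ^ j) *ᵥ Sum.elim (0 : ι → ℝ) q = Sum.elim (0 : ι → ℝ) (((-Fᵀ) ^ j) *ᵥ q) := fun j => by
    induction j with
    | zero => simpa using hq
    | succ j ih =>
      have h := hMq (((-Fᵀ) ^ j) *ᵥ q)
      rw [hSq _ ih.1, mulVec_mulVec (M := -Fᵀ), ← pow_succ'] at h
      refine ⟨h ▸ mulVec_mem_stableSpace ih.1, ?_⟩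
      rw [pow_succ', ← mulVec_mulVec, ih.2, h]
  have hq' : q ∈ stableSpace (-Fᵀ) :=
    mem_stableSpace_of_map (LinearMap.funLeft ℝ ℝ Sum.inr) (fun j => by
      rw [(hpow j).2]; rfl) hq
  refine dotProduct_self_eq_zero.1 (dotProduct_eq_zero_of_mem_stableSpace (M := F) ?_ hq')
  rw [hF]
  trivial

/-- When moreover no eigenvalue is purely imaginary, every value of the first component is
attained: a covector which annihilates these values gives a vector symplectically orthogonal to the
stable subspace, and the latter equals its symplectic orthogonal. -/
theorem exists_elim_mem_stableSpace (hS : S.PosSemidef) (hQ : Qᵀ = Q) (hF : stableSpace F = ⊤)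
    (hM : NoImaginaryAxisEigenvalue (fromBlocks F S (-Q) (-Fᵀ))) (x : ι → ℝ) :
    ∃ q, Sum.elim x q ∈ stableSpace (fromBlocks F S (-Q) (-Fᵀ)) := by
  set M := fromBlocks F S (-Q) (-Fᵀ) with hMdef
  have hJ : SemiconjBy (symplecticMatrix ι) M (-Mᵀ) :=
    semiconjBy_symplecticMatrix F S Q (by simpa using hS.isHermitian.eq) hQ
  have hJ' : SemiconjBy (symplecticMatrix ι) (-M) (-(-M)ᵀ) := by
    have := hJ.neg_right
    rwa [← transpose_neg] at this ⊢
  set X : Submodule ℝ (ι → ℝ) := (stableSpace M).map (LinearMap.funLeft ℝ ℝ Sum.inl) with hX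
  suffices hXt : X = ⊤ by
    obtain ⟨w, hw, rfl⟩ : x ∈ X := hXt ▸ trivial
    refine ⟨w ∘ Sum.inr, ?_⟩
    rw [show Sum.elim (LinearMap.funLeft ℝ ℝ Sum.inl w) (w ∘ Sum.inr) = w
      from Sum.elim_comp_inl_inr w]
    exact hw
  by_contra hne
  obtain ⟨f, hf0, hf⟩ := X.exists_le_ker_of_lt_top (lt_top_iff_ne_top.2 hne)
  set p : ι → ℝ := fun i => f (Pi.single i 1) with hp
  have hfp : ∀ y, f y = p ⬝ᵥ y := fun y => by
    rw [LinearMap.pi_apply_eq_sum_univ f y, dotProduct]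
    refine Finset.sum_congr rfl fun i _ => ?_
    rw [smul_eq_mul, mul_comm]
    congr 2
    ext j
    simp [Pi.single_apply, eq_comm]
  have horth : ∀ w ∈ stableSpace M, Sum.elim (0 : ι → ℝ) p ⬝ᵥ symplecticMatrix ι *ᵥ w = 0 := by
    intro w hw
    have h1 : f (w ∘ Sum.inl) = 0 := hf ⟨w, hw, rfl⟩
    rw [hfp] at h1
    rw [← Sum.elim_comp_inl_inr w, symplecticMatrix_mulVec, sumElim_dotProduct_sumElim,
      zero_dotProduct, dotProduct_neg, h1]
    simp
  obtain ⟨s, hs, u, hu, hsu⟩ := Submodule.mem_sup.1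
    (show Sum.elim (0 : ι → ℝ) p ∈ stableSpace M ⊔ stableSpace (-M) by
      rw [stableSpace_sup_stableSpace_neg hM]; trivial)
  -- The unstable component is symplectically orthogonal to both subspaces, hence to everything.
  have hu0 : u = 0 := by
    have hall : ∀ w, u ⬝ᵥ symplecticMatrix ι *ᵥ w = 0 := by
      intro w
      obtain ⟨a, ha, b, hb, rfl⟩ := Submodule.mem_sup.1
        (show w ∈ stableSpace M ⊔ stableSpace (-M) by
          rw [stableSpace_sup_stableSpace_neg hM]; trivial)
      have h1 : u ⬝ᵥ symplecticMatrix ι *ᵥ a = 0 := by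
        have h2 := horth a ha
        rw [← hsu, add_dotProduct, dotProduct_symplecticMatrix_mulVec_eq_zero hJ hs ha,
          zero_add] at h2
        exact h2
      rw [mulVec_add, dotProduct_add, h1, dotProduct_symplecticMatrix_mulVec_eq_zero hJ' hu hb,
        add_zero]
    have h3 := hall (Sum.elim (-(u ∘ Sum.inr)) (u ∘ Sum.inl))
    rw [symplecticMatrix_mulVec, neg_neg, Sum.elim_comp_inl_inr] at h3
    exact dotProduct_self_eq_zero.1 h3
  rw [hu0, add_zero] at hsu
  have hp0 := eq_zero_of_elim_zero_mem_stableSpace hS hQ hF (hsu ▸ hs)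
  refine hf0 (LinearMap.ext fun y => ?_)
  rw [hfp, hp0]
  simp

end Hamiltonian

end Matrix

/-! ### The consistency equations -/

section Consistency

variable {n r : ℕ} {ρ : ℝ} {A : Matrix (Fin n) (Fin n) ℝ} {B : Matrix (Fin n) (Fin r) ℝ}
  {C : Matrix (Fin n) (Fin n) ℝ} {D : Matrix (Fin n) (Fin r) ℝ}
  {Q : Matrix (Fin n) (Fin n) ℝ} {R : Matrix (Fin r) (Fin r) ℝ} {P : Matrix (Fin n) (Fin n) ℝ}

/-- `Ā - (ρ/2) I`. -/
noncomputable def discountedMatrix (ρ : ℝ) (A : Matrix (Fin n) (Fin n) ℝ) (B : Matrix (Fin n) (Fin r) ℝ)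
    (C : Matrix (Fin n) (Fin n) ℝ) (D : Matrix (Fin n) (Fin r) ℝ) (R : Matrix (Fin r) (Fin r) ℝ)
    (P : Matrix (Fin n) (Fin n) ℝ) : Matrix (Fin n) (Fin n) ℝ :=
  closedLoopMatrix A B C D R P - (ρ / 2) • (1 : Matrix (Fin n) (Fin n) ℝ)

theorem hamiltonianMatrix_eq : hamiltonianMatrix ρ A B C D Q R P
    = Matrix.fromBlocks (discountedMatrix ρ A B C D R P) (inputMatrix B D R P) (-Q)
        (-(discountedMatrix ρ A B C D R P)ᵀ) := by
  rw [hamiltonianMatrix, discountedMatrix]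
  congr 1
  rw [Matrix.transpose_sub, Matrix.transpose_smul, Matrix.transpose_one, neg_sub, sub_eq_neg_add]

theorem hasDerivAt_exp_const_mul (c t : ℝ) :
    HasDerivAt (fun t => Real.exp (c * t)) (c * Real.exp (c * t)) t := by
  have h := ((hasDerivAt_id t).const_mul c).exp
  simpa [mul_comm] using h

theorem exp_half_mul_sq (ρ t : ℝ) : Real.exp (-(ρ / 2) * t) ^ 2 = Real.exp (-ρ * t) := by
  rw [← Real.exp_nat_mul]
  congr 1
  push_cast
  ring

/-- After the substitution `x = e^{-ρt/2} xbar`, `q = -e^{-ρt/2} s` the consistency equations are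
the Hamiltonian system. -/
theorem IsConsistencySolution.eq_flow {x₀ : EuclideanSpace ℝ (Fin n)}
    {s x : ℝ → EuclideanSpace ℝ (Fin n)} (h : IsConsistencySolution ρ A B C D Q R P x₀ s x)
    {t : ℝ} (ht : 0 ≤ t) :
    Sum.elim (Real.exp (-(ρ / 2) * t) • (x t).ofLp) (-(Real.exp (-(ρ / 2) * t) • (s t).ofLp))
      = (hamiltonianMatrix ρ A B C D Q R P).flow t (Sum.elim x₀.ofLp (-(s 0).ofLp)) := by
  have hd := Matrix.eq_flow_of_hasDerivWithinAt (N := hamiltonianMatrix ρ A B C D Q R P)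
    (f := fun t => Sum.elim (Real.exp (-(ρ / 2) * t) • (x t).ofLp)
      (-(Real.exp (-(ρ / 2) * t) • (s t).ofLp))) (fun t ht => ?_) ht
  · simpa [h.initial] using hd
  · have hx := fun i => (EuclideanSpace.proj (𝕜 := ℝ) i).hasFDerivAt.comp_hasDerivWithinAt t
      (h.differentiable_xbar t ht).hasDerivWithinAt
    have hs := fun i => (EuclideanSpace.proj (𝕜 := ℝ) i).hasFDerivAt.comp_hasDerivWithinAt t
      (h.differentiable_s t ht).hasDerivWithinAt
    have he := (hasDerivAt_exp_const_mul (-(ρ / 2)) t).hasDerivWithinAt (s := Ici 0)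
    have hs' : derivWithin s (Ici 0) t = ρ • s t - act (closedLoopMatrix A B C D R P)ᵀ (s t)
        + act Q (x t) := by rw [h.eq_s t ht]; abel
    rw [hasDerivWithinAt_pi]
    rintro (i | i)
    · refine (he.mul (hx i)).congr_deriv ?_
      rw [h.eq_xbar t ht, hamiltonianMatrix_eq, Matrix.fromBlocks_mulVec, Sum.elim_comp_inl,
        Sum.elim_comp_inr, discountedMatrix]
      simp [Matrix.mulVec_smul, Matrix.sub_mulVec, Matrix.smul_mulVec, Matrix.mulVec_neg]
      ring
    · refine (he.mul (hs i)).neg.congr_deriv ?_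
      rw [hs', hamiltonianMatrix_eq, Matrix.fromBlocks_mulVec, Sum.elim_comp_inl,
        Sum.elim_comp_inr, discountedMatrix]
      simp [Matrix.mulVec_smul, Matrix.sub_mulVec, Matrix.smul_mulVec, Matrix.mulVec_neg,
        Matrix.neg_mulVec]
      ring

/-- The weight in `C_{ρ/2}` becomes square integrability after the substitution. -/
theorem IsConsistencySolution.mem_stableSpace {x₀ : EuclideanSpace ℝ (Fin n)}
    {s x : ℝ → EuclideanSpace ℝ (Fin n)} (h : IsConsistencySolution ρ A B C D Q R P x₀ s x) :
    Sum.elim x₀.ofLp (-(s 0).ofLp) ∈ (hamiltonianMatrix ρ A B C D Q R P).stableSpace := by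
  have hg : MemLp (fun t => Real.exp (-(ρ / 2) * t) * ‖WithLp.toLp 2 (s t, x t)‖) 2
      (volume.restrict (Ici 0)) := by
    have hc : ContinuousOn (fun t => Real.exp (-(ρ / 2) * t) * ‖WithLp.toLp 2 (s t, x t)‖)
        (Ici 0) := (by fun_prop : Continuous fun t => Real.exp (-(ρ / 2) * t)).continuousOn.mul
          h.mem.1.norm
    rw [memLp_two_iff_integrable_sq (hc.aestronglyMeasurable measurableSet_Ici)]
    simp only [mul_pow, exp_half_mul_sq]
    exact h.mem.2
  refine hg.mono (Matrix.continuous_flow _ _).aestronglyMeasurable ?_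
  filter_upwards [ae_restrict_mem measurableSet_Ici] with t ht
  have ht : 0 ≤ t := ht
  rw [← h.eq_flow ht, Real.norm_of_nonneg (by positivity)]
  refine (pi_norm_le_iff_of_nonneg (by positivity)).2 ?_
  have hsx := WithLp.prod_norm_sq_eq_of_L2 (WithLp.toLp 2 (s t, x t))
  simp only [WithLp.toLp_fst, WithLp.toLp_snd] at hsx
  have h1 : ‖x t‖ ≤ ‖WithLp.toLp 2 (s t, x t)‖ :=
    abs_le_of_sq_le_sq' (by rw [hsx]; linarith [sq_nonneg ‖s t‖]) (norm_nonneg _) |>.2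
  have h2 : ‖s t‖ ≤ ‖WithLp.toLp 2 (s t, x t)‖ :=
    abs_le_of_sq_le_sq' (by rw [hsx]; linarith [sq_nonneg ‖x t‖]) (norm_nonneg _) |>.2
  rintro (i | i)
  · simp only [Sum.elim_inl, Pi.smul_apply, norm_smul, Real.norm_eq_abs, Real.abs_exp]
    gcongr
    exact (PiLp.norm_apply_le (x t) i).trans h1
  · simp only [Sum.elim_inr, Pi.neg_apply, norm_neg, Pi.smul_apply, norm_smul, Real.norm_eq_abs,
      Real.abs_exp]
    gcongr
    exact (PiLp.norm_apply_le (s t) i).trans h2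

/-- Square integrable solutions of the Hamiltonian system give solutions of the consistency
equations. -/
theorem isConsistencySolution_of_mem_stableSpace {x₀ : EuclideanSpace ℝ (Fin n)} {q : Fin n → ℝ}
    (h : Sum.elim x₀.ofLp q ∈ (hamiltonianMatrix ρ A B C D Q R P).stableSpace) :
    ∃ s x : ℝ → EuclideanSpace ℝ (Fin n), IsConsistencySolution ρ A B C D Q R P x₀ s x := by
  set M := hamiltonianMatrix ρ A B C D Q R P with hM
  set f : ℝ → Fin n ⊕ Fin n → ℝ := fun t => M.flow t (Sum.elim x₀.ofLp q) with hf
  set x : ℝ → EuclideanSpace ℝ (Fin n) := fun t =>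
    WithLp.toLp 2 (Real.exp (ρ / 2 * t) • (f t ∘ Sum.inl)) with hx
  set s : ℝ → EuclideanSpace ℝ (Fin n) := fun t =>
    WithLp.toLp 2 (-(Real.exp (ρ / 2 * t) • (f t ∘ Sum.inr))) with hs
  have hfd := fun t => hasDerivAt_pi.1 (Matrix.hasDerivAt_flow M (Sum.elim x₀.ofLp q) t)
  have he := hasDerivAt_exp_const_mul (ρ / 2)
  have hMf : ∀ t, M *ᵥ f t = Sum.elim
      (discountedMatrix ρ A B C D R P *ᵥ (f t ∘ Sum.inl) + inputMatrix B D R P *ᵥ (f t ∘ Sum.inr))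
      ((-Q) *ᵥ (f t ∘ Sum.inl) + (-(discountedMatrix ρ A B C D R P)ᵀ) *ᵥ (f t ∘ Sum.inr)) :=
    fun t => by rw [hM, hamiltonianMatrix_eq, Matrix.fromBlocks_mulVec]
  have hlift : ∀ {g : ℝ → Fin n → ℝ} {g' : Fin n → ℝ} {t : ℝ}, HasDerivAt g g' t →
      HasDerivAt (fun t => (WithLp.toLp 2 (g t) : EuclideanSpace ℝ (Fin n))) (WithLp.toLp 2 g') t :=
    fun {g g' t} hg => (PiLp.continuousLinearEquiv 2 ℝ
      (fun _ : Fin n => ℝ)).symm.toContinuousLinearMap.hasFDerivAt.comp_hasDerivAt t hg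
  have hdx : ∀ t, HasDerivAt x (act (closedLoopMatrix A B C D R P) (x t)
      - act (inputMatrix B D R P) (s t)) t := by
    intro t
    have h1 : HasDerivAt (fun t => Real.exp (ρ / 2 * t) • (f t ∘ Sum.inl))
        ((closedLoopMatrix A B C D R P) *ᵥ (x t).ofLp - inputMatrix B D R P *ᵥ (s t).ofLp) t := by
      rw [hasDerivAt_pi]
      intro i
      refine ((he t).mul (hfd t (Sum.inl i))).congr_deriv ?_
      change _ * f t (Sum.inl i) + _ * (M *ᵥ f t) (Sum.inl i) = _
      rw [hMf, discountedMatrix, hx, hs]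
      simp [Matrix.mulVec_smul, Matrix.sub_mulVec, Matrix.smul_mulVec, Matrix.mulVec_neg]
      ring
    exact hlift h1
  have hds : ∀ t, HasDerivAt s (ρ • s t - act (closedLoopMatrix A B C D R P)ᵀ (s t)
      + act Q (x t)) t := by
    intro t
    have h1 : HasDerivAt (fun t => -(Real.exp (ρ / 2 * t) • (f t ∘ Sum.inr)))
        (ρ • (s t).ofLp - (closedLoopMatrix A B C D R P)ᵀ *ᵥ (s t).ofLp + Q *ᵥ (x t).ofLp) t := by
      rw [hasDerivAt_pi]
      intro i
      refine ((he t).mul (hfd t (Sum.inr i))).neg.congr_deriv ?_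
      change -(_ * f t (Sum.inr i) + _ * (M *ᵥ f t) (Sum.inr i)) = _
      rw [hMf, discountedMatrix, hx, hs]
      simp [Matrix.mulVec_smul, Matrix.sub_mulVec, Matrix.smul_mulVec, Matrix.mulVec_neg,
        Matrix.neg_mulVec]
      ring
    exact hlift h1
  have hu := uniqueDiffOn_Ici (0 : ℝ)
  have hcx : Continuous x := continuous_iff_continuousAt.2 fun t => (hdx t).continuousAt
  have hcs : Continuous s := continuous_iff_continuousAt.2 fun t => (hds t).continuousAt
  refine ⟨s, x, ⟨?_, ?_⟩, fun t _ => (hds t).differentiableAt.differentiableWithinAt,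
    fun t _ => (hdx t).differentiableAt.differentiableWithinAt, fun t ht => ?_, fun t ht => ?_, ?_⟩
  · exact ((WithLp.prod_continuous_toLp 2 _ _).comp (hcs.prodMk hcx)).continuousOn
  · have hi : IntegrableOn (fun t => ∑ k, f t k ^ 2) (Ici 0) := by
      refine integrable_finsetSum _ fun k _ => ?_
      exact ((ContinuousLinearMap.proj (R := ℝ) (φ := fun _ : Fin n ⊕ Fin n => ℝ) k).comp_memLp'
        h).integrable_sq
    refine hi.congr (Eventually.of_forall fun t => ?_)
    simp only
    rw [WithLp.prod_norm_sq_eq_of_L2, WithLp.toLp_fst, WithLp.toLp_snd,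
      EuclideanSpace.norm_sq_eq, EuclideanSpace.norm_sq_eq, Fintype.sum_sum_type, ← Finset.sum_add_distrib,
      ← Finset.sum_add_distrib, Finset.mul_sum]
    refine Finset.sum_congr rfl fun i _ => ?_
    have e1 : Real.exp (-ρ * t) * Real.exp (ρ / 2 * t) ^ 2 = 1 := by
      rw [← Real.exp_nat_mul, ← Real.exp_add, Real.exp_eq_one_iff]
      push_cast
      ring
    simp only [hx, hs, Real.norm_eq_abs, sq_abs, Pi.neg_apply, Pi.smul_apply, Function.comp_apply,
      smul_eq_mul, neg_sq, mul_pow]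
    linear_combination -(f t (Sum.inl i) ^ 2 + f t (Sum.inr i) ^ 2) * e1
  · rw [(hds t).hasDerivWithinAt.derivWithin (hu t ht)]
    abel
  · rw [(hdx t).hasDerivWithinAt.derivWithin (hu t ht)]
  · simp only [hx, hf, mul_zero, Real.exp_zero, one_smul, Matrix.flow_zero, Sum.elim_comp_inl]

/-- Solvability of the consistency equations, for a stable `Ā - (ρ/2) I`. -/
theorem existsUnique_isConsistencySolution (hS : (inputMatrix B D R P).PosSemidef) (hQ : Qᵀ = Q)
    (hF : (discountedMatrix ρ A B C D R P).stableSpace = ⊤)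
    (hM : NoImaginaryAxisEigenvalue (hamiltonianMatrix ρ A B C D Q R P))
    (x₀ : EuclideanSpace ℝ (Fin n)) :
    ∃ s x : ℝ → EuclideanSpace ℝ (Fin n), IsConsistencySolution ρ A B C D Q R P x₀ s x ∧
      ∀ s' x' : ℝ → EuclideanSpace ℝ (Fin n), IsConsistencySolution ρ A B C D Q R P x₀ s' x' →
        EqOn s' s (Ici 0) ∧ EqOn x' x (Ici 0) := by
  obtain ⟨q, hq⟩ : ∃ q, Sum.elim x₀.ofLp q ∈ (hamiltonianMatrix ρ A B C D Q R P).stableSpace := by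
    rw [hamiltonianMatrix_eq] at hM ⊢
    exact Matrix.exists_elim_mem_stableSpace hS hQ hF hM _
  obtain ⟨s, x, hsx⟩ := isConsistencySolution_of_mem_stableSpace hq
  refine ⟨s, x, hsx, fun s' x' h' => ?_⟩
  have h0 : (s' 0).ofLp = (s 0).ofLp := by
    have h1 := sub_mem h'.mem_stableSpace hsx.mem_stableSpace
    have e : Sum.elim x₀.ofLp (-(s' 0).ofLp) - Sum.elim x₀.ofLp (-(s 0).ofLp)
        = Sum.elim (0 : Fin n → ℝ) ((s 0).ofLp - (s' 0).ofLp) := by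
      ext (i | i)
      · simp
      · simp; ring
    rw [e, hamiltonianMatrix_eq] at h1
    exact (sub_eq_zero.1 (Matrix.eq_zero_of_elim_zero_mem_stableSpace hS hQ hF h1)).symm
  have heq : ∀ t, 0 ≤ t → s' t = s t ∧ x' t = x t := fun t ht => by
    have h1 := h'.eq_flow ht
    rw [h0, ← hsx.eq_flow ht, Sum.elim_eq_iff, neg_inj] at h1
    have he := (Real.exp_pos (-(ρ / 2) * t)).ne'
    exact ⟨WithLp.ofLp_injective 2 (smul_right_injective _ he h1.2),
      WithLp.ofLp_injective 2 (smul_right_injective _ he h1.1)⟩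
  exact ⟨fun t ht => (heq t ht).1, fun t ht => (heq t ht).2⟩

end Consistency

/-! ### Differential equations for the moments -/

section Primitive

variable {E : Type*} [NormedAddCommGroup E] [NormedSpace ℝ E] [CompleteSpace E]

theorem continuousOn_of_eq_add_integral {f g : ℝ → E} {x₀ : E}
    (hg : ∀ T, 0 ≤ T → IntegrableOn g (Icc 0 T)) (hf : ∀ t, 0 ≤ t → f t = x₀ + ∫ s in (0 : ℝ)..t, g s) :
    ContinuousOn f (Ici 0) := by
  intro t ht
  have ht : 0 ≤ t := ht
  have h1 : ContinuousOn (fun u => x₀ + ∫ s in (0 : ℝ)..u, g s) (Icc 0 (t + 1)) := by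
    have h2 := intervalIntegral.continuousOn_primitive_interval (a := 0) (b := t + 1) (f := g)
      (μ := volume) (by rw [uIcc_of_le (by linarith)]; exact hg _ (by linarith))
    rw [uIcc_of_le (by linarith)] at h2
    exact continuousOn_const.add h2
  have h3 : ContinuousWithinAt f (Icc 0 (t + 1)) t :=
    (h1.congr fun u hu => hf u hu.1) t ⟨ht, by linarith⟩
  refine h3.mono_of_mem_nhdsWithin ?_
  rw [← Ici_inter_Iic]
  exact inter_mem_nhdsWithin _ (Iic_mem_nhds (by linarith))

theorem hasDerivWithinAt_of_eq_add_integral {f g : ℝ → E} {x₀ : E} (hg : ContinuousOn g (Ici 0))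
    (hf : ∀ t, 0 ≤ t → f t = x₀ + ∫ s in (0 : ℝ)..t, g s) {t : ℝ} (ht : 0 ≤ t) :
    HasDerivWithinAt f (g t) (Ici 0) t := by
  have hc : Continuous fun s => g (max s 0) :=
    hg.comp_continuous (continuous_id.max continuous_const) fun s => mem_Ici.2 (le_max_right _ _)
  have h1 := ((hc.integral_hasStrictDerivAt 0 t).hasDerivAt.const_add x₀).hasDerivWithinAt (s := Ici 0)
  rw [max_eq_left ht] at h1
  have e : ∀ u, 0 ≤ u → f u = x₀ + ∫ s in (0 : ℝ)..u, g (max s 0) := fun u hu => by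
    rw [hf u hu]
    congr 1
    refine intervalIntegral.integral_congr fun s hs => ?_
    rw [uIcc_of_le hu] at hs
    simp only [max_eq_left hs.1]
  exact h1.congr (fun u hu => e u hu) (e t ht)

end Primitive

namespace IsSDESolution

variable {Ω : Type*} {m : MeasurableSpace Ω} {μ : Measure Ω} [IsProbabilityMeasure μ]
  {ℱ : Filtration ℝ≥0 m} {W : ℝ≥0 → Ω → ℝ}
  {E : Type*} [NormedAddCommGroup E] [InnerProductSpace ℝ E] [CompleteSpace E]
  {a c : E →L[ℝ] E} {x₀ : E} {x : ℝ≥0 → Ω → E}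

/-- The mean `m` of a solution has derivative `a m`. -/
theorem hasDerivWithinAt_integral (hx : IsSDESolution μ ℱ W a c x₀ x)
    (hW : IsFilteredBrownian μ ℱ W) {t : ℝ} (ht : 0 ≤ t) :
    HasDerivWithinAt (fun s : ℝ => ∫ ω, x s.toNNReal ω ∂μ) (a (∫ ω, x t.toNNReal ω ∂μ)) (Ici 0) t := by
  have hf : ∀ t : ℝ, 0 ≤ t → ∫ ω, x t.toNNReal ω ∂μ
      = x₀ + ∫ s in (0 : ℝ)..t, a (∫ ω, x s.toNNReal ω ∂μ) := fun t ht => by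
    have h := hx.integral_eq hW t.toNNReal
    rwa [Real.coe_toNNReal t ht] at h
  have hi : ∀ T : ℝ, 0 ≤ T → IntegrableOn (fun s : ℝ => ∫ ω, x s.toNNReal ω ∂μ) (Icc 0 T) := by
    intro T hT
    have h : Integrable (fun p => onPaths x p) (pathMeasure μ T.toNNReal) :=
      (hx.memLp_onPaths T.toNNReal).integrable one_le_two
    have h2 := h.integral_prod_right
    rwa [Real.coe_toNNReal T hT] at h2
  have hc : ContinuousOn (fun s : ℝ => ∫ ω, x s.toNNReal ω ∂μ) (Ici 0) :=
    continuousOn_of_eq_add_integral (fun T hT => a.integrable_comp (hi T hT)) hf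
  exact hasDerivWithinAt_of_eq_add_integral (a.continuous.comp_continuousOn hc) hf ht

theorem continuousOn_integral_inner (hx : IsSDESolution μ ℱ W a c x₀ x)
    (hW : IsFilteredBrownian μ ℱ W) {G : E →L[ℝ] E}
    (hG : ∀ u v, inner ℝ (G u) v = inner ℝ u (G v)) :
    ContinuousOn (fun t : ℝ => ∫ ω, inner ℝ (G (x t.toNNReal ω)) (x t.toNNReal ω) ∂μ) (Ici 0) := by
  refine continuousOn_of_eq_add_integral (x₀ := inner ℝ (G x₀) x₀) (g := fun s =>
    2 * ∫ ω, inner ℝ (G (a (x s.toNNReal ω))) (x s.toNNReal ω) ∂μ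
        + ∫ ω, inner ℝ (G (c (x s.toNNReal ω))) (c (x s.toNNReal ω)) ∂μ) (fun T hT => ?_)
    (fun t ht => ?_)
  · have h1 := hx.integrableOn_integral_inner (G.comp a) (ContinuousLinearMap.id ℝ E) T.toNNReal
    have h2 := hx.integrableOn_integral_inner (G.comp c) c T.toNNReal
    rw [Real.coe_toNNReal T hT] at h1 h2
    exact (h1.const_mul 2).add h2
  · have h := hx.integral_inner_self hW hG t.toNNReal
    rw [Real.coe_toNNReal t ht] at h
    rw [h, intervalIntegral.integral_of_le ht, ← integral_Icc_eq_integral_Ioc]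

/-- The second moments `E ⟨G x, x⟩` have derivative `E ⟨H x, x⟩`, where `H` is the image of `G`
under the Lyapunov operator of the equation. -/
theorem hasDerivWithinAt_integral_inner (hx : IsSDESolution μ ℱ W a c x₀ x)
    (hW : IsFilteredBrownian μ ℱ W) {G H : E →L[ℝ] E}
    (hG : ∀ u v, inner ℝ (G u) v = inner ℝ u (G v))
    (hH : ∀ u v, inner ℝ (H u) v = inner ℝ u (H v))
    (h : ∀ u, inner ℝ (H u) u = 2 * inner ℝ (G (a u)) u + inner ℝ (G (c u)) (c u))
    {t : ℝ} (ht : 0 ≤ t) :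
    HasDerivWithinAt (fun t : ℝ => ∫ ω, inner ℝ (G (x t.toNNReal ω)) (x t.toNNReal ω) ∂μ)
      (∫ ω, inner ℝ (H (x t.toNNReal ω)) (x t.toNNReal ω) ∂μ) (Ici 0) t := by
  refine hasDerivWithinAt_of_eq_add_integral (x₀ := inner ℝ (G x₀) x₀)
    (g := fun t => ∫ ω, inner ℝ (H (x t.toNNReal ω)) (x t.toNNReal ω) ∂μ)
    (hx.continuousOn_integral_inner hW hH) (fun t ht => ?_) ht
  have h1 := hx.integral_inner_self hW hG t.toNNReal
  rw [Real.coe_toNNReal t ht] at h1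
  rw [h1, intervalIntegral.integral_of_le ht, ← integral_Icc_eq_integral_Ioc]
  congr 1
  refine setIntegral_congr_fun measurableSet_Icc fun s _ => ?_
  have hm := hx.memLp hW s.toNNReal
  have i1 : Integrable (fun ω => 2 * inner ℝ (G (a (x s.toNNReal ω))) (x s.toNNReal ω)) μ :=
    (integrable_inner_of_memLp ((G.comp a).comp_memLp' hm) hm).const_mul 2
  have i2 : Integrable (fun ω => inner ℝ (G (c (x s.toNNReal ω))) (c (x s.toNNReal ω))) μ :=
    integrable_inner_of_memLp ((G.comp c).comp_memLp' hm) (c.comp_memLp' hm)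
  simp only [h]
  rw [integral_add i1 i2, integral_const_mul]

end IsSDESolution

/-! ### Completing the square in the Riccati equation -/

section Riccati

variable {n r : ℕ} {ρ : ℝ} {A : Matrix (Fin n) (Fin n) ℝ} {B : Matrix (Fin n) (Fin r) ℝ}
  {C : Matrix (Fin n) (Fin n) ℝ} {D : Matrix (Fin n) (Fin r) ℝ}
  {Q : Matrix (Fin n) (Fin n) ℝ} {R : Matrix (Fin r) (Fin r) ℝ} {P : Matrix (Fin n) (Fin n) ℝ}

/-- The Lyapunov operator `P ↦ (A - ρ/2)ᵀ P + P (A - ρ/2) + Cᵀ P C` of `dx = A x dt + C x dW`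
with discount rate `ρ`. -/
def lyapunov (ρ : ℝ) (A C P : Matrix (Fin n) (Fin n) ℝ) : Matrix (Fin n) (Fin n) ℝ :=
  Aᵀ * P + P * A + Cᵀ * P * C - ρ • P

/-- The difference of the two sides of the Riccati equation. -/
noncomputable def riccatiResidual (ρ : ℝ) (A : Matrix (Fin n) (Fin n) ℝ)
    (B : Matrix (Fin n) (Fin r) ℝ) (C : Matrix (Fin n) (Fin n) ℝ) (D : Matrix (Fin n) (Fin r) ℝ)
    (Q : Matrix (Fin n) (Fin n) ℝ) (R : Matrix (Fin r) (Fin r) ℝ) (P : Matrix (Fin n) (Fin n) ℝ) :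
    Matrix (Fin n) (Fin n) ℝ :=
  Aᵀ * P + P * A + Cᵀ * P * C + Q
    - (Bᵀ * P + Dᵀ * P * C)ᵀ * (R + Dᵀ * P * D)⁻¹ * (Bᵀ * P + Dᵀ * P * C) - ρ • P

/-- The optimal feedback `-(R + Dᵀ P D)⁻¹ (Bᵀ P + Dᵀ P C)`. -/
noncomputable def riccatiGain (B : Matrix (Fin n) (Fin r) ℝ) (C : Matrix (Fin n) (Fin n) ℝ)
    (D : Matrix (Fin n) (Fin r) ℝ) (R : Matrix (Fin r) (Fin r) ℝ) (P : Matrix (Fin n) (Fin n) ℝ) :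
    Matrix (Fin r) (Fin n) ℝ :=
  -((R + Dᵀ * P * D)⁻¹ * (Bᵀ * P + Dᵀ * P * C))

theorem isRiccatiSolution_iff :
    IsRiccatiSolution ρ A B C D Q R P ↔ P.PosSemidef ∧ riccatiResidual ρ A B C D Q R P = 0 := by
  rw [IsRiccatiSolution, riccatiResidual, sub_eq_zero, eq_comm (a := ρ • P)]

theorem closedLoopMatrix_eq : closedLoopMatrix A B C D R P = A + B * riccatiGain B C D R P := by
  rw [closedLoopMatrix, riccatiGain, Matrix.mul_neg, Matrix.mul_assoc, sub_eq_add_neg]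

theorem posDef_add_transpose_mul_mul (hR : R.PosDef) (hP : P.PosSemidef) (D : Matrix (Fin n) (Fin r) ℝ) :
    (R + Dᵀ * P * D).PosDef :=
  hR.add_posSemidef (hP.conjTranspose_mul_mul_same D)

theorem transpose_eq_of_isHermitian {ι : Type*} {M : Matrix ι ι ℝ} (h : M.IsHermitian) : Mᵀ = M := by
  simpa using h.eq

/-- Completing the square: the cost of the feedback `K` exceeds the optimal one by a square. -/
theorem lyapunov_add_eq_riccatiResidual_add (hR : R.PosDef) (hP : P.PosSemidef)
    (K : Matrix (Fin r) (Fin n) ℝ) :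
    lyapunov ρ (A + B * K) (C + D * K) P + (Q + Kᵀ * R * K) = riccatiResidual ρ A B C D Q R P
      + (K - riccatiGain B C D R P)ᵀ * (R + Dᵀ * P * D) * (K - riccatiGain B C D R P) := by
  have hY := posDef_add_transpose_mul_mul hR hP D
  have hu := (Matrix.isUnit_iff_isUnit_det _).1 hY.isUnit
  have hYt := transpose_eq_of_isHermitian hY.isHermitian
  have hPt := transpose_eq_of_isHermitian hP.isHermitian
  have hsq : (K - riccatiGain B C D R P)ᵀ * (R + Dᵀ * P * D) * (K - riccatiGain B C D R P)
      = Kᵀ * (R + Dᵀ * P * D) * K + Kᵀ * (Bᵀ * P + Dᵀ * P * C) + (Bᵀ * P + Dᵀ * P * C)ᵀ * K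
        + (Bᵀ * P + Dᵀ * P * C)ᵀ * (R + Dᵀ * P * D)⁻¹ * (Bᵀ * P + Dᵀ * P * C) := by
    rw [riccatiGain]
    generalize Bᵀ * P + Dᵀ * P * C = N
    generalize R + Dᵀ * P * D = Y at hu hYt
    have hYi : (Y⁻¹)ᵀ = Y⁻¹ := by rw [Matrix.transpose_nonsing_inv, hYt]
    rw [sub_neg_eq_add, Matrix.transpose_add, Matrix.transpose_mul, hYi, Matrix.add_mul,
      Matrix.mul_assoc Nᵀ, Matrix.nonsing_inv_mul _ hu, Matrix.mul_one, Matrix.add_mul,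
      Matrix.mul_add, Matrix.mul_add, Matrix.mul_assoc Kᵀ Y (Y⁻¹ * N),
      Matrix.mul_nonsing_inv_cancel_left _ _ hu, ← Matrix.mul_assoc Nᵀ]
    abel
  rw [hsq, lyapunov, riccatiResidual]
  generalize (Bᵀ * P + Dᵀ * P * C)ᵀ * (R + Dᵀ * P * D)⁻¹ * (Bᵀ * P + Dᵀ * P * C) = Z
  simp only [Matrix.transpose_add, Matrix.transpose_mul, Matrix.transpose_transpose, hPt,
    Matrix.add_mul, Matrix.mul_add, Matrix.mul_assoc]
  abel

theorem posSemidef_inputMatrix (hR : R.PosDef) (hP : P.PosSemidef) :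
    (inputMatrix B D R P).PosSemidef := by
  have h := (posDef_add_transpose_mul_mul hR hP D).posSemidef.inv
  exact h.mul_mul_conjTranspose_same B

/-- A Riccati solution solves the Lyapunov equation of its own feedback. -/
theorem IsRiccatiSolution.lyapunov_eq (h : IsRiccatiSolution ρ A B C D Q R P) (hR : R.PosDef) :
    lyapunov ρ (A + B * riccatiGain B C D R P) (C + D * riccatiGain B C D R P) P
      + (Q + (riccatiGain B C D R P)ᵀ * R * riccatiGain B C D R P) = 0 := by
  rw [lyapunov_add_eq_riccatiResidual_add hR h.1, (isRiccatiSolution_iff.1 h).2]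
  simp

end Riccati

/-! ### Stability of the closed loop -/

section Stability

open Matrix

variable {n r : ℕ}

theorem dotProduct_lyapunov_mulVec {ρ : ℝ} {A C P : Matrix (Fin n) (Fin n) ℝ} (hP : Pᵀ = P)
    (u : Fin n → ℝ) : u ⬝ᵥ lyapunov ρ A C P *ᵥ u
      = 2 * (P *ᵥ u ⬝ᵥ A *ᵥ u) + (C *ᵥ u) ⬝ᵥ P *ᵥ (C *ᵥ u) - ρ * (u ⬝ᵥ P *ᵥ u) := by
  have e1 : u ⬝ᵥ (Aᵀ * P) *ᵥ u = P *ᵥ u ⬝ᵥ A *ᵥ u := by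
    rw [← mulVec_mulVec, dotProduct_mulVec, vecMul_transpose, dotProduct_comm]
  have e2 : u ⬝ᵥ (P * A) *ᵥ u = P *ᵥ u ⬝ᵥ A *ᵥ u := by
    rw [← mulVec_mulVec, dotProduct_mulVec, ← mulVec_transpose, hP]
  have e3 : u ⬝ᵥ (Cᵀ * P * C) *ᵥ u = (C *ᵥ u) ⬝ᵥ P *ᵥ (C *ᵥ u) := by
    rw [Matrix.mul_assoc, ← mulVec_mulVec, ← mulVec_mulVec, dotProduct_mulVec, vecMul_transpose]
  rw [lyapunov, sub_mulVec, add_mulVec, add_mulVec, dotProduct_sub, dotProduct_add, dotProduct_add,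
    e1, e2, e3, smul_mulVec, dotProduct_smul, smul_eq_mul]
  ring

theorem Matrix.PosSemidef.dotProduct_nonneg {ι : Type*} [Fintype ι] {M : Matrix ι ι ℝ}
    (h : M.PosSemidef) (u : ι → ℝ) : 0 ≤ u ⬝ᵥ M *ᵥ u := by
  simpa using h.dotProduct_mulVec_nonneg u

theorem Matrix.PosSemidef.mulVec_eq_zero {ι : Type*} [Fintype ι] {M : Matrix ι ι ℝ}
    (h : M.PosSemidef) {u : ι → ℝ} (hu : u ⬝ᵥ M *ᵥ u = 0) : M *ᵥ u = 0 :=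
  (h.dotProduct_mulVec_zero_iff u).1 (by simpa using hu)

theorem mulVec_sqrt_eq_zero {Q : Matrix (Fin n) (Fin n) ℝ} (hQ : Q.PosSemidef) {u : Fin n → ℝ}
    (hu : Q *ᵥ u = 0) : CFC.sqrt Q *ᵥ u = 0 := by
  have h1 : CFC.sqrt Q * CFC.sqrt Q = Q := CFC.sqrt_mul_sqrt_self Q hQ.nonneg
  have h2 : (CFC.sqrt Q)ᵀ = CFC.sqrt Q :=
    transpose_eq_of_isHermitian (Matrix.nonneg_iff_posSemidef.1 (CFC.sqrt_nonneg Q)).isHermitian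
  refine dotProduct_self_eq_zero.1 ?_
  rw [dotProduct_mulVec, vecMul_mulVec, h2, h1, ← dotProduct_mulVec, hu,
    dotProduct_zero]

variable {Ω : Type*} {m : MeasurableSpace Ω} {μ : Measure Ω} [IsProbabilityMeasure μ]
  {ℱ : Filtration ℝ≥0 m} {W : ℝ≥0 → Ω → ℝ}

/-- Linear stochastic equations have solutions with values in a given invariant subspace. -/
theorem exists_isLinearSDESolution_mem (hW : IsFilteredBrownian μ ℱ W)
    {A C : Matrix (Fin n) (Fin n) ℝ} {V : Submodule ℝ (EuclideanSpace ℝ (Fin n))}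
    (hA : ∀ u ∈ V, act A u ∈ V) (hC : ∀ u ∈ V, act C u ∈ V) {z₀ : EuclideanSpace ℝ (Fin n)}
    (hz : z₀ ∈ V) : ∃ z, IsLinearSDESolution μ ℱ W A C z₀ z ∧ ∀ t ω, z t ω ∈ V := by
  obtain ⟨y, hy⟩ := exists_isSDESolution hW
    (((act A).comp V.subtypeL).codRestrict V fun u => hA u u.2)
    (((act C).comp V.subtypeL).codRestrict V fun u => hC u u.2) ⟨z₀, hz⟩
  exact ⟨_, isLinearSDESolution_iff.2 (hy.map (a' := act A) (c' := act C) V.subtypeL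
    (fun _ => rfl) fun _ => rfl), fun t ω => (y t ω).2⟩

/-- The mean of a solution is the solution of the deterministic equation. -/
theorem IsLinearSDESolution.integral_eq_flow {A C : Matrix (Fin n) (Fin n) ℝ}
    {z₀ : EuclideanSpace ℝ (Fin n)} {z : ℝ≥0 → Ω → EuclideanSpace ℝ (Fin n)}
    (hz : IsLinearSDESolution μ ℱ W A C z₀ z) (hW : IsFilteredBrownian μ ℱ W) (t : ℝ≥0) :
    (∫ ω, z t ω ∂μ).ofLp = A.flow t z₀.ofLp := by
  have hz' := isLinearSDESolution_iff.1 hz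
  have h := Matrix.eq_flow_of_hasDerivWithinAt (N := A)
    (f := fun s : ℝ => (∫ ω, z s.toNNReal ω ∂μ).ofLp) (fun s hs => ?_) t.coe_nonneg
  · have h0 : ∫ ω, z 0 ω ∂μ = z₀ := by
      rw [integral_congr_ae hz.initial]
      simp
    simpa [h0] using h
  · exact (PiLp.continuousLinearEquiv 2 ℝ
      (fun _ : Fin n => ℝ)).toContinuousLinearMap.hasFDerivAt.comp_hasDerivWithinAt s
        (hz'.hasDerivWithinAt_integral hW hs)

/-- On an invariant subspace which is not observed, exact detectability makes the mean, a solution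
of the deterministic equation, tend to zero. -/
theorem IsExactlyDetectable.tendsto_flow {A C H : Matrix (Fin n) (Fin n) ℝ}
    (h : IsExactlyDetectable μ ℱ W A C H) (hW : IsFilteredBrownian μ ℱ W)
    {V : Submodule ℝ (Fin n → ℝ)} (hA : ∀ u ∈ V, A *ᵥ u ∈ V) (hC : ∀ u ∈ V, C *ᵥ u ∈ V)
    (hH : ∀ u ∈ V, H *ᵥ u = 0) {u : Fin n → ℝ} (hu : u ∈ V) :
    Tendsto (fun t : ℝ≥0 => A.flow t u) atTop (𝓝 0) := by
  obtain ⟨z, hz, hzV⟩ := exists_isLinearSDESolution_mem hW (A := A) (C := C)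
    (V := V.comap (WithLp.linearEquiv 2 ℝ (Fin n → ℝ)).toLinearMap) (fun u hu => hA _ hu)
    (fun u hu => hC _ hu) (z₀ := WithLp.toLp 2 u) hu
  have hlim := h _ z hz (Eventually.of_forall fun ω t => by
    refine WithLp.ofLp_injective 2 ?_
    exact hH _ (hzV t ω))
  rw [tendsto_lintegral_enorm_sq_iff] at hlim
  have hm : ∀ t, AEStronglyMeasurable (z t) μ := fun t =>
    ((isLinearSDESolution_iff.1 hz).memLp hW t).1
  have h1 : Tendsto (fun t : ℝ≥0 => ∫ ω, z t ω ∂μ) atTop (𝓝 0) := by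
    rw [tendsto_zero_iff_enorm_tendsto_zero]
    refine tendsto_of_tendsto_of_tendsto_of_le_of_le tendsto_const_nhds hlim (fun _ => zero_le)
      fun t => ?_
    refine (enorm_integral_le_lintegral_enorm _).trans ?_
    rw [← eLpNorm_one_eq_lintegral_enorm]
    exact eLpNorm_le_eLpNorm_of_exponent_le one_le_two (hm t)
  have h2 := ((PiLp.continuous_ofLp 2 (fun _ : Fin n => ℝ)).tendsto 0).comp h1
  refine h2.congr fun t => ?_
  exact hz.integral_eq_flow hW t

end Stability

section ClosedLoop

open Matrix

variable {n r : ℕ} {ρ : ℝ} {A : Matrix (Fin n) (Fin n) ℝ} {B : Matrix (Fin n) (Fin r) ℝ}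
  {C : Matrix (Fin n) (Fin n) ℝ} {D : Matrix (Fin n) (Fin r) ℝ}
  {Q : Matrix (Fin n) (Fin n) ℝ} {R : Matrix (Fin r) (Fin r) ℝ} {P : Matrix (Fin n) (Fin n) ℝ}

theorem discountedMatrix_eq : discountedMatrix ρ A B C D R P
    = A - (ρ / 2) • (1 : Matrix (Fin n) (Fin n) ℝ) + B * riccatiGain B C D R P := by
  rw [discountedMatrix, closedLoopMatrix_eq]
  abel

theorem discountedMatrix_mulVec {u : Fin n → ℝ} (hu : riccatiGain B C D R P *ᵥ u = 0) :
    (A - (ρ / 2) • (1 : Matrix (Fin n) (Fin n) ℝ)) *ᵥ u = discountedMatrix ρ A B C D R P *ᵥ u := by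
  rw [discountedMatrix_eq, add_mulVec, ← mulVec_mulVec, hu, mulVec_zero, add_zero]

theorem closedLoop_diffusion_mulVec {u : Fin n → ℝ} (hu : riccatiGain B C D R P *ᵥ u = 0) :
    (C + D * riccatiGain B C D R P) *ᵥ u = C *ᵥ u := by
  rw [add_mulVec, ← mulVec_mulVec, hu, mulVec_zero, add_zero]

/-- The quadratic form of the Lyapunov equation of the closed loop. -/
theorem IsRiccatiSolution.dotProduct_eq_zero (h : IsRiccatiSolution ρ A B C D Q R P)
    (hR : R.PosDef) (u : Fin n → ℝ) :
    2 * (P *ᵥ u ⬝ᵥ discountedMatrix ρ A B C D R P *ᵥ u)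
      + (C + D * riccatiGain B C D R P) *ᵥ u ⬝ᵥ P *ᵥ (C + D * riccatiGain B C D R P) *ᵥ u
      + u ⬝ᵥ Q *ᵥ u
      + riccatiGain B C D R P *ᵥ u ⬝ᵥ R *ᵥ riccatiGain B C D R P *ᵥ u = 0 := by
  have h1 := congrArg (fun M => u ⬝ᵥ M *ᵥ u) (h.lyapunov_eq hR)
  simp only [add_mulVec _ (Q + _), add_mulVec Q, dotProduct_add, zero_mulVec, dotProduct_zero,
    dotProduct_lyapunov_mulVec (transpose_eq_of_isHermitian h.1.isHermitian)] at h1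
  rw [← closedLoopMatrix_eq] at h1
  have e : u ⬝ᵥ ((riccatiGain B C D R P)ᵀ * R * riccatiGain B C D R P) *ᵥ u
      = riccatiGain B C D R P *ᵥ u ⬝ᵥ R *ᵥ riccatiGain B C D R P *ᵥ u := by
    rw [Matrix.mul_assoc, ← mulVec_mulVec, ← mulVec_mulVec, dotProduct_mulVec, vecMul_transpose]
  rw [e] at h1
  rw [discountedMatrix, sub_mulVec, smul_mulVec, one_mulVec, dotProduct_sub, dotProduct_smul,
    smul_eq_mul, dotProduct_comm _ u]
  linarith

/-- The kernel of a Riccati solution is invariant and not observed. -/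
theorem IsRiccatiSolution.mulVec_eq_zero (h : IsRiccatiSolution ρ A B C D Q R P)
    (hR : R.PosDef) (hQ : Q.PosSemidef) {u : Fin n → ℝ} (hu : P *ᵥ u = 0) :
    Q *ᵥ u = 0 ∧ riccatiGain B C D R P *ᵥ u = 0 ∧ P *ᵥ (C *ᵥ u) = 0 ∧
      P *ᵥ (discountedMatrix ρ A B C D R P *ᵥ u) = 0 := by
  have h1 := h.dotProduct_eq_zero hR u
  rw [hu, zero_dotProduct, mul_zero, zero_add] at h1
  have n1 := h.1.dotProduct_nonneg ((C + D * riccatiGain B C D R P) *ᵥ u)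
  have n2 := hQ.dotProduct_nonneg u
  have n3 := hR.posSemidef.dotProduct_nonneg (riccatiGain B C D R P *ᵥ u)
  have hQu := hQ.mulVec_eq_zero (u := u) (by linarith)
  have hRK := hR.posSemidef.mulVec_eq_zero (u := riccatiGain B C D R P *ᵥ u) (by linarith)
  have hK : riccatiGain B C D R P *ᵥ u = 0 := by
    by_contra hne
    have := hR.dotProduct_mulVec_pos hne
    rw [hRK, dotProduct_zero] at this
    exact lt_irrefl _ this
  have hPC := h.1.mulVec_eq_zero (u := (C + D * riccatiGain B C D R P) *ᵥ u) (by linarith)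
  rw [closedLoop_diffusion_mulVec hK] at hPC
  refine ⟨hQu, hK, hPC, ?_⟩
  have h2 := congrArg (fun M => M *ᵥ u) (h.lyapunov_eq hR)
  simp only [lyapunov, add_mulVec, sub_mulVec, zero_mulVec, Matrix.mul_assoc, ← mulVec_mulVec, hu,
    hQu, hK, hPC, mulVec_zero, smul_mulVec, smul_zero,
    zero_add, add_zero, sub_zero] at h2
  rw [discountedMatrix, closedLoopMatrix_eq, sub_mulVec, smul_mulVec, one_mulVec, mulVec_sub,
    mulVec_smul, hu, smul_zero, sub_zero, add_mulVec, ← mulVec_mulVec, hK, mulVec_zero, add_zero]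
  exact h2

theorem reVec_smul (z : ℂ) {ι : Type*} (v : ι → ℂ) :
    reVec (z • v) = z.re • reVec v + z.im • reVec (Complex.I • v) := by
  ext i
  simp [reVec]
  ring

theorem ext_reVec {ι : Type*} {v w : ι → ℂ} (h : reVec v = reVec w)
    (h' : reVec (Complex.I • v) = reVec (Complex.I • w)) : v = w := by
  ext i
  refine Complex.ext (congrFun h i) ?_
  have := congrFun h' i
  simpa [reVec] using this

variable {Ω : Type*} {m : MeasurableSpace Ω} {μ : Measure Ω} [IsProbabilityMeasure μ]
  {ℱ : Filtration ℝ≥0 m} {W : ℝ≥0 → Ω → ℝ}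

/-- The discounted closed loop matrix of a Riccati solution is stable: an eigenvector for an
eigenvalue in the closed right half plane would, together with the kernel of `P`, span an invariant
subspace on which the state is not observed, and along it the mean of the state would not tend to
zero. -/
theorem IsRiccatiSolution.re_lt_zero (h : IsRiccatiSolution ρ A B C D Q R P)
    (hR : R.PosDef) (hQ : Q.PosSemidef) (hW : IsFilteredBrownian μ ℱ W)
    (hdet : IsExactlyDetectable μ ℱ W
      (A - (ρ / 2) • (1 : Matrix (Fin n) (Fin n) ℝ)) C (CFC.sqrt Q)) {z : ℂ}
    (hz : Module.End.HasEigenvalue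
      (toLin' ((discountedMatrix ρ A B C D R P).map (algebraMap ℝ ℂ))) z) : z.re < 0 := by
  by_contra! hre
  obtain ⟨v, hv⟩ := hz.exists_hasEigenvector
  have hv0 := hv.2
  have hFv : (discountedMatrix ρ A B C D R P).map (algebraMap ℝ ℂ) *ᵥ v = z • v := by
    simpa using hv.apply_eq_smul
  set F := discountedMatrix ρ A B C D R P with hF
  set K := riccatiGain B C D R P with hK
  set a := reVec v with ha
  set b := reVec (Complex.I • v) with hb
  have hFa : F *ᵥ a = z.re • a + z.im • b := by
    rw [ha, ← reVec_map_mulVec, hFv, reVec_smul]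
  have hFb : F *ᵥ b = z.re • b - z.im • a := by
    rw [hb, ← reVec_map_mulVec, mulVec_smul, hFv, smul_comm, reVec_smul, smul_smul, Complex.I_mul_I,
      neg_one_smul, map_neg, smul_neg, sub_eq_add_neg]
  -- The Lyapunov equation at the real and imaginary part of the eigenvector. In the sum of the
  -- two the terms with `z.im` cancel, and all remaining terms are nonnegative.
  have ea := h.dotProduct_eq_zero hR a
  have eb := h.dotProduct_eq_zero hR b
  have hPt := transpose_eq_of_isHermitian h.1.isHermitian
  have hcross : P *ᵥ a ⬝ᵥ b = P *ᵥ b ⬝ᵥ a := by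
    rw [dotProduct_comm (P *ᵥ b), dotProduct_mulVec, ← mulVec_transpose, hPt]
  rw [← hF, hFa, dotProduct_add, dotProduct_smul, dotProduct_smul, smul_eq_mul, smul_eq_mul] at ea
  rw [← hF, hFb, dotProduct_sub, dotProduct_smul, dotProduct_smul, smul_eq_mul, smul_eq_mul] at eb
  have na := mul_nonneg hre (h.1.dotProduct_nonneg a)
  have nb := mul_nonneg hre (h.1.dotProduct_nonneg b)
  rw [dotProduct_comm] at na nb
  have n1a := h.1.dotProduct_nonneg ((C + D * K) *ᵥ a)
  have n2a := hQ.dotProduct_nonneg a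
  have n3a := hR.posSemidef.dotProduct_nonneg (K *ᵥ a)
  have n1b := h.1.dotProduct_nonneg ((C + D * K) *ᵥ b)
  have n2b := hQ.dotProduct_nonneg b
  have n3b := hR.posSemidef.dotProduct_nonneg (K *ᵥ b)
  rw [hcross] at ea
  have hpos : ∀ u, u ⬝ᵥ R *ᵥ u = 0 → u = 0 := fun u hu => by
    by_contra hne
    have := hR.dotProduct_mulVec_pos hne
    rw [star_trivial, hu] at this
    exact lt_irrefl _ this
  have hQa := hQ.mulVec_eq_zero (u := a) (by linarith)
  have hQb := hQ.mulVec_eq_zero (u := b) (by linarith)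
  have hKa : K *ᵥ a = 0 := hpos _ (by linarith)
  have hKb : K *ᵥ b = 0 := hpos _ (by linarith)
  have hCa := h.1.mulVec_eq_zero (u := (C + D * K) *ᵥ a) (by linarith)
  have hCb := h.1.mulVec_eq_zero (u := (C + D * K) *ᵥ b) (by linarith)
  rw [closedLoop_diffusion_mulVec hKa] at hCa
  rw [closedLoop_diffusion_mulVec hKb] at hCb
  have hAa := discountedMatrix_mulVec (ρ := ρ) (A := A) hKa
  have hAb := discountedMatrix_mulVec (ρ := ρ) (A := A) hKb
  rw [← hF] at hAa hAb
  set A' := A - (ρ / 2) • (1 : Matrix (Fin n) (Fin n) ℝ) with hA'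
  set V : Submodule ℝ (Fin n → ℝ) := LinearMap.ker (toLin' P) ⊔ Submodule.span ℝ {a, b} with hV
  have haV : a ∈ V := Submodule.mem_sup_right (Submodule.subset_span (by simp))
  have hbV : b ∈ V := Submodule.mem_sup_right (Submodule.subset_span (by simp))
  have hker : ∀ u, P *ᵥ u = 0 → u ∈ V := fun u hu =>
    Submodule.mem_sup_left (by simpa using hu)
  -- Properties of vectors in `V` are checked on the kernel and on the two generators.
  have hVle : ∀ (U : Submodule ℝ (Fin n → ℝ)), (∀ u, P *ᵥ u = 0 → u ∈ U) → a ∈ U → b ∈ U →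
      ∀ u ∈ V, u ∈ U := fun U hU haU hbU u hu => by
    refine (sup_le (fun w hw => hU w (by simpa using hw)) (Submodule.span_le.2 ?_) : V ≤ U) hu
    rintro w (rfl | rfl)
    · exact haU
    · exact hbU
  have hVA : ∀ u ∈ V, A' *ᵥ u ∈ V := hVle (V.comap (toLin' A'))
    (fun u hu => by
      obtain ⟨-, h2, -, h4⟩ := h.mulVec_eq_zero hR hQ hu
      rw [Submodule.mem_comap, toLin'_apply, hA', discountedMatrix_mulVec h2]
      exact hker _ h4)
    (by
      rw [Submodule.mem_comap, toLin'_apply, hAa, hFa]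
      exact add_mem (V.smul_mem _ haV) (V.smul_mem _ hbV))
    (by
      rw [Submodule.mem_comap, toLin'_apply, hAb, hFb]
      exact sub_mem (V.smul_mem _ hbV) (V.smul_mem _ haV))
  have hVC : ∀ u ∈ V, C *ᵥ u ∈ V := hVle (V.comap (toLin' C))
    (fun u hu => hker _ (h.mulVec_eq_zero hR hQ hu).2.2.1) (hker _ hCa) (hker _ hCb)
  have hVQ : ∀ u ∈ V, CFC.sqrt Q *ᵥ u = 0 := fun u hu => mulVec_sqrt_eq_zero hQ (by
    have := hVle (LinearMap.ker (toLin' Q)) (fun u hu => by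
      simpa using (h.mulVec_eq_zero hR hQ hu).1) (by simpa using hQa) (by simpa using hQb) u hu
    simpa using this)
  have hAv : A'.map (algebraMap ℝ ℂ) *ᵥ v = z • v := by
    rw [← hFv]
    refine ext_reVec ?_ ?_
    · rw [reVec_map_mulVec, reVec_map_mulVec, ← ha, hAa]
    · rw [← mulVec_smul, ← mulVec_smul, reVec_map_mulVec, reVec_map_mulVec, ← hb, hAb]
  -- Along `V` the uncontrolled mean has the solution `e^{z t} v`, which does not decay.
  have hflow : ∀ c : ℂ, ∀ t : ℝ, A'.flow t (reVec (c • v)) = reVec (Complex.exp (t * z) • c • v) := by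
    intro c t
    have h1 : ((A'.map (algebraMap ℝ ℂ) - z • 1) ^ 1) *ᵥ (c • v) = 0 := by
      rw [pow_one, mulVec_smul, sub_mulVec, hAv, smul_mulVec, one_mulVec, sub_self, smul_zero]
    rw [← map_flow reVec (fun j => reVec_map_pow_mulVec A' (c • v) j) t,
      flow_eq_of_pow_mulVec_eq_zero h1]
    simp
  obtain ⟨i, hi⟩ : ∃ i, v i ≠ 0 := by
    by_contra! hcon
    exact hv0 (funext hcon)
  have hla := (tendsto_pi_nhds.1 (hdet.tendsto_flow hW hVA hVC hVQ haV)) i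
  have hlb := (tendsto_pi_nhds.1 (hdet.tendsto_flow hW hVA hVC hVQ hbV)) i
  have hnorm : Tendsto (fun t : ℝ≥0 => ‖Complex.exp (t * z) * v i‖ ^ 2) atTop (𝓝 0) := by
    have h1 := (hla.pow 2).add (hlb.pow 2)
    simp only [Pi.zero_apply, ne_eq, OfNat.ofNat_ne_zero, not_false_eq_true, zero_pow,
      add_zero] at h1
    refine h1.congr fun t => ?_
    have e1 := congrFun (hflow 1 t) i
    have e2 := congrFun (hflow Complex.I t) i
    rw [one_smul, ← ha] at e1
    rw [← hb] at e2
    rw [e1, e2, Complex.sq_norm, Complex.normSq_apply]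
    simp [reVec]
    ring
  have hle : ‖v i‖ ^ 2 ≤ 0 := by
    refine ge_of_tendsto hnorm (Eventually.of_forall fun t => ?_)
    rw [norm_mul, Complex.norm_exp]
    refine pow_le_pow_left₀ (norm_nonneg _) (le_mul_of_one_le_left (norm_nonneg _) ?_) 2
    refine Real.one_le_exp ?_
    simpa using mul_nonneg t.coe_nonneg hre
  have : 0 < ‖v i‖ ^ 2 := by positivity
  linarith

end ClosedLoop

/-! ### Lyapunov equations of mean-square stable systems -/

section LyapunovEquation

variable {Ω : Type*} {m : MeasurableSpace Ω} {μ : Measure Ω} [IsProbabilityMeasure μ]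
  {ℱ : Filtration ℝ≥0 m} {W : ℝ≥0 → Ω → ℝ}

/-- Tonelli for the discounted energy on a bounded time interval. -/
theorem lintegral_discounted_le {E : Type*} [NormedAddCommGroup E]
    [InnerProductSpace ℝ E] {x : ℝ≥0 → Ω → E} (hx : IsStronglyProgressive ℱ x) (ρ : ℝ) (T : ℝ≥0) :
    ∫⁻ t in Icc (0 : ℝ) T, ENNReal.ofReal (Real.exp (-ρ * t)) * ∫⁻ ω, ‖x t.toNNReal ω‖ₑ ^ 2 ∂μ
      ≤ ∫⁻ ω, ∫⁻ t in Ici (0 : ℝ),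
          ENNReal.ofReal (Real.exp (-ρ * t)) * ‖x t.toNNReal ω‖ₑ ^ 2 ∂volume ∂μ := by
  have hm : AEMeasurable (fun p : Ω × ℝ =>
      ENNReal.ofReal (Real.exp (-ρ * p.2)) * ‖onPaths x p‖ₑ ^ 2) (pathMeasure μ T) := by
    refine AEMeasurable.mul ?_ ((aestronglyMeasurable_onPaths hx T).enorm.pow_const 2)
    exact Measurable.aemeasurable (by fun_prop)
  simp_rw [← lintegral_const_mul' _ _ ENNReal.ofReal_ne_top]
  rw [← lintegral_lintegral_swap (f := fun ω t =>
    ENNReal.ofReal (Real.exp (-ρ * t)) * ‖x t.toNNReal ω‖ₑ ^ 2) hm]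
  exact lintegral_mono fun ω => lintegral_mono_set Icc_subset_Ici_self

/-- If the discounted second moment of the solution is integrable in time, then a quadratic form
which does not increase along the solution is nonnegative at the initial state: otherwise it would
stay below a negative constant. -/
theorem IsSDESolution.inner_nonneg_of_discounted {E : Type*} [NormedAddCommGroup E]
    [InnerProductSpace ℝ E] [CompleteSpace E] {a c : E →L[ℝ] E} {x₀ : E} {x : ℝ≥0 → Ω → E}
    (hx : IsSDESolution μ ℱ W a c x₀ x) (hW : IsFilteredBrownian μ ℱ W) {G H : E →L[ℝ] E}
    (hG : ∀ u v, inner ℝ (G u) v = inner ℝ u (G v))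
    (hH : ∀ u v, inner ℝ (H u) v = inner ℝ u (H v))
    (h : ∀ u, inner ℝ (H u) u = 2 * inner ℝ (G (a u)) u + inner ℝ (G (c u)) (c u))
    {ρ : ℝ} (hle : ∀ u, inner ℝ (H u) u ≤ ρ * inner ℝ (G u) u)
    (hfin : ∫⁻ ω, ∫⁻ t in Ici (0 : ℝ),
      ENNReal.ofReal (Real.exp (-ρ * t)) * ‖x t.toNNReal ω‖ₑ ^ 2 ∂volume ∂μ < ∞) :
    0 ≤ inner ℝ (G x₀) x₀ := by
  set g : ℝ → ℝ := fun t => ∫ ω, inner ℝ (G (x t.toNNReal ω)) (x t.toNNReal ω) ∂μ with hg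
  set k : ℝ → ℝ := fun t => ∫ ω, inner ℝ (H (x t.toNNReal ω)) (x t.toNNReal ω) ∂μ with hk
  have hi : ∀ (L : E →L[ℝ] E) (t : ℝ),
      Integrable (fun ω => inner ℝ (L (x t.toNNReal ω)) (x t.toNNReal ω)) μ := fun L t =>
    integrable_inner_of_memLp (L.comp_memLp' (hx.memLp hW _)) (hx.memLp hW _)
  have hd : ∀ t ∈ Ici (0 : ℝ), HasDerivWithinAt (fun t => Real.exp (-ρ * t) * g t)
      (Real.exp (-ρ * t) * (-ρ * 1) * g t + Real.exp (-ρ * t) * k t) (Ici 0) t := fun t ht =>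
    (((hasDerivAt_id t).const_mul (-ρ)).exp.hasDerivWithinAt).mul
      (hx.hasDerivWithinAt_integral_inner hW hG hH h ht)
  have hkg : ∀ t, k t ≤ ρ * g t := fun t => by
    rw [hg, hk, ← integral_const_mul]
    exact integral_mono (hi H t) ((hi G t).const_mul ρ) fun ω => hle _
  have hanti : AntitoneOn (fun t => Real.exp (-ρ * t) * g t) (Ici 0) := by
    refine antitoneOn_of_hasDerivWithinAt_nonpos (convex_Ici 0)
      (f' := fun t => Real.exp (-ρ * t) * (-ρ * 1) * g t + Real.exp (-ρ * t) * k t)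
      (fun t ht => (hd t ht).continuousWithinAt)
      (fun t ht => (hd t (interior_subset ht)).mono interior_subset) fun t _ => ?_
    have := mul_le_mul_of_nonneg_left (hkg t) (Real.exp_pos (-ρ * t)).le
    linarith
  have h0 : g 0 = inner ℝ (G x₀) x₀ := by
    have : (fun ω => inner ℝ (G (x (0 : ℝ).toNNReal ω)) (x (0 : ℝ).toNNReal ω))
        =ᵐ[μ] fun _ => inner ℝ (G x₀) x₀ := by
      filter_upwards [hx.initial] with ω hω
      rw [Real.toNNReal_zero, hω]
    rw [hg]
    simp only
    rw [integral_congr_ae this]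
    simp
  rw [← h0]
  by_contra! hneg
  -- A negative initial value is a uniform lower bound for the discounted second moment.
  have hlow : ∀ t ∈ Ici (0 : ℝ), ENNReal.ofReal (-g 0)
      ≤ ‖G‖ₑ * (ENNReal.ofReal (Real.exp (-ρ * t)) * ∫⁻ ω, ‖x t.toNNReal ω‖ₑ ^ 2 ∂μ) := by
    intro t ht
    have h1 : Real.exp (-ρ * t) * g t ≤ g 0 := by
      simpa using hanti self_mem_Ici ht ht
    have h2 : -g t ≤ ‖G‖ * ∫ ω, ‖x t.toNNReal ω‖ ^ 2 ∂μ := by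
      rw [hg, ← integral_neg, ← integral_const_mul]
      refine integral_mono (hi G t).neg
        (((memLp_two_iff_integrable_sq_norm (hx.memLp hW _).1).1 (hx.memLp hW _)).const_mul _)
        fun ω => ?_
      refine (neg_le_abs _).trans ((abs_real_inner_le_norm _ _).trans ?_)
      calc _ ≤ ‖G‖ * ‖x t.toNNReal ω‖ * ‖x t.toNNReal ω‖ := by gcongr; exact G.le_opNorm _
        _ = _ := by ring
    rw [lintegral_enorm_sq_eq_ofReal (hx.memLp hW _), ← ofReal_norm,
      ← ENNReal.ofReal_mul (Real.exp_pos _).le, ← ENNReal.ofReal_mul (norm_nonneg _)]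
    refine ENNReal.ofReal_le_ofReal ?_
    have := mul_le_mul_of_nonneg_left h2 (Real.exp_pos (-ρ * t)).le
    linarith
  have hT : ∀ N : ℕ, (N : ℝ≥0∞) * ENNReal.ofReal (-g 0) ≤ ‖G‖ₑ * ∫⁻ ω, ∫⁻ t in Ici (0 : ℝ),
      ENNReal.ofReal (Real.exp (-ρ * t)) * ‖x t.toNNReal ω‖ₑ ^ 2 ∂volume ∂μ := by
    intro N
    calc (N : ℝ≥0∞) * ENNReal.ofReal (-g 0)
        = ∫⁻ _ in Icc (0 : ℝ) (N : ℝ≥0), ENNReal.ofReal (-g 0) := by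
          simp [mul_comm]
      _ ≤ ∫⁻ t in Icc (0 : ℝ) (N : ℝ≥0),
          ‖G‖ₑ * (ENNReal.ofReal (Real.exp (-ρ * t)) * ∫⁻ ω, ‖x t.toNNReal ω‖ₑ ^ 2 ∂μ) :=
          setLIntegral_mono' measurableSet_Icc fun t ht => hlow t ht.1
      _ ≤ _ := by
          rw [lintegral_const_mul' _ _ enorm_ne_top]
          gcongr
          exact lintegral_discounted_le hx.progressive ρ _
  obtain ⟨N, hN⟩ := ENNReal.exists_nat_mul_gt (a := ENNReal.ofReal (-g 0))
    (ENNReal.ofReal_pos.2 (neg_pos.2 hneg)).ne' (ENNReal.mul_lt_top (enorm_lt_top (x := G)) hfin).ne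
  exact absurd (hT N) (not_le.2 hN)

open Matrix

variable {n : ℕ} {ρ : ℝ} {A C : Matrix (Fin n) (Fin n) ℝ}

theorem inner_act (S : Matrix (Fin n) (Fin n) ℝ) (u v : EuclideanSpace ℝ (Fin n)) :
    inner ℝ (act S u) v = v.ofLp ⬝ᵥ S *ᵥ u.ofLp := by
  rw [EuclideanSpace.inner_eq_star_dotProduct, star_trivial]
  rfl

theorem inner_act_comm {S : Matrix (Fin n) (Fin n) ℝ} (hS : Sᵀ = S)
    (u v : EuclideanSpace ℝ (Fin n)) : inner ℝ (act S u) v = inner ℝ u (act S v) := by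
  rw [inner_act, real_inner_comm, inner_act, dotProduct_mulVec, ← mulVec_transpose, hS,
    dotProduct_comm]

theorem transpose_lyapunov {S : Matrix (Fin n) (Fin n) ℝ} (hS : Sᵀ = S) :
    (lyapunov ρ A C S)ᵀ = lyapunov ρ A C S := by
  simp only [lyapunov, transpose_sub, transpose_add, transpose_mul, transpose_smul,
    transpose_transpose, hS, Matrix.mul_assoc]
  abel

/-- The energy `E ∫₀^∞ e^{-ρt} ‖x(t)‖² dt` is finite for suitable solutions of
`dx = A x dt + C x dW` with arbitrary initial states. -/
def IsRhoStable (μ : Measure Ω) (ℱ : Filtration ℝ≥0 m) (W : ℝ≥0 → Ω → ℝ) (ρ : ℝ)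
    (A C : Matrix (Fin n) (Fin n) ℝ) : Prop :=
  ∀ x₀ : EuclideanSpace ℝ (Fin n), ∃ x : ℝ≥0 → Ω → EuclideanSpace ℝ (Fin n),
    IsLinearSDESolution μ ℱ W A C x₀ x ∧
    ∫⁻ ω, ∫⁻ t in Ici (0 : ℝ),
      ENNReal.ofReal (Real.exp (-ρ * t)) * ‖x t.toNNReal ω‖ₑ ^ 2 ∂volume ∂μ < ∞

/-- A supersolution of the homogeneous Lyapunov equation of a stable system is nonnegative. -/
theorem IsRhoStable.posSemidef (h : IsRhoStable μ ℱ W ρ A C) (hW : IsFilteredBrownian μ ℱ W)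
    {S : Matrix (Fin n) (Fin n) ℝ} (hS : Sᵀ = S) (hL : (-lyapunov ρ A C S).PosSemidef) :
    S.PosSemidef := by
  refine .of_dotProduct_mulVec_nonneg (by simpa [IsHermitian] using hS) fun v => ?_
  obtain ⟨x, hx, hfin⟩ := h (WithLp.toLp 2 v)
  have h1 := (isLinearSDESolution_iff.1 hx).inner_nonneg_of_discounted hW (G := act S)
    (H := act (lyapunov 0 A C S)) (inner_act_comm hS) (inner_act_comm (transpose_lyapunov hS))
    (fun u => ?_) (ρ := ρ) (fun u => ?_) hfin
  · rw [inner_act] at h1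
    simpa using h1
  · rw [inner_act, dotProduct_lyapunov_mulVec hS, inner_act, inner_act, zero_mul, sub_zero,
      dotProduct_mulVec u.ofLp, ← mulVec_transpose, hS]
    rfl
  · have h2 := hL.dotProduct_nonneg u.ofLp
    rw [neg_mulVec, dotProduct_neg, dotProduct_lyapunov_mulVec hS] at h2
    rw [inner_act, inner_act, dotProduct_lyapunov_mulVec hS, zero_mul]
    linarith

/-- The Lyapunov operator on symmetric matrices. -/
def symmLyapunov (ρ : ℝ) (A C : Matrix (Fin n) (Fin n) ℝ) :
    selfAdjoint.submodule ℝ (Matrix (Fin n) (Fin n) ℝ) →ₗ[ℝ]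
      selfAdjoint.submodule ℝ (Matrix (Fin n) (Fin n) ℝ) where
  toFun S := ⟨lyapunov ρ A C S, transpose_lyapunov (transpose_eq_of_isHermitian S.2)⟩
  map_add' S T := by
    ext1
    simp only [lyapunov, Submodule.coe_add, Matrix.mul_add, Matrix.add_mul, smul_add]
    abel
  map_smul' c S := by
    ext1
    simp only [lyapunov, Submodule.coe_smul, Matrix.mul_smul, Matrix.smul_mul, smul_sub, smul_add,
      RingHom.id_apply, smul_comm c ρ]

/-- Lyapunov equations of mean-square stable systems are solvable: on symmetric matrices the
Lyapunov operator is injective, hence surjective, and its inverse is negative. -/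
theorem IsRhoStable.exists_lyapunov_eq (h : IsRhoStable μ ℱ W ρ A C)
    (hW : IsFilteredBrownian μ ℱ W) {G : Matrix (Fin n) (Fin n) ℝ} (hG : G.PosSemidef) :
    ∃ S : Matrix (Fin n) (Fin n) ℝ, S.PosSemidef ∧ lyapunov ρ A C S + G = 0 := by
  have hinj : Function.Injective (symmLyapunov ρ A C) := by
    refine (injective_iff_map_eq_zero _).2 fun S hS => ?_
    have hS0 : lyapunov ρ A C S = 0 := congrArg Subtype.val hS
    have hSt : (S : Matrix (Fin n) (Fin n) ℝ)ᵀ = S := transpose_eq_of_isHermitian S.2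
    have h1 := h.posSemidef hW hSt (by rw [hS0, neg_zero]; exact .zero)
    have h2 := h.posSemidef hW (S := -(S : Matrix (Fin n) (Fin n) ℝ)) (by rw [transpose_neg, hSt])
      (by
        have : lyapunov ρ A C (-(S : Matrix (Fin n) (Fin n) ℝ)) = 0 := by
          have := congrArg Subtype.val (map_neg (symmLyapunov ρ A C) S)
          rw [hS, neg_zero] at this
          exact this
        rw [this, neg_zero]; exact .zero)
    ext1
    exact le_antisymm (by simpa using h2.nonneg) h1.nonneg
  obtain ⟨S, hS⟩ := LinearMap.injective_iff_surjective.1 hinj ⟨-G, hG.isHermitian.neg⟩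
  have hS' : lyapunov ρ A C S = -G := congrArg Subtype.val hS
  exact ⟨S, h.posSemidef hW (transpose_eq_of_isHermitian S.2) (by rwa [hS', neg_neg]),
    by rw [hS', neg_add_cancel]⟩

end LyapunovEquation

/-! ### Existence of a Riccati solution -/

section RiccatiExistence

open Matrix

variable {n r : ℕ} {ρ : ℝ} {A : Matrix (Fin n) (Fin n) ℝ} {B : Matrix (Fin n) (Fin r) ℝ}
  {C : Matrix (Fin n) (Fin n) ℝ} {D : Matrix (Fin n) (Fin r) ℝ}
  {Q : Matrix (Fin n) (Fin n) ℝ} {R : Matrix (Fin r) (Fin r) ℝ} {P : Matrix (Fin n) (Fin n) ℝ}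

/-- The Cayley transform of the Lyapunov operator. -/
theorem two_mul_smul_lyapunov (γ : ℝ) (X : Matrix (Fin n) (Fin n) ℝ) :
    (2 * γ) • lyapunov ρ A C X
      = (γ • 1 + (A - (ρ / 2) • 1))ᵀ * X * (γ • 1 + (A - (ρ / 2) • 1)) + (2 * γ) • (Cᵀ * X * C)
        - (γ • 1 - (A - (ρ / 2) • 1))ᵀ * X * (γ • 1 - (A - (ρ / 2) • 1)) := by
  simp only [lyapunov, transpose_add, transpose_sub, transpose_smul, transpose_one, Matrix.add_mul,
    Matrix.mul_add, Matrix.sub_mul, Matrix.mul_sub, Matrix.smul_mul, Matrix.mul_smul,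
    Matrix.one_mul, Matrix.mul_one, smul_add, smul_sub, smul_smul]
  module

theorem exists_pos_isUnit_smul_one_sub (F : Matrix (Fin n) (Fin n) ℝ) :
    ∃ γ : ℝ, 0 < γ ∧ IsUnit (γ • 1 - F) := by
  obtain ⟨γ, hγ, hs⟩ := (Ioi_infinite (0 : ℝ)).exists_notMem_finite (Matrix.finite_real_spectrum (A := F))
  refine ⟨γ, hγ, ?_⟩
  rw [spectrum.notMem_iff, Algebra.algebraMap_eq_smul_one] at hs
  exact hs

/-- A supersolution of a Lyapunov equation which is not a solution can be decreased. The Cayley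
transform turns the equation into a fixed point equation for a monotone map, and the smaller
supersolution is the image of the given one. -/
theorem exists_smaller_lyapunov_supersolution {G : Matrix (Fin n) (Fin n) ℝ} (hG : G.PosSemidef)
    (hP : P.PosSemidef) (hL : (-(lyapunov ρ A C P + G)).PosSemidef) :
    ∃ P' : Matrix (Fin n) (Fin n) ℝ, P'.PosSemidef ∧ (P - P').PosSemidef ∧
      (-(lyapunov ρ A C P' + G)).PosSemidef ∧ (P' = P → lyapunov ρ A C P + G = 0) := by
  obtain ⟨γ, hγ, hu⟩ := exists_pos_isUnit_smul_one_sub (A - (ρ / 2) • 1)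
  have hγ2 : 0 ≤ 2 * γ := by positivity
  have hlyap := fun X => two_mul_smul_lyapunov (ρ := ρ) (A := A) (C := C) γ X
  set M := γ • 1 - (A - (ρ / 2) • 1) with hM
  set N := γ • 1 + (A - (ρ / 2) • 1) with hN
  have hd := (isUnit_iff_isUnit_det _).1 hu
  have hMi : M⁻¹ * M = 1 := nonsing_inv_mul _ hd
  have hMit : Mᵀ * (M⁻¹)ᵀ = 1 := by rw [← transpose_mul, hMi, transpose_one]
  have hMi' : M * M⁻¹ = 1 := mul_nonsing_inv _ hd
  have hMit' : (M⁻¹)ᵀ * Mᵀ = 1 := by rw [← transpose_mul, hMi', transpose_one]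
  set P' := (M⁻¹)ᵀ * (Nᵀ * P * N + (2 * γ) • (Cᵀ * P * C + G)) * M⁻¹ with hP'
  have hMP' : Mᵀ * P' * M = Nᵀ * P * N + (2 * γ) • (Cᵀ * P * C + G) := by
    rw [hP', ← Matrix.mul_assoc, ← Matrix.mul_assoc, hMit, Matrix.one_mul, Matrix.mul_assoc, hMi,
      Matrix.mul_one]
  have hdiff : Mᵀ * (P - P') * M = (2 * γ) • (-(lyapunov ρ A C P + G)) := by
    rw [Matrix.mul_sub Mᵀ, Matrix.sub_mul _ _ M, hMP', smul_neg, smul_add _ (lyapunov ρ A C P), hlyap, smul_add]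
    abel
  have hPP' : P - P' = (M⁻¹)ᵀ * ((2 * γ) • (-(lyapunov ρ A C P + G))) * M⁻¹ := by
    rw [← hdiff, ← Matrix.mul_assoc, ← Matrix.mul_assoc, hMit', Matrix.one_mul, Matrix.mul_assoc,
      hMi', Matrix.mul_one]
  have hpos : (P - P').PosSemidef := by
    rw [hPP']
    exact (hL.smul hγ2).conjTranspose_mul_mul_same M⁻¹
  refine ⟨P', ?_, hpos, ?_, fun h => ?_⟩
  · refine PosSemidef.conjTranspose_mul_mul_same ?_ M⁻¹
    exact (hP.conjTranspose_mul_mul_same N).add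
      (((hP.conjTranspose_mul_mul_same C).add hG).smul hγ2)
  · have e : (2 * γ) • (-(lyapunov ρ A C P' + G))
        = Nᵀ * (P - P') * N + (2 * γ) • (Cᵀ * (P - P') * C) := by
      rw [smul_neg, smul_add, hlyap, hMP']
      simp only [Matrix.mul_sub, Matrix.sub_mul, smul_sub, smul_add]
      abel
    have h1 : ((2 * γ) • (-(lyapunov ρ A C P' + G))).PosSemidef := by
      rw [e]
      exact (hpos.conjTranspose_mul_mul_same N).add
        ((hpos.conjTranspose_mul_mul_same C).smul hγ2)
    have h2 := h1.smul (inv_nonneg.2 hγ2)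
    rwa [smul_smul, inv_mul_cancel₀ (by positivity), one_smul] at h2
  · rw [h, sub_self, Matrix.mul_zero, Matrix.zero_mul, eq_comm, smul_eq_zero] at hdiff
    exact neg_eq_zero.1 (hdiff.resolve_left (by positivity))

/-- A supersolution of the Lyapunov equation of some feedback is a supersolution of the Riccati
equation. -/
theorem neg_riccatiResidual_posSemidef (hR : R.PosDef) (hP : P.PosSemidef)
    {K : Matrix (Fin r) (Fin n) ℝ}
    (h : (-(lyapunov ρ (A + B * K) (C + D * K) P + (Q + Kᵀ * R * K))).PosSemidef) :
    (-riccatiResidual ρ A B C D Q R P).PosSemidef := by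
  have h1 := h.add ((posDef_add_transpose_mul_mul hR hP D).posSemidef.conjTranspose_mul_mul_same
    (K - riccatiGain B C D R P))
  rw [lyapunov_add_eq_riccatiResidual_add hR hP K] at h1
  convert h1 using 1
  rw [conjTranspose_eq_transpose_of_trivial]
  abel

/-- A positive semidefinite supersolution of the Riccati equation which is not a solution can be
decreased. -/
theorem exists_smaller_riccati_supersolution (hR : R.PosDef) (hQ : Q.PosSemidef)
    (hP : P.PosSemidef) (hres : (-riccatiResidual ρ A B C D Q R P).PosSemidef) :
    ∃ P' : Matrix (Fin n) (Fin n) ℝ, P'.PosSemidef ∧ (P - P').PosSemidef ∧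
      (-riccatiResidual ρ A B C D Q R P').PosSemidef ∧
      (P' = P → riccatiResidual ρ A B C D Q R P = 0) := by
  set K := riccatiGain B C D R P with hK
  have hG : (Q + Kᵀ * R * K).PosSemidef :=
    hQ.add (hR.posSemidef.conjTranspose_mul_mul_same K)
  have e : lyapunov ρ (A + B * K) (C + D * K) P + (Q + Kᵀ * R * K)
      = riccatiResidual ρ A B C D Q R P := by
    rw [lyapunov_add_eq_riccatiResidual_add hR hP K, ← hK, sub_self, Matrix.mul_zero, add_zero]
  obtain ⟨P', h1, h2, h3, h4⟩ := exists_smaller_lyapunov_supersolution hG hP (by rwa [e])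
  rw [e] at h4
  exact ⟨P', h1, h2, neg_riccatiResidual_posSemidef hR h1 h3, h4⟩

theorem isClosed_setOf_posSemidef {ι : Type*} [Fintype ι] :
    IsClosed {M : Matrix ι ι ℝ | M.PosSemidef} := by
  have h : {M : Matrix ι ι ℝ | M.PosSemidef}
      = {M | Mᵀ = M} ∩ ⋂ u : ι → ℝ, {M | 0 ≤ u ⬝ᵥ M *ᵥ u} := by
    ext M
    simp only [mem_inter_iff, mem_iInter, mem_ofPred_eq]
    exact ⟨fun h => ⟨transpose_eq_of_isHermitian h.isHermitian, h.dotProduct_nonneg⟩,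
      fun h => .of_dotProduct_mulVec_nonneg (by simpa [IsHermitian] using h.1)
        fun u => by simpa using h.2 u⟩
  rw [h]
  refine (isClosed_eq (by fun_prop) continuous_id).inter (isClosed_iInter fun u => ?_)
  exact isClosed_le continuous_const (by fun_prop)

/-- Test the quadratic form with the sum and the difference of two basis vectors. -/
theorem Matrix.PosSemidef.abs_apply_le_trace {ι : Type*} [Fintype ι] [DecidableEq ι]
    {M : Matrix ι ι ℝ} (hM : M.PosSemidef) (i j : ι) : |M i j| ≤ M.trace := by
  have hd : ∀ k, 0 ≤ M k k := fun k => by simpa using hM.dotProduct_nonneg (Pi.single k 1)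
  have ht : ∀ k, M k k ≤ M.trace := fun k =>
    Finset.single_le_sum (f := fun k => M k k) (fun k _ => hd k) (Finset.mem_univ k)
  have hs : M j i = M i j := congrFun (congrFun (transpose_eq_of_isHermitian hM.isHermitian) i) j
  have h1 := hM.dotProduct_nonneg (Pi.single i 1 + Pi.single j 1)
  have h2 := hM.dotProduct_nonneg (Pi.single i 1 - Pi.single j 1)
  simp [mulVec_add, mulVec_sub, hs] at h1 h2
  rw [abs_le]
  constructor <;> linarith [ht i, ht j]

theorem isCompact_setOf_posSemidef_trace_le (c : ℝ) :
    IsCompact {M : Matrix (Fin n) (Fin n) ℝ | M.PosSemidef ∧ M.trace ≤ c} := by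
  have hc : IsCompact (univ.pi fun _ : Fin n => univ.pi fun _ : Fin n => Icc (-c) c) :=
    isCompact_univ_pi fun _ => isCompact_univ_pi fun _ => isCompact_Icc
  refine IsCompact.of_isClosed_subset (X := Matrix (Fin n) (Fin n) ℝ) hc
    (isClosed_setOf_posSemidef.inter (isClosed_le continuous_id.matrix_trace continuous_const)) ?_
  rintro M ⟨hM, ht⟩ i - j -
  exact abs_le.1 ((hM.abs_apply_le_trace i j).trans ht)

theorem continuousOn_riccatiResidual (hR : R.PosDef) :
    ContinuousOn (riccatiResidual ρ A B C D Q R) {P | P.PosSemidef} := by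
  intro P hP
  have hinv : ContinuousAt (fun X : Matrix (Fin n) (Fin n) ℝ => (R + Dᵀ * X * D)⁻¹) P := by
    obtain ⟨u, hu⟩ := (posDef_add_transpose_mul_mul hR hP D).isUnit
    have h1 := NormedRing.inverse_continuousAt u
    rw [hu] at h1
    simp only [nonsing_inv_eq_ringInverse]
    exact ContinuousAt.comp (f := fun X : Matrix (Fin n) (Fin n) ℝ => R + Dᵀ * X * D) h1
      (by fun_prop)
  refine ContinuousAt.continuousWithinAt ?_
  unfold riccatiResidual
  fun_prop

/-- If the Riccati equation has a positive semidefinite supersolution, then a supersolution of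
minimal trace exists by compactness, and it cannot be decreased. -/
theorem exists_isRiccatiSolution_of_supersolution (hR : R.PosDef) (hQ : Q.PosSemidef)
    (hP : P.PosSemidef) (hres : (-riccatiResidual ρ A B C D Q R P).PosSemidef) :
    ∃ P, IsRiccatiSolution ρ A B C D Q R P := by
  have hK := isCompact_setOf_posSemidef_trace_le (n := n) P.trace
  have hcont : ContinuousOn (fun X => -riccatiResidual ρ A B C D Q R X)
      {X | X.PosSemidef ∧ X.trace ≤ P.trace} :=
    ((continuousOn_riccatiResidual hR).mono fun _ h => h.1).neg
  have hS : IsCompact ({X | X.PosSemidef ∧ X.trace ≤ P.trace} ∩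
      (fun X => -riccatiResidual ρ A B C D Q R X) ⁻¹' {M | M.PosSemidef}) :=
    hK.of_isClosed_subset (hcont.preimage_isClosed_of_isClosed hK.isClosed isClosed_setOf_posSemidef)
      inter_subset_left
  obtain ⟨X, ⟨⟨hX, hXt⟩, hXr⟩, hmin⟩ := hS.exists_isMinOn ⟨P, ⟨hP, le_rfl⟩, hres⟩
    (f := Matrix.trace) (by fun_prop)
  obtain ⟨X', h1, h2, h3, h4⟩ := exists_smaller_riccati_supersolution hR hQ hX hXr
  have ht : X'.trace ≤ X.trace := by simpa [trace_sub] using h2.trace_nonneg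
  have ht' : X.trace ≤ X'.trace := hmin ⟨⟨h1, ht.trans hXt⟩, h3⟩
  refine ⟨X, isRiccatiSolution_iff.2 ⟨hX, h4 ?_⟩⟩
  have h5 := h2.trace_eq_zero_iff.1 (by rw [trace_sub]; linarith)
  exact (sub_eq_zero.1 h5).symm

variable {Ω : Type*} {m : MeasurableSpace Ω} {μ : Measure Ω} [IsProbabilityMeasure μ]
  {ℱ : Filtration ℝ≥0 m} {W : ℝ≥0 → Ω → ℝ}

/-- The cost matrix of a stabilizing feedback is a supersolution of the Riccati equation. -/
theorem IsRhoStabilizable.exists_isRiccatiSolution (h : IsRhoStabilizable μ ℱ W ρ A B C D)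
    (hW : IsFilteredBrownian μ ℱ W) (hR : R.PosDef) (hQ : Q.PosSemidef) :
    ∃ P, IsRiccatiSolution ρ A B C D Q R P := by
  obtain ⟨K, hK⟩ := h
  have hK' : IsRhoStable μ ℱ W ρ (A + B * K) (C + D * K) := hK
  obtain ⟨P, hP, hL⟩ := hK'.exists_lyapunov_eq hW
    (hQ.add (hR.posSemidef.conjTranspose_mul_mul_same K))
  refine exists_isRiccatiSolution_of_supersolution hR hQ hP
    (neg_riccatiResidual_posSemidef hR hP (K := K) ?_)
  have hL' : lyapunov ρ (A + B * K) (C + D * K) P + (Q + Kᵀ * R * K) = 0 := hL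
  rw [hL', neg_zero]
  exact .zero

end RiccatiExistence

theorem mainTheorem4 {Ω : Type*} {m : MeasurableSpace Ω} (μ : Measure Ω) [IsProbabilityMeasure μ]
    (ℱ : Filtration ℝ≥0 m) (W : ℝ≥0 → Ω → ℝ) (hW : IsFilteredBrownian μ ℱ W)
    (n r : ℕ) (ρ : ℝ) (hρ : 0 ≤ ρ)
    (A : Matrix (Fin n) (Fin n) ℝ) (B : Matrix (Fin n) (Fin r) ℝ)
    (C : Matrix (Fin n) (Fin n) ℝ) (D : Matrix (Fin n) (Fin r) ℝ)
    (Q : Matrix (Fin n) (Fin n) ℝ) (R : Matrix (Fin r) (Fin r) ℝ)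
    (hA3 : IsRhoStabilizable μ ℱ W ρ A B C D)
    (hR : R.PosDef) (hQ : Q.PosSemidef)
    (hA4 : IsExactlyDetectable μ ℱ W
      (A - (ρ / 2) • (1 : Matrix (Fin n) (Fin n) ℝ)) C (CFC.sqrt Q)) :
    (∃ P, IsRiccatiSolution ρ A B C D Q R P) ∧
    ∀ P, IsRiccatiSolution ρ A B C D Q R P →
      NoImaginaryAxisEigenvalue (hamiltonianMatrix ρ A B C D Q R P) →
      ∀ xbar₀ : EuclideanSpace ℝ (Fin n),
        ∃ s xbar : ℝ → EuclideanSpace ℝ (Fin n),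
          IsConsistencySolution ρ A B C D Q R P xbar₀ s xbar ∧
          ∀ s' xbar' : ℝ → EuclideanSpace ℝ (Fin n),
            IsConsistencySolution ρ A B C D Q R P xbar₀ s' xbar' →
              EqOn s' s (Ici 0) ∧ EqOn xbar' xbar (Ici 0) := by
  refine ⟨hA3.exists_isRiccatiSolution hW hR hQ, fun P hP hM xbar₀ => ?_⟩
  exact existsUnique_isConsistencySolution (posSemidef_inputMatrix hR hP.1)
    (transpose_eq_of_isHermitian hQ.isHermitian)
    (Matrix.stableSpace_eq_top fun z hz => hP.re_lt_zero hR hQ hW hA4 hz) hM xbar₀
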